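/- Let $M$ be a connected (Hausdorff, second countable, smooth) manifold with $m=\dim M\ge 4$. For a smooth symmetric $(0,2)$-tensor field $g$ on $M$ let $\Sigma$ be the set of points where $g$ degenerates, and for $p\in\Sigma$ let $\mathrm{Rad}_p=\{\xi\in T_pM: g_p(\xi,\cdot)=0\}$. $(M,g)$ is a *transverse Riemann–Lorentz manifold* if $\Sigma\neq\emptyset$, $d_p(\det(g_{ab}))\ne 0$ for every $p\in\Sigma$ (in coordinates around $p$; hence $\Sigma$ is a hypersurface and $\mathrm{Rad}_p$ is a line), and at each point of $M\setminus\Sigma$ the form $g$ is either positive definite or Lorentzian (nondegenerate of index one). Let $\mathcal C=\{e^{2f}g: f\in C^\infty(M)\}$ be the conformal class of such a $g$; all its members are transverse Riemann–Lorentz with the same $\Sigma$ and the same radical. We call $(M,\mathcal C)$ a *transverse Riemann–Lorentz conformal manifold*. The radical is *transverse* if $\mathrm{Rad}_p\not\subset T_p\Sigma$ for all $p\in\Sigma$. For $g\in\mathcal C$ let $\square_XY(Z)$ be given by the Koszul formula $$2\,\square_XY(Z)=X g(Y,Z)+Y g(X,Z)-Z g(X,Y)+g([X,Y],Z)-g([X,Z],Y)-g([Y,Z],X),$$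 so that $\square_XY(Z)=g(\nabla_XY,Z)$ off $\Sigma$, where $\nabla$ is the Levi-Civita connection of $g|_{M\setminus\Sigma}$. A vector field $R$ on an open set $U\subset M$ is *radical* if $R_p\in\mathrm{Rad}_p\setminus\{0\}$ for $p\in\Sigma\cap U$; then $II^R(X,Y)=\square_XY(R)|_\Sigma$ depends only on $X|_\Sigma,Y|_\Sigma$. Let $II^R_\Sigma$ and $g_\Sigma$ be the restrictions of $II^R$ and $g$ to vectors tangent to $\Sigma$. * $g$ is *$II$-flat on $U$* if $II^R_\Sigma=0$ on $\Sigma\cap U$ for some radical vector field $R$ on $U$. * $g$ is *conformally $II$-flat* if $II^R_\Sigma=h\,g_\Sigma$ for some radical vector field $R$ on $M$ and some $h\in C^\infty(\Sigma)$. * If the radical is transverse and $g$ is $II$-flat on $U$, then for vector fields $X,Y$ tangent to $\Sigma$ along $\Sigma$, on an open subset of $U$, the field $\nabla_XY$ extends smoothly (and uniquely) across $\Sigma$, and one puts $III^R(X,Y)=II^R(\nabla_XY,R)$. Such a $g$ is *conformally $III$-flat on $U$* if $III^R=k\,g_\Sigma$ on $\Sigma\cap U$ for some radical vector field $R$ on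 $U$ and some $k\in C^\infty(\Sigma\cap U)$. * When the radical is transverse, $\mathcal C$ is *conformally $III$-flat* if some $g\in\mathcal C$ is conformally $II$-flat and every $g\in\mathcal C$ which is $II$-flat on some open $U\subset M$ is conformally $III$-flat on $U$. The Weyl tensor of $g\in\mathcal C$ is the $(0,4)$-tensor field on $M\setminus\Sigma$ $$W=K-h\bullet g,\qquad h=\tfrac1{m-2}\Bigl\{\mathrm{Ric}-\tfrac{\mathrm{Sc}}{2(m-1)}g\Bigr\},$$ where $K$, $\mathrm{Ric}$, $\mathrm{Sc}$ are the covariant curvature ($K(x,y,x,y)>0$ for linearly independent $x,y$ on round spheres), the Ricci tensor and the scalar curvature of $g|_{M\setminus\Sigma}$, and $(\theta\bullet\omega)(x,y,z,t)=\theta(x,z)\omega(y,t)-\omega(x,t)\theta(y,z)+\omega(x,z)\theta(y,t)-\theta(x,t)\omega(y,z)$. **Theorem 3.5.** Let $(M,\mathcal C)$ be a transverse Riemann–Lorentz conformal manifold with $\dim M=m\ge4$, and let $g\in\mathcal C$. Then the Weyl tensor $W$ of $g$, defined on $M\setminus\Sigma$, extends to a smooth $(0,4)$-tensor field on the whole of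 $M$ if and only if the radical is transverse to $\Sigma$ and $\mathcal C$ is conformally $III$-flat. -/

import Mathlib

open Set Topology Bundle Manifold
open scoped ContDiff

noncomputable section

namespace RiemannLorentz

/-! ### Local formulas in a coordinate domain of `ℝᵐ` -/

/-- The coordinate space `ℝᵐ`. -/
abbrev Coord (m : ℕ) : Type := EuclideanSpace ℝ (Fin m)

/-- Bilinear forms on `ℝᵐ`. -/
abbrev Bilin (m : ℕ) : Type := Coord m →L[ℝ] Coord m →L[ℝ] ℝ

/-- The `a`-th coordinate vector `∂ₐ`. -/
def basisVec {m : ℕ} (a : Fin m) : Coord m := EuclideanSpace.single a (1 : ℝ)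

section Local

variable {m : ℕ} (G : Coord m → Bilin m)

/-- The determinant `det (g_ab)` at `y`. -/
def gramDet (y : Coord m) : ℝ :=
  (Matrix.of fun a b : Fin m => G y (basisVec a) (basisVec b)).det

/-- Christoffel symbols of the first kind, as the covector
`w ↦ ½ (∂ᵤ g(v, w) + ∂ᵥ g(u, w) - ∂_w g(u, v))`. -/
def christoffelFirst (y u v : Coord m) : Coord m →L[ℝ] ℝ :=
  (1 / 2 : ℝ) • (fderiv ℝ G y u v + fderiv ℝ G y v u - ((fderiv ℝ G y).flip u).flip v)

/-- The torsion-free metric dual connection, that is, the covector `Z ↦ □_X Y (Z)` at `y`. This is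
the Koszul formula
`2 □_X Y (Z) = X g(Y,Z) + Y g(X,Z) - Z g(X,Y) + g([X,Y],Z) - g([X,Z],Y) - g([Y,Z],X)`
expanded in coordinates. -/
def coordDualConn (X Y : Coord m → Coord m) (y : Coord m) : Coord m →L[ℝ] ℝ :=
  G y (fderiv ℝ Y y (X y)) + christoffelFirst G y (X y) (Y y)

/-- The Levi-Civita derivative `∇_X Y` at a point `y` where `G y` is nondegenerate: the vector with
`g (∇_X Y, ·) = □_X Y`. -/
def coordNabla (X Y : Coord m → Coord m) (y : Coord m) : Coord m :=
  (G y).inverse (coordDualConn G X Y y)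

/-- `∇_X ∇_Y Z - ∇_Y ∇_X Z` at `y`, for the coordinate-constant (hence commuting) vector fields
`X, Y, Z` with values `u, v, w`. -/
def coordRiem (y u v w : Coord m) : Coord m :=
  coordNabla G (fun _ => u) (coordNabla G (fun _ => v) fun _ => w) y -
    coordNabla G (fun _ => v) (coordNabla G (fun _ => u) fun _ => w) y

/-- The covariant curvature `K`, with the sign for which `K(u, v, u, v)` is positive on round
spheres. -/
def coordCurv (y u v w t : Coord m) : ℝ := G y (coordRiem G y u v t) w

/-- The Ricci tensor: `Ric(v, t)` is the trace of `u ↦ ∇_u ∇_v t - ∇_v ∇_u t`; equivalently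
`Ric(v, t) = g^{ab} K(∂ₐ, v, ∂_b, t)`. -/
def coordRic (y v t : Coord m) : ℝ := ∑ a : Fin m, coordRiem G y (basisVec a) v t a

/-- The scalar curvature `g^{ab} Ric(∂ₐ, ∂_b)`; the vector
`(G y).inverse (EuclideanSpace.proj a)` is `g^{ab} ∂_b`. -/
def coordScal (y : Coord m) : ℝ :=
  ∑ a : Fin m, coordRic G y (basisVec a)
    ((G y).inverse (EuclideanSpace.proj a : Coord m →L[ℝ] ℝ))

/-- The Schouten tensor `h = (Ric - Sc / (2 (m - 1)) g) / (m - 2)`. -/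
def coordSchouten (y u v : Coord m) : ℝ :=
  1 / ((m : ℝ) - 2) * (coordRic G y u v - coordScal G y / (2 * ((m : ℝ) - 1)) * G y u v)

/-- The Kulkarni-Nomizu product of two bilinear forms. -/
def kulkarniNomizu {V : Type*} (θ η : V → V → ℝ) (x y z t : V) : ℝ :=
  (θ x z * η y t - η x t * θ y z) + (η x z * θ y t - θ x t * η y z)

/-- The Weyl tensor `W = K - h • g`. -/
def coordWeyl (y u v w t : Coord m) : ℝ :=
  coordCurv G y u v w t - kulkarniNomizu (coordSchouten G y) (fun a b => G y a b) u v w t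

end Local

/-! ### Type-changing metrics on a manifold -/

variable (m : ℕ) (M : Type*) [TopologicalSpace M] [ChartedSpace (Coord m) M]
  [IsManifold (𝓡 m) ∞ M]

/-- A smooth symmetric covariant tensor field of order two (possibly degenerate). -/
structure SymTensorField where
  /-- The bilinear form on each tangent space. -/
  form : ∀ x : M, TangentSpace (𝓡 m) x →L[ℝ] TangentSpace (𝓡 m) x →L[ℝ] ℝ
  symm : ∀ (x : M) (u v : TangentSpace (𝓡 m) x), form x u v = form x v u
  contMDiff : ContMDiff (𝓡 m) ((𝓡 m).prod 𝓘(ℝ, Bilin m)) ∞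
    (fun x => TotalSpace.mk' (Bilin m)
      (E := fun x : M => TangentSpace (𝓡 m) x →L[ℝ] TangentSpace (𝓡 m) x →L[ℝ] ℝ) x (form x))

variable {m M}

/-- The differential at `x` of a chart. -/
def chartDiff (φ : OpenPartialHomeomorph M (Coord m)) (x : M) :
    TangentSpace (𝓡 m) x →L[ℝ] Coord m :=
  mfderiv (𝓡 m) (𝓡 m) φ x

/-- The differential at `y` of the inverse of a chart. -/
def chartSymmDiff (φ : OpenPartialHomeomorph M (Coord m)) (y : Coord m) :
    Coord m →L[ℝ] TangentSpace (𝓡 m) (φ.symm y) :=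
  mfderiv (𝓡 m) (𝓡 m) φ.symm y

/-- A vector field in the coordinates of a chart. -/
def coordField (φ : OpenPartialHomeomorph M (Coord m)) (X : ∀ x : M, TangentSpace (𝓡 m) x)
    (y : Coord m) : Coord m :=
  chartDiff φ (φ.symm y) (X (φ.symm y))

/-- A vector field (given on all of `M`, only its values on `U` matter) is smooth on `U`. -/
def SmoothFieldOn (X : ∀ x : M, TangentSpace (𝓡 m) x) (U : Set M) : Prop :=
  ContMDiffOn (𝓡 m) (𝓡 m).tangent ∞ (fun x => (⟨x, X x⟩ : TangentBundle (𝓡 m) M)) U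

variable (g : SymTensorField m M)

/-- The tensor field in the coordinates of a chart `φ`, as a function on `φ.target`. -/
def coordMetric (φ : OpenPartialHomeomorph M (Coord m)) (y : Coord m) : Bilin m :=
  let B : Bilin m := g.form (φ.symm y)
  let D : Coord m →L[ℝ] Coord m := chartSymmDiff φ y
  B.bilinearComp D D

/-- The radical of `g` at `p`. -/
def radical (p : M) : Set (TangentSpace (𝓡 m) p) := {ξ | ∀ v, g.form p ξ v = 0}

/-- The set `Σ` of the points where `g` degenerates. -/
def singularSet : Set M := {p | ∃ ξ ∈ radical g p, ξ ≠ 0}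

/-- `g` is transverse type-changing at every singular point: `d (det (g_ab)) ≠ 0` there, in any
coordinates. -/
def IsTransverseTypeChanging : Prop :=
  ∀ φ ∈ IsManifold.maximalAtlas (𝓡 m) ∞ M, ∀ p ∈ φ.source, p ∈ singularSet g →
    fderiv ℝ (gramDet (coordMetric g φ)) (φ p) ≠ 0

/-- `g` is positive definite at `p`. -/
def IsRiemannianAt (p : M) : Prop := ∀ v, v ≠ 0 → 0 < g.form p v v

/-- `g` is nondegenerate of index one at `p`: it is negative on some vector and positive definite
on the orthogonal complement of that vector. -/
def IsLorentzianAt (p : M) : Prop :=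
  ∃ u, g.form p u u < 0 ∧ ∀ v, g.form p u v = 0 → v ≠ 0 → 0 < g.form p v v

/-- `(M, g)` is a transverse Riemann-Lorentz manifold: `g` degenerates somewhere, always
transversally, and `M - Σ` consists of a riemannian and a lorentzian part. -/
structure IsTransverseRiemannLorentz : Prop where
  nonempty : (singularSet g).Nonempty
  transverse : IsTransverseTypeChanging g
  signature : ∀ p ∉ singularSet g, IsRiemannianAt g p ∨ IsLorentzianAt g p

/-! ### The hypersurface `Σ`, the dual connection and the forms `II`, `III`

Pointwise notions are computed in the preferred chart at the point; like all of the following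
notions they do not depend on the chart. -/

/-- The tangent space to `Σ` at a singular point `p`: the kernel of the differential of the local
equation `det (g_ab) = 0` of `Σ`. -/
def tangentSigma (p : M) : Set (TangentSpace (𝓡 m) p) :=
  {v | fderiv ℝ (gramDet (coordMetric g (chartAt (Coord m) p))) (chartAt (Coord m) p p)
    (chartDiff (chartAt (Coord m) p) p v) = 0}

/-- The radical is transverse to `Σ`. -/
def RadicalTransverse : Prop :=
  ∀ p ∈ singularSet g, ∀ ξ ∈ radical g p, ξ ≠ 0 → ξ ∉ tangentSigma g p

/-- The dual connection: `dualConn g X Y p w = □_X Y (w)` for `w ∈ T_p M`. -/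
def dualConn (X Y : ∀ x : M, TangentSpace (𝓡 m) x) (p : M) (w : TangentSpace (𝓡 m) p) : ℝ :=
  coordDualConn (coordMetric g (chartAt (Coord m) p)) (coordField (chartAt (Coord m) p) X)
    (coordField (chartAt (Coord m) p) Y) (chartAt (Coord m) p p)
    (chartDiff (chartAt (Coord m) p) p w)

/-- `II^ξ(u, v) = □_X Y (ξ)` at a singular point `p`, for `ξ` in the radical and vector fields
`X, Y` extending `u, v` (the value does not depend on the extensions; here they are constant in
coordinates). -/
def secondForm (p : M) (ξ u v : TangentSpace (𝓡 m) p) : ℝ :=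
  coordDualConn (coordMetric g (chartAt (Coord m) p))
    (fun _ => chartDiff (chartAt (Coord m) p) p u) (fun _ => chartDiff (chartAt (Coord m) p) p v)
    (chartAt (Coord m) p p) (chartDiff (chartAt (Coord m) p) p ξ)

/-- `R` is a radical vector field on the open set `U`. -/
def IsRadicalField (R : ∀ x : M, TangentSpace (𝓡 m) x) (U : Set M) : Prop :=
  SmoothFieldOn R U ∧ ∀ p ∈ singularSet g ∩ U, R p ∈ radical g p ∧ R p ≠ 0

/-- `X` is a vector field on the open set `V` that is tangent to `Σ` along `Σ`. -/
def IsTangentField (X : ∀ x : M, TangentSpace (𝓡 m) x) (V : Set M) : Prop :=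
  SmoothFieldOn X V ∧ ∀ p ∈ singularSet g ∩ V, X p ∈ tangentSigma g p

/-- `k ∈ C^∞(Σ ∩ U)`: near each point of `Σ ∩ U`, `k` is the restriction to `Σ` of a smooth function
on an open subset of `M`. -/
def SmoothOnSigma (k : M → ℝ) (U : Set M) : Prop :=
  ∀ p ∈ singularSet g ∩ U, ∃ V : Set M, IsOpen V ∧ p ∈ V ∧ ∃ κ : M → ℝ,
    ContMDiffOn (𝓡 m) 𝓘(ℝ, ℝ) ∞ κ V ∧ ∀ x ∈ singularSet g ∩ V, κ x = k x

/-- `g` is `II`-flat on the open set `U`: `II_Σ^R = 0` on `Σ ∩ U` for some radical field `R`. -/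
def IsIIFlatOn (U : Set M) : Prop :=
  ∃ R : ∀ x : M, TangentSpace (𝓡 m) x, IsRadicalField g R U ∧
    ∀ p ∈ singularSet g ∩ U, ∀ u ∈ tangentSigma g p, ∀ v ∈ tangentSigma g p,
      secondForm g p (R p) u v = 0

/-- `g` is conformally `II`-flat: `II_Σ^R = h g_Σ` for some radical vector field `R` on `M` and some
`h ∈ C^∞(Σ)`. -/
def IsConformallyIIFlat : Prop :=
  ∃ R : ∀ x : M, TangentSpace (𝓡 m) x, IsRadicalField g R univ ∧
    ∃ h : M → ℝ, SmoothOnSigma g h univ ∧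
      ∀ p ∈ singularSet g, ∀ u ∈ tangentSigma g p, ∀ v ∈ tangentSigma g p,
        secondForm g p (R p) u v = h p * g.form p u v

/-- `N` is the smooth extension to the open set `V` of the Levi-Civita derivative `∇_X Y`, which is
defined off `Σ` by `g (∇_X Y, ·) = □_X Y`. -/
def ExtendsNabla (X Y N : ∀ x : M, TangentSpace (𝓡 m) x) (V : Set M) : Prop :=
  SmoothFieldOn N V ∧ ∀ x ∈ V, x ∉ singularSet g → ∀ w, g.form x (N x) w = dualConn g X Y x w

/-- `g` is conformally `III`-flat on the open set `U`: it is `II`-flat on `U` and `III^R = k g_Σ` for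
some radical vector field `R` on `U` and some `k ∈ C^∞(Σ ∩ U)`. Here
`III^R(X, Y) = II^R(∇_X Y, R)` for vector fields `X, Y` tangent to `Σ`, where `∇_X Y` on `Σ` is
understood through its (unique, as `Σ` has empty interior) smooth extension. -/
def IsConformallyIIIFlatOn (U : Set M) : Prop :=
  IsIIFlatOn g U ∧ ∃ R : ∀ x : M, TangentSpace (𝓡 m) x, IsRadicalField g R U ∧
    ∃ k : M → ℝ, SmoothOnSigma g k U ∧
      ∀ V : Set M, IsOpen V → V ⊆ U → ∀ X Y : ∀ x : M, TangentSpace (𝓡 m) x,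
        IsTangentField g X V → IsTangentField g Y V →
          ∃ N : ∀ x : M, TangentSpace (𝓡 m) x, ExtendsNabla g X Y N V ∧
            ∀ p ∈ singularSet g ∩ V,
              secondForm g p (R p) (N p) (R p) = k p * g.form p (X p) (Y p)

/-! ### Conformal structures -/

/-- The conformal class `{e^{2f} g : f ∈ C^∞(M)}`. -/
def conformalClass : Set (SymTensorField m M) :=
  {g' | ∃ f : M → ℝ, ContMDiff (𝓡 m) 𝓘(ℝ, ℝ) ∞ f ∧
    ∀ x, g'.form x = Real.exp (2 * f x) • g.form x}

/-- `(M, 𝒞)` is a transverse Riemann-Lorentz conformal manifold. -/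
def IsTransverseRiemannLorentzConformal (𝒞 : Set (SymTensorField m M)) : Prop :=
  ∃ g : SymTensorField m M, IsTransverseRiemannLorentz g ∧ 𝒞 = conformalClass g

/-- `(M, 𝒞)` (with transverse radical) is conformally `III`-flat: some metric in `𝒞` is conformally
`II`-flat, and every metric in `𝒞` that is `II`-flat on some open set `U` is conformally `III`-flat
on `U`. -/
def ConformallyIIIFlat (𝒞 : Set (SymTensorField m M)) : Prop :=
  (∃ g ∈ 𝒞, IsConformallyIIFlat g) ∧
    ∀ g ∈ 𝒞, ∀ U : Set M, IsOpen U → IsIIFlatOn g U → IsConformallyIIIFlatOn g U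

/-! ### The Weyl tensor -/

/-- The Weyl tensor of `g` at a point `x ∉ Σ`. -/
def weylTensor (x : M) (v : Fin 4 → TangentSpace (𝓡 m) x) : ℝ :=
  coordWeyl (coordMetric g (chartAt (Coord m) x)) (chartAt (Coord m) x x)
    (chartDiff (chartAt (Coord m) x) x (v 0)) (chartDiff (chartAt (Coord m) x) x (v 1))
    (chartDiff (chartAt (Coord m) x) x (v 2)) (chartDiff (chartAt (Coord m) x) x (v 3))

/-- A covariant tensor field of order four is smooth: its components in every chart are. -/
def IsSmoothTensorField
    (T : ∀ x : M, MultilinearMap ℝ (fun _ : Fin 4 => TangentSpace (𝓡 m) x) ℝ) : Prop :=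
  ∀ φ ∈ IsManifold.maximalAtlas (𝓡 m) ∞ M, ∀ a : Fin 4 → Fin m,
    ContDiffOn ℝ ∞
      (fun y => T (φ.symm y) fun i => chartSymmDiff φ y (basisVec (a i))) φ.target

/-- The Weyl tensor of `g`, defined on `M - Σ`, extends to a smooth tensor field on `M`. -/
def WeylExtends : Prop :=
  ∃ T : ∀ x : M, MultilinearMap ℝ (fun _ : Fin 4 => TangentSpace (𝓡 m) x) ℝ,
    IsSmoothTensorField T ∧ ∀ x ∉ singularSet g, ∀ v, T x v = weylTensor g x v

end RiemannLorentz

end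

/-!
# Extending the Weyl tensor across the singular hypersurface

In a chart write `δ = det (g_ab)`, a defining function of `Σ`. Replacing `g⁻¹` by `adj(g) / δ`, the
curvature and the Weyl tensor of `g` become smooth tensors divided by powers of `δ`, so that the
question is when their poles cancel. At a point of `Σ` the adjugate is a nonzero multiple of
`ρ ⊗ ρ`, where `ρ` spans the radical, and a smooth tensor vanishing on `Σ` is `δ` times a smooth
tensor by Hadamard's lemma (`exists_smul_eq_of_eq_zero`).

*The leading pole.* Its coefficient is the Kulkarni-Nomizu product with the degenerate form `g` of a
form built from `II^R ⊗ II^R` and a multiple of `g`. Since `g` still has rank `m - 1 ≥ 3` on `Σ`,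
taking that product with `g` is injective (`eq_zero_of_kulkarniNomizu_eq_zero`). Hence if `W`
extends, the radical is transverse and `II^R` is a multiple `h g` of `g` on vectors tangent to `Σ`
(`WeylExtendsNear.secondForm_eq`).

*Removing it.* The Weyl tensor is conformally covariant (`ConformalGerm.coordWeyl_eq`), so `g` may
be rescaled by `e^{2f}`. When the radical is transverse, a suitable `f` vanishing on `Σ`, with normal
derivative prescribed by `h`, makes the metric `II`-flat near a given point
(`IsConformallyIIFlat.exists_isIIFlatOn`). For a `II`-flat metric the curvature tensor itself
extends smoothly to some `κ` (`FlatGerm.exists_curvExtension`).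

*The remaining pole.* Only a simple pole from the traces of `κ` is left, and it cancels exactly when
`κ(R, ·, R, ·) = k g` on `Σ` (`WeylExtendsNear.jacobi_eq`, `CurvExtension.weylExtendsNear`). On
vectors tangent to `Σ` the left side is `III^R` (`CurvExtension.thirdForm_eq`), which gives
conformal `III`-flatness.

*From charts to `M`.* The formulas are invariant under changes of coordinates
(`PullbackGerm.coordWeyl_eq`). Since `M ∖ Σ` is dense, local smooth extensions of `W` agree where
they overlap and glue. The determinant of `g` changes by a positive factor under changes of
coordinates, so `dδ(R) > 0` is a condition independent of the chart; it makes the admissible values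
of `R` a convex set, and a partition of unity gives a global radical field
(`RadicalTransverse.exists_isRadicalField`). The factor `h` is glued in the same way.
-/

namespace RiemannLorentz

/-! ### Germs of smooth maps -/

section Germs

variable {E F F' : Type*} [NormedAddCommGroup E] [NormedSpace ℝ E] [NormedAddCommGroup F]
  [NormedSpace ℝ F] [NormedAddCommGroup F'] [NormedSpace ℝ F']

/-- `f` is smooth on a neighbourhood of `p`. This is stronger than `ContDiffAt ℝ ∞ f p`, where the
neighbourhood may depend on the order of differentiability. -/
def SmoothNear (f : E → F) (p : E) : Prop := ∀ᶠ y in 𝓝 p, ContDiffAt ℝ ∞ f y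

variable {f g : E → F} {p : E}

theorem SmoothNear.contDiffAt (hf : SmoothNear f p) : ContDiffAt ℝ ∞ f p := hf.self_of_nhds

theorem SmoothNear.differentiableAt (hf : SmoothNear f p) : DifferentiableAt ℝ f p :=
  hf.contDiffAt.differentiableAt (by simp)

theorem SmoothNear.continuousAt (hf : SmoothNear f p) : ContinuousAt f p :=
  hf.contDiffAt.continuousAt

theorem SmoothNear.eventually (hf : SmoothNear f p) : ∀ᶠ q in 𝓝 p, SmoothNear f q :=
  eventually_eventually_nhds.2 hf

theorem SmoothNear.congr (hf : SmoothNear f p) (h : ∀ᶠ y in 𝓝 p, g y = f y) : SmoothNear g p := by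
  filter_upwards [hf, eventually_eventually_nhds.2 h] with y hy h'
  exact hy.congr_of_eventuallyEq h'

theorem SmoothNear.const (c : F) : SmoothNear (fun _ : E => c) p :=
  Filter.Eventually.of_forall fun _ => contDiffAt_const

theorem smoothNear_of_contDiff (hf : ContDiff ℝ ∞ f) : SmoothNear f p :=
  Filter.Eventually.of_forall fun _ => hf.contDiffAt

theorem SmoothNear.add (hf : SmoothNear f p) (hg : SmoothNear g p) :
    SmoothNear (fun y => f y + g y) p := by
  filter_upwards [hf, hg] with y h1 h2 using h1.add h2

theorem SmoothNear.sub (hf : SmoothNear f p) (hg : SmoothNear g p) :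
    SmoothNear (fun y => f y - g y) p := by
  filter_upwards [hf, hg] with y h1 h2 using h1.sub h2

theorem SmoothNear.smul {a : E → ℝ} (ha : SmoothNear a p) (hf : SmoothNear f p) :
    SmoothNear (fun y => a y • f y) p := by
  filter_upwards [hf, ha] with y h1 h2 using h2.smul h1

theorem SmoothNear.mul {a b : E → ℝ} (ha : SmoothNear a p) (hb : SmoothNear b p) :
    SmoothNear (fun y => a y * b y) p := by
  filter_upwards [hb, ha] with y h1 h2 using h2.mul h1

theorem SmoothNear.inv {a : E → ℝ} (ha : SmoothNear a p) (h0 : a p ≠ 0) :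
    SmoothNear (fun y => (a y)⁻¹) p := by
  filter_upwards [ha, ha.continuousAt.eventually_ne h0] with y h1 h2 using h1.inv h2

theorem SmoothNear.sum {ι : Type*} {s : Finset ι} {f : ι → E → F}
    (hf : ∀ i ∈ s, SmoothNear (f i) p) : SmoothNear (fun y => ∑ i ∈ s, f i y) p := by
  have : ∀ᶠ y in 𝓝 p, ∀ i ∈ s, ContDiffAt ℝ ∞ (f i) y := (Finset.eventually_all s).2 hf
  filter_upwards [this] with y h using ContDiffAt.sum h

theorem SmoothNear.clm_apply {A : E → F →L[ℝ] F'} (hA : SmoothNear A p) (hf : SmoothNear f p) :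
    SmoothNear (fun y => A y (f y)) p := by
  filter_upwards [hA, hf] with y h1 h2 using h1.clm_apply h2

theorem SmoothNear.fderiv_right (hf : SmoothNear f p) : SmoothNear (fderiv ℝ f) p := by
  filter_upwards [hf] with y h using h.fderiv_right (by simp)

theorem SmoothNear.comp {h : F → F'} (hh : SmoothNear h (f p)) (hf : SmoothNear f p) :
    SmoothNear (fun y => h (f y)) p := by
  filter_upwards [hf, hf.continuousAt.eventually hh] with y h1 h2 using h2.comp y h1

theorem smoothNear_of_contDiffOn {s : Set E} (hf : ContDiffOn ℝ ∞ f s) (hs : IsOpen s)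
    (hp : p ∈ s) : SmoothNear f p := by
  filter_upwards [hs.mem_nhds hp] with y hy using hf.contDiffAt (hs.mem_nhds hy)

end Germs

/-! ### Division by a defining function -/

section Hadamard

open MeasureTheory

theorem contDiff_nat_integral {E : Type} [NormedAddCommGroup E] [NormedSpace ℝ E]
    [FiniteDimensional ℝ E] (n : ℕ) :
    ∀ {V : Type} [NormedAddCommGroup V] [NormedSpace ℝ V]
      (F : E × ℝ → V), ContDiff ℝ ∞ F →
        ContDiff ℝ n (fun x : E => ∫ s in (0 : ℝ)..1, F (x, s)) := by
  induction n with
  | zero =>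
    intro V _ _ F hF
    refine contDiff_zero.2 ?_
    exact intervalIntegral.continuous_parametric_intervalIntegral_of_continuous'
      (f := fun x s => F (x, s)) (by simpa [Function.uncurry] using! hF.continuous) 0 1
  | succ n ih =>
    intro V _ _ F hF
    set F' : E × ℝ → E →L[ℝ] V := fun z => (fderiv ℝ F z).comp (ContinuousLinearMap.inl ℝ E ℝ)
    have hF' : ContDiff ℝ ∞ F' :=
      (hF.fderiv_right (m := ∞) (by simp)).clm_comp contDiff_const
    have hd : ∀ x s, HasFDerivAt (fun x => F (x, s)) (F' (x, s)) x := fun x s =>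
      ((hF.differentiable (by simp)) (x, s)).hasFDerivAt.comp x
        ((hasFDerivAt_id x).prodMk (hasFDerivAt_const s x))
    have key : ∀ x, HasFDerivAt (fun x => ∫ s in (0 : ℝ)..1, F (x, s))
        (∫ s in (0 : ℝ)..1, F' (x, s)) x := by
      intro x
      obtain ⟨C, hC⟩ := ((isCompact_closedBall x 1).prod isCompact_Icc).exists_bound_of_continuousOn
        (f := F') hF'.continuous.continuousOn
      have hc : ∀ y, Continuous fun s => F (y, s) := fun y => hF.continuous.comp (by fun_prop)
      have hc' : ∀ y, Continuous fun s => F' (y, s) := fun y => hF'.continuous.comp (by fun_prop)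
      refine intervalIntegral.hasFDerivAt_integral_of_dominated_of_fderiv_le (𝕜 := ℝ)
        (F := fun y s => F (y, s)) (F' := fun y s => F' (y, s)) (bound := fun _ => C)
        (Metric.ball_mem_nhds x one_pos) ?_ ?_ ?_ ?_ ?_ ?_
      · exact Filter.Eventually.of_forall fun y => (hc y).aestronglyMeasurable
      · exact (hc x).intervalIntegrable _ _
      · exact (hc' x).aestronglyMeasurable
      · refine Filter.Eventually.of_forall fun s hs y hy => hC (y, s)
          ⟨Metric.ball_subset_closedBall hy, ?_⟩
        rw [uIoc_of_le zero_le_one] at hs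
        exact ⟨hs.1.le, hs.2⟩
      · exact intervalIntegrable_const
      · exact Filter.Eventually.of_forall fun s _ y _ => hd y s
    push_cast
    refine (contDiff_succ_iff_fderiv (n := (n : WithTop ℕ∞))).2
      ⟨fun x => (key x).differentiableAt, by simp, ?_⟩
    rw [show fderiv ℝ (fun x => ∫ s in (0 : ℝ)..1, F (x, s)) = fun x => ∫ s in (0 : ℝ)..1, F' (x, s)
      from funext fun x => HasFDerivAt.fderiv (key x)]
    exact ih F' hF'

theorem contDiff_integral {E V : Type} [NormedAddCommGroup E] [NormedSpace ℝ E]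
    [FiniteDimensional ℝ E] [NormedAddCommGroup V] [NormedSpace ℝ V]
    {F : E × ℝ → V} (hF : ContDiff ℝ ∞ F) : ContDiff ℝ ∞ fun x => ∫ s in (0 : ℝ)..1, F (x, s) :=
  contDiff_infty.2 fun n => contDiff_nat_integral n F hF

/-- Hadamard's lemma for a linear defining function. -/
theorem exists_smul_eq_of_eq_zero_of_linear {E V : Type} [NormedAddCommGroup E] [NormedSpace ℝ E]
    [FiniteDimensional ℝ E] [NormedAddCommGroup V] [NormedSpace ℝ V] [CompleteSpace V]
    {F : E → V} (hF : ContDiff ℝ ∞ F) (l : E →L[ℝ] ℝ) (e : E) (he : l e = 1)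
    (h0 : ∀ z, l z = 0 → F z = 0) :
    ∃ Q : E → V, ContDiff ℝ ∞ Q ∧ ∀ z, F z = l z • Q z := by
  refine ⟨fun z => ∫ s in (0 : ℝ)..1, fderiv ℝ F (z - ((1 - s) * l z) • e) e, ?_, ?_⟩
  · refine contDiff_integral (F := fun zs : E × ℝ =>
      fderiv ℝ F (zs.1 - ((1 - zs.2) * l zs.1) • e) e) ?_
    have h1 : ContDiff ℝ ∞ (fderiv ℝ F) := hF.fderiv_right (by simp)
    have h2 : ContDiff ℝ ∞ fun zs : E × ℝ => zs.1 - ((1 - zs.2) * l zs.1) • e := by fun_prop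
    exact (h1.comp h2).clm_apply contDiff_const
  · intro z
    have hd : ∀ s : ℝ, HasDerivAt (fun s : ℝ => F (z - ((1 - s) * l z) • e))
        (l z • fderiv ℝ F (z - ((1 - s) * l z) • e) e) s := by
      intro s
      have h1 : HasDerivAt (fun s : ℝ => z - ((1 - s) * l z) • e) (l z • e) s := by
        have := (((((hasDerivAt_id s).const_sub 1).mul_const (l z)).smul_const e).const_sub z)
        simpa using! this
      have := ((hF.differentiable (by simp)) (z - ((1 - s) * l z) • e)).hasFDerivAt
        |>.comp_hasDerivAt s h1
      simpa using! this
    have hcont : Continuous fun s : ℝ => l z • fderiv ℝ F (z - ((1 - s) * l z) • e) e := by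
      have h1 : Continuous (fderiv ℝ F) := hF.continuous_fderiv (by simp)
      have h2 : Continuous fun s : ℝ => z - ((1 - s) * l z) • e := by fun_prop
      exact ((h1.comp h2).clm_apply continuous_const).const_smul _
    have := intervalIntegral.integral_eq_sub_of_hasDerivAt (fun s _ => hd s)
      (hcont.intervalIntegrable 0 1)
    rw [intervalIntegral.integral_smul] at this
    rw [this]
    simp [h0 (z - l z • e) (by simp [he])]

/-- Hadamard's lemma: a map that is smooth near `p` and vanishes on the hypersurface `δ = 0` is
a multiple of `δ` near `p`. -/
theorem exists_smul_eq_of_eq_zero {E V : Type} [NormedAddCommGroup E] [NormedSpace ℝ E]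
    [FiniteDimensional ℝ E] [NormedAddCommGroup V] [NormedSpace ℝ V] [CompleteSpace V]
    {F : E → V} {δ : E → ℝ} {p : E} (hF : SmoothNear F p) (hδ : SmoothNear δ p)
    (hp : fderiv ℝ δ p ≠ 0) (h0 : ∀ᶠ y in 𝓝 p, δ y = 0 → F y = 0) :
    ∃ Q : E → V, SmoothNear Q p ∧ ∀ᶠ y in 𝓝 p, F y = δ y • Q y := by
  obtain ⟨e, he⟩ : ∃ e, fderiv ℝ δ p e = 1 := by
    obtain ⟨v, hv⟩ : ∃ v, fderiv ℝ δ p v ≠ 0 := by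
      by_contra! h
      exact hp (ContinuousLinearMap.ext h)
    exact ⟨(fderiv ℝ δ p v)⁻¹ • v, by simp [hv]⟩
  set l := fderiv ℝ δ p with hl
  -- In the coordinates `Φ` the defining function `δ` is the linear form `l`.
  set Φ : E → E := fun y => y + (δ y - l y) • e with hΦ
  have hΦs : SmoothNear Φ p := by
    filter_upwards [hδ] with y hy
    exact contDiffAt_id.add ((hy.sub l.contDiff.contDiffAt).smul contDiffAt_const)
  have hlΦ : ∀ y, l (Φ y) = δ y := fun y => by simp [hΦ, he]
  have hΦd : HasFDerivAt Φ ((ContinuousLinearEquiv.refl ℝ E : E ≃L[ℝ] E) : E →L[ℝ] E) p := by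
    have h1 : HasFDerivAt (fun y => δ y - l y) (0 : E →L[ℝ] ℝ) p := by
      have := hδ.differentiableAt.hasFDerivAt.sub l.hasFDerivAt
      simpa [← hl] using! this
    have := (hasFDerivAt_id p).add (h1.smul_const e)
    refine this.congr_fderiv ?_
    ext v; simp
  set Ψ := hΦs.contDiffAt.toOpenPartialHomeomorph Φ hΦd (by simp) with hΨ
  have hΨc : (Ψ : E → E) = Φ := rfl
  have hps : p ∈ Ψ.source := hΦs.contDiffAt.mem_toOpenPartialHomeomorph_source hΦd (by simp)
  have hinv : SmoothNear Ψ.symm (Φ p) := by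
    have hdet : ∀ᶠ y in 𝓝 p, ContDiffAt ℝ ∞ Φ y ∧ y ∈ Ψ.source ∧
        ∃ e' : E ≃L[ℝ] E, (e' : E →L[ℝ] E) = fderiv ℝ Φ y := by
      have hc : ContinuousAt (fderiv ℝ Φ) p := hΦs.fderiv_right.continuousAt
      have h1 := hc.eventually ((ContinuousLinearEquiv.isOpen (𝕜 := ℝ) (E := E) (F := E)).mem_nhds
        ⟨ContinuousLinearEquiv.refl ℝ E, hΦd.fderiv.symm⟩)
      filter_upwards [hΦs, Ψ.open_source.mem_nhds hps, h1] with y a b c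
      exact ⟨a, b, c⟩
    have hcs : Filter.Tendsto Ψ.symm (𝓝 (Φ p)) (𝓝 p) := Ψ.tendsto_symm hps
    filter_upwards [hcs.eventually hdet, Ψ.open_target.mem_nhds (Ψ.map_source hps)]
      with z ⟨h1, _, e', he'⟩ h3
    refine Ψ.contDiffAt_symm (f₀' := e') h3 ?_ (by rw [hΨc]; exact h1)
    rw [he', hΨc]
    exact (h1.differentiableAt (by simp)).hasFDerivAt
  have hsymp : Ψ.symm (Φ p) = p := Ψ.left_inv hps
  have hFs : SmoothNear (fun z => F (Ψ.symm z)) (Φ p) :=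
    SmoothNear.comp (by rw [hsymp]; exact hF) hinv
  have hz : ∀ᶠ z in 𝓝 (Φ p), ContDiffAt ℝ ∞ (fun z => F (Ψ.symm z)) z ∧
      (l z = 0 → F (Ψ.symm z) = 0) := by
    have hcs : Filter.Tendsto Ψ.symm (𝓝 (Φ p)) (𝓝 p) := Ψ.tendsto_symm hps
    filter_upwards [hFs, hcs.eventually h0, Ψ.open_target.mem_nhds (Ψ.map_source hps)]
      with z h1 h2 h3
    refine ⟨h1, fun hz => h2 ?_⟩
    rw [← hlΦ, ← hΨc, Ψ.right_inv h3, hz]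
  obtain ⟨r, hr, hball⟩ := Metric.eventually_nhds_iff_ball.1 hz
  let χ : ContDiffBump (Φ p) := ⟨r / 4, r / 2, by positivity, by linarith⟩
  have hχs : ContDiff ℝ ∞ (fun z => χ z • F (Ψ.symm z)) := by
    rw [contDiff_iff_contDiffAt]
    intro z
    by_cases hzr : z ∈ Metric.ball (Φ p) r
    · exact χ.contDiffAt.smul (hball z hzr).1
    · have : (fun z => χ z • F (Ψ.symm z)) =ᶠ[𝓝 z] fun _ => 0 := by
        have : z ∈ (Metric.closedBall (Φ p) (r / 2))ᶜ := by
          simp only [Metric.mem_ball, mem_compl_iff, Metric.mem_closedBall, not_lt, not_le] at hzr ⊢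
          linarith
        filter_upwards [Metric.isClosed_closedBall.isOpen_compl.mem_nhds this] with w hw
        rw [χ.zero_of_le_dist, zero_smul]
        simp only [mem_compl_iff, Metric.mem_closedBall, not_le] at hw
        exact hw.le
      exact contDiffAt_const.congr_of_eventuallyEq this
  obtain ⟨Q, hQ, hQe⟩ := exists_smul_eq_of_eq_zero_of_linear hχs l e he (by
    intro z hz
    by_cases hzr : z ∈ Metric.ball (Φ p) r
    · simp [(hball z hzr).2 hz]
    · rw [χ.zero_of_le_dist, zero_smul]
      simp only [Metric.mem_ball, not_lt] at hzr
      exact le_trans (by change r / 2 ≤ r; linarith) hzr)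
  refine ⟨fun y => Q (Φ y), SmoothNear.comp (smoothNear_of_contDiff hQ) hΦs, ?_⟩
  have hn : ∀ᶠ y in 𝓝 p, Φ y ∈ Metric.ball (Φ p) (r / 4) :=
    hΦs.continuousAt.eventually (Metric.ball_mem_nhds _ (by positivity))
  filter_upwards [hn, Ψ.open_source.mem_nhds hps] with y hy hys
  have h1 := hQe (Φ y)
  rw [χ.one_of_mem_closedBall (Metric.ball_subset_closedBall hy), one_smul, hlΦ] at h1
  rw [← h1, ← hΨc, Ψ.left_inv hys]

section Hypersurface

variable {E : Type} [NormedAddCommGroup E] [NormedSpace ℝ E] {δ : E → ℝ} {p : E}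

/-- The complement of a regular level set is dense: `p` is a limit of points where `δ ≠ 0`. -/
theorem neBot_nhdsWithin_ne_zero (hp : fderiv ℝ δ p ≠ 0) :
    (𝓝[{y | δ y ≠ 0}] p).NeBot := by
  rw [← mem_closure_iff_nhdsWithin_neBot]
  by_contra h
  have h1 : (closure {y | δ y ≠ 0})ᶜ ∈ 𝓝 p := isClosed_closure.isOpen_compl.mem_nhds h
  refine hp ?_
  have : δ =ᶠ[𝓝 p] fun _ => 0 := by
    filter_upwards [h1] with y hy
    by_contra hne
    exact hy (subset_closure hne)
  rw [this.fderiv_eq]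
  simp

/-- Two maps that agree off a regular hypersurface agree on it. -/
theorem eq_of_eventually_ne_zero {V : Type*} [TopologicalSpace V] [T2Space V] {F F' : E → V}
    (hp : fderiv ℝ δ p ≠ 0) (hF : ContinuousAt F p) (hF' : ContinuousAt F' p)
    (h : ∀ᶠ y in 𝓝 p, δ y ≠ 0 → F y = F' y) : F p = F' p := by
  have := neBot_nhdsWithin_ne_zero hp
  have h2 : F =ᶠ[𝓝[{y | δ y ≠ 0}] p] F' := by
    filter_upwards [nhdsWithin_le_nhds h, self_mem_nhdsWithin] with y h1 h2 using h1 h2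
  exact tendsto_nhds_unique_of_eventuallyEq (hF.tendsto.mono_left nhdsWithin_le_nhds)
    (hF'.tendsto.mono_left nhdsWithin_le_nhds) h2

theorem SmoothNear.eventually_fderiv_ne_zero (hδ : SmoothNear δ p) (hp : fderiv ℝ δ p ≠ 0) :
    ∀ᶠ y in 𝓝 p, fderiv ℝ δ y ≠ 0 :=
  hδ.fderiv_right.continuousAt.eventually_ne hp

/-- Two maps that are smooth near `p` and agree off a regular hypersurface agree near `p`. -/
theorem eventually_eq_of_eventually_ne_zero {V : Type*} [NormedAddCommGroup V] [NormedSpace ℝ V]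
    {F F' : E → V} (hδ : SmoothNear δ p) (hp : fderiv ℝ δ p ≠ 0) (hF : SmoothNear F p)
    (hF' : SmoothNear F' p) (h : ∀ᶠ y in 𝓝 p, δ y ≠ 0 → F y = F' y) :
    ∀ᶠ y in 𝓝 p, F y = F' y := by
  filter_upwards [hδ.eventually_fderiv_ne_zero hp, hF, hF', eventually_eventually_nhds.2 h]
    with y h2 h3 h4 h5
  exact eq_of_eventually_ne_zero h2 h3.continuousAt
    h4.continuousAt h5

/-- The differential of a map vanishing on the hypersurface `δ = 0` is a multiple of `dδ`. -/
theorem exists_fderiv_apply_eq_smul [FiniteDimensional ℝ E] {V : Type} [NormedAddCommGroup V]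
    [NormedSpace ℝ V] [CompleteSpace V] {F : E → V} (hF : SmoothNear F p) (hδ : SmoothNear δ p)
    (hp : fderiv ℝ δ p ≠ 0) (hδp : δ p = 0) (h0 : ∀ᶠ y in 𝓝 p, δ y = 0 → F y = 0) :
    ∃ w : V, ∀ u, fderiv ℝ F p u = fderiv ℝ δ p u • w := by
  obtain ⟨Q, hQ, hFQ⟩ := exists_smul_eq_of_eq_zero hF hδ hp h0
  refine ⟨Q p, fun u => ?_⟩
  have h1 : F =ᶠ[𝓝 p] fun y => δ y • Q y := hFQ
  rw [h1.fderiv_eq, fderiv_fun_smul hδ.differentiableAt hQ.differentiableAt]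
  simp [hδp]

end Hypersurface

end Hadamard

/-! ### Shortcut instances

Typeclass search on nested spaces of continuous linear maps is slow without them. -/

noncomputable section Shortcuts

variable (m : ℕ)

scoped instance : NormedAddCommGroup (Coord m) := inferInstance
scoped instance : NormedSpace ℝ (Coord m) := inferInstance
scoped instance : NormedAddCommGroup (Coord m →L[ℝ] ℝ) := ContinuousLinearMap.toNormedAddCommGroup
scoped instance : NormedSpace ℝ (Coord m →L[ℝ] ℝ) := ContinuousLinearMap.toNormedSpace
scoped instance : NormedAddCommGroup (Bilin m) := ContinuousLinearMap.toNormedAddCommGroup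
scoped instance : NormedSpace ℝ (Bilin m) := ContinuousLinearMap.toNormedSpace
scoped instance : NormedAddCommGroup (Coord m →L[ℝ] Bilin m) :=
  ContinuousLinearMap.toNormedAddCommGroup
scoped instance : NormedSpace ℝ (Coord m →L[ℝ] Bilin m) := ContinuousLinearMap.toNormedSpace

end Shortcuts

/-! ### The adjugate of a bilinear form -/

section Adjugate

variable {m : ℕ} {G : Coord m → Bilin m} {p y : Coord m}

theorem sum_smul_basisVec (v : Coord m) : ∑ a, v a • basisVec a = v := by
  ext i
  simp [basisVec, Pi.single_apply]

theorem basisVec_apply (a b : Fin m) : basisVec a b = if b = a then (1 : ℝ) else 0 := by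
  simp [basisVec]

theorem covector_apply (α : Coord m →L[ℝ] ℝ) (v : Coord m) :
    α v = ∑ a, v a * α (basisVec a) := by
  conv_lhs => rw [← sum_smul_basisVec v]
  simp

theorem covector_eq_sum (α : Coord m →L[ℝ] ℝ) :
    α = ∑ a, α (basisVec a) • (EuclideanSpace.proj a : Coord m →L[ℝ] ℝ) := by
  ext v
  rw [covector_apply α v]
  simp [mul_comm]

/-- The matrix `(g_ab)` at `y`. -/
noncomputable def gramMatrix (G : Coord m → Bilin m) (y : Coord m) : Matrix (Fin m) (Fin m) ℝ :=
  Matrix.of fun a b => G y (basisVec a) (basisVec b)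

theorem gramDet_eq : gramDet G y = (gramMatrix G y).det := rfl

/-- The adjugate of `G y`, as a map from covectors to vectors: `gramDet G y` times the inverse of
`G y` where the latter exists, but smooth everywhere. -/
noncomputable def adjMap (G : Coord m → Bilin m) (y : Coord m) :
    (Coord m →L[ℝ] ℝ) →L[ℝ] Coord m :=
  ∑ a, ∑ b, (gramMatrix G y).adjugate b a •
    (ContinuousLinearMap.apply ℝ ℝ (basisVec b : Coord m)).smulRight (basisVec a)

theorem adjMap_apply (α : Coord m →L[ℝ] ℝ) :
    adjMap G y α = ∑ a, ∑ b, ((gramMatrix G y).adjugate b a * α (basisVec b)) • basisVec a := by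
  simp [adjMap, smul_smul]

theorem adjMap_apply_coord (α : Coord m →L[ℝ] ℝ) (a : Fin m) :
    adjMap G y α a = ∑ b, (gramMatrix G y).adjugate b a * α (basisVec b) := by
  rw [adjMap_apply]
  simp [basisVec_apply, Finset.sum_apply]

theorem apply_adjMap (α : Coord m →L[ℝ] ℝ) : G y (adjMap G y α) = gramDet G y • α := by
  ext v
  rw [covector_apply (G y _) v, smul_apply, covector_apply α v, smul_eq_mul,
    Finset.mul_sum]
  refine Finset.sum_congr rfl fun c _ => ?_
  have h : ∀ b, ∑ a, (gramMatrix G y).adjugate b a * gramMatrix G y a c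
      = if b = c then gramDet G y else 0 := fun b => by
    rw [← Matrix.mul_apply, Matrix.adjugate_mul]
    simp [Matrix.one_apply, gramDet_eq]
  have : G y (adjMap G y α) (basisVec c) = gramDet G y * α (basisVec c) := by
    rw [adjMap_apply]
    simp only [map_sum, map_smul, sum_apply, smul_apply,
      smul_eq_mul]
    rw [Finset.sum_comm]
    have h2 : ∀ b, ∑ a, (gramMatrix G y).adjugate b a * α (basisVec b) *
        G y (basisVec a) (basisVec c) = α (basisVec b) * if b = c then gramDet G y else 0 := by
      intro b
      rw [← h b, Finset.mul_sum]
      exact Finset.sum_congr rfl fun a _ => by simp [gramMatrix]; ring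
    simp [h2, mul_comm]
  rw [this]; ring

theorem adjMap_apply_self (v : Coord m) : adjMap G y (G y v) = gramDet G y • v := by
  ext a
  rw [adjMap_apply_coord]
  have h : ∀ d, ∑ b, gramMatrix G y d b * (gramMatrix G y).adjugate b a
      = if d = a then gramDet G y else 0 := fun d => by
    rw [← Matrix.mul_apply, Matrix.mul_adjugate]
    simp [Matrix.one_apply, gramDet_eq]
  have h2 : ∀ b, (gramMatrix G y).adjugate b a * G y v (basisVec b)
      = ∑ d, v d * (gramMatrix G y d b * (gramMatrix G y).adjugate b a) := by
    intro b
    conv_lhs => rw [← sum_smul_basisVec v]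
    simp only [map_sum, map_smul, sum_apply, smul_apply,
      smul_eq_mul, Finset.mul_sum]
    exact Finset.sum_congr rfl fun d _ => by simp [gramMatrix]; ring
  simp_rw [h2]
  rw [Finset.sum_comm]
  simp_rw [← Finset.mul_sum, h]
  simp [mul_comm]

theorem apply_adjMap_comm (hG : ∀ u v, G y u v = G y v u) (α β : Coord m →L[ℝ] ℝ) :
    α (adjMap G y β) = β (adjMap G y α) := by
  have hs : (gramMatrix G y).transpose = gramMatrix G y := by
    ext a b; simp [gramMatrix, hG (basisVec a)]
  have hs' : ∀ a b, (gramMatrix G y).adjugate a b = (gramMatrix G y).adjugate b a := by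
    intro a b
    conv_lhs => rw [← hs, ← Matrix.adjugate_transpose, Matrix.transpose_apply]
  rw [adjMap_apply, adjMap_apply]
  simp only [map_sum, map_smul, smul_eq_mul]
  rw [Finset.sum_comm]
  exact Finset.sum_congr rfl fun a _ => Finset.sum_congr rfl fun b _ => by rw [hs' a b]; ring

theorem inverse_eq_smul_adjMap (h : gramDet G y ≠ 0) :
    (G y).inverse = (gramDet G y)⁻¹ • adjMap G y := by
  refine ContinuousLinearMap.inverse_eq ?_ ?_
  · ext α v; simp [apply_adjMap, h]
  · ext v; simp [adjMap_apply_self, h]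

theorem inverse_apply (h : gramDet G y ≠ 0) (α : Coord m →L[ℝ] ℝ) :
    G y ((G y).inverse α) = α := by
  rw [inverse_eq_smul_adjMap h]; simp [apply_adjMap, h]

theorem inverse_apply_self (h : gramDet G y ≠ 0) (v : Coord m) : (G y).inverse (G y v) = v := by
  rw [inverse_eq_smul_adjMap h]; simp [adjMap_apply_self, h]

theorem gramDet_eq_zero_iff : gramDet G y = 0 ↔ ∃ v, v ≠ 0 ∧ G y v = 0 := by
  rw [gramDet_eq, ← Matrix.exists_vecMul_eq_zero_iff]
  have key : ∀ v : Coord m, Matrix.vecMul v (gramMatrix G y) = 0 ↔ G y v = 0 := by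
    intro v
    have : ∀ b, Matrix.vecMul v (gramMatrix G y) b = G y v (basisVec b) := by
      intro b
      conv_rhs => rw [← sum_smul_basisVec v]
      simp [Matrix.vecMul, dotProduct, gramMatrix]
    constructor
    · intro h
      ext w
      rw [covector_apply]
      simp [← this, h]
    · intro h
      ext b
      simp [this, h]
  constructor
  · rintro ⟨v, hv, h⟩
    refine ⟨WithLp.toLp 2 v, fun h0 => hv (by simpa using congrArg WithLp.ofLp h0), (key _).1 h⟩
  · rintro ⟨v, hv, h⟩
    exact ⟨v, fun h0 => hv (by ext i; simpa using congrFun h0 i), (key _).2 h⟩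

/-- The adjugate vanishes where the kernel is at least two-dimensional. -/
theorem adjMap_eq_zero (hG : ∀ u v, G y u v = G y v u) {v₁ v₂ : Coord m} (h₁ : G y v₁ = 0)
    (h₂ : G y v₂ = 0) (hv : LinearIndependent ℝ ![v₁, v₂]) : adjMap G y = 0 := by
  have hadj : (gramMatrix G y).adjugate = 0 := by
    ext i j
    rw [Matrix.adjugate_apply, Matrix.zero_apply, ← Matrix.exists_mulVec_eq_zero_iff]
    -- a kernel vector with vanishing `i`-th coordinate
    obtain ⟨x, hx, hxi, hGx⟩ : ∃ x : Coord m, x ≠ 0 ∧ x i = 0 ∧ G y x = 0 := by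
      rw [LinearIndependent.pair_iff] at hv
      by_cases h0 : v₁ i = 0
      · exact ⟨v₁, fun h => by simpa [h] using hv 1 0, h0, h₁⟩
      · refine ⟨v₂ i • v₁ + (-v₁ i) • v₂, fun h => h0 ?_, by simp; ring, by simp [h₁, h₂]⟩
        simpa using (hv _ _ h).2
    refine ⟨x, fun h => hx (by ext k; simpa using congrFun h k), ?_⟩
    ext a
    by_cases ha : a = j
    · subst ha
      simp [Matrix.mulVec, dotProduct, Pi.single_apply, hxi]
    · simp only [Matrix.mulVec, dotProduct, Matrix.updateRow_ne ha, gramMatrix, Matrix.of_apply,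
        Pi.zero_apply]
      have := covector_apply (G y (basisVec a)) x
      rw [hG, hGx] at this
      rw [← show _ = _ from Finset.sum_congr rfl fun b _ => mul_comm (x b) _]
      simpa using this.symm
  ext α a
  simp [adjMap_apply, hadj]

end Adjugate

/-! ### Germs of degenerate metrics -/

section LocalMetric

variable {m : ℕ} {G : Coord m → Bilin m} {p q : Coord m}

/-- `G` is smooth and symmetric near `p`. -/
structure LocalMetric (G : Coord m → Bilin m) (p : Coord m) : Prop where
  smooth : SmoothNear G p
  symm : ∀ᶠ y in 𝓝 p, ∀ u v, G y u v = G y v u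

/-- `G` is smooth and symmetric near `p`, and `p` is a regular point of its determinant. -/
structure TransverseMetric (G : Coord m → Bilin m) (p : Coord m) : Prop extends
    LocalMetric G p where
  fderiv_ne : fderiv ℝ (gramDet G) p ≠ 0

theorem smoothNear_det {f : Coord m → Matrix (Fin m) (Fin m) ℝ}
    (hf : ∀ a b, SmoothNear (fun y => f y a b) p) : SmoothNear (fun y => (f y).det) p := by
  simp only [Matrix.det_apply]
  have : ∀ᶠ y in 𝓝 p, ∀ a b, ContDiffAt ℝ ∞ (fun y => f y a b) y := by
    simpa [Filter.eventually_all] using! hf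
  filter_upwards [this] with y hy
  refine ContDiffAt.sum fun σ _ => ?_
  simp only [Units.smul_def, zsmul_eq_mul]
  exact contDiffAt_const.mul (contDiffAt_prod fun a _ => hy _ _)

theorem LocalMetric.eventually (hG : LocalMetric G p) : ∀ᶠ q in 𝓝 p, LocalMetric G q := by
  filter_upwards [hG.smooth.eventually, eventually_eventually_nhds.2 hG.symm] with q h1 h2
    using ⟨h1, h2⟩

theorem LocalMetric.symm_self (hG : LocalMetric G p) (u v : Coord m) : G p u v = G p v u :=
  hG.symm.self_of_nhds u v

theorem LocalMetric.smooth_apply (hG : LocalMetric G p) (u v : Coord m) :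
    SmoothNear (fun y => G y u v) p :=
  (hG.smooth.clm_apply (.const u)).clm_apply (.const v)

theorem LocalMetric.smooth_gramDet (hG : LocalMetric G p) : SmoothNear (gramDet G) p :=
  smoothNear_det fun _ _ => hG.smooth_apply _ _

theorem LocalMetric.smooth_adjMap (hG : LocalMetric G p) : SmoothNear (adjMap G) p := by
  refine SmoothNear.sum fun a _ => SmoothNear.sum fun b _ => SmoothNear.smul ?_ (.const _)
  simp only [Matrix.adjugate_apply]
  refine smoothNear_det fun i j => ?_
  by_cases h : i = a
  · subst h; simp only [Matrix.updateRow_self]; exact .const _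
  · simp only [Matrix.updateRow_ne h]; exact hG.smooth_apply _ _

theorem TransverseMetric.eventually (hG : TransverseMetric G p) :
    ∀ᶠ q in 𝓝 p, TransverseMetric G q := by
  filter_upwards [hG.toLocalMetric.eventually,
    hG.smooth_gramDet.eventually_fderiv_ne_zero hG.fderiv_ne] with q h1 h2 using ⟨h1, h2⟩

theorem fderiv_apply₂ (hG : DifferentiableAt ℝ G p) (u v w : Coord m) :
    fderiv ℝ (fun y => G y u v) p w = fderiv ℝ G p w u v := by
  rw [fderiv_clm_apply (hG.clm_apply (differentiableAt_const u)) (differentiableAt_const v),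
    fderiv_clm_apply hG (differentiableAt_const u)]
  simp

theorem LocalMetric.fderiv_symm (hG : LocalMetric G p) (w u v : Coord m) :
    fderiv ℝ G p w u v = fderiv ℝ G p w v u := by
  rw [← fderiv_apply₂ hG.smooth.differentiableAt, ← fderiv_apply₂ hG.smooth.differentiableAt]
  have : (fun y => G y u v) =ᶠ[𝓝 p] fun y => G y v u := by
    filter_upwards [hG.symm] with y hy using hy u v
  rw [this.fderiv_eq]

theorem christoffelFirst_apply (u v w : Coord m) : christoffelFirst G p u v w =
    1 / 2 * (fderiv ℝ G p u v w + fderiv ℝ G p v u w - fderiv ℝ G p w u v) := by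
  simp [christoffelFirst]

theorem LocalMetric.christoffelFirst_comm (hG : LocalMetric G p) (u v : Coord m) :
    christoffelFirst G p u v = christoffelFirst G p v u := by
  ext w
  rw [christoffelFirst_apply, christoffelFirst_apply, hG.fderiv_symm w u v]
  ring

/-- Metric compatibility of the Levi-Civita connection. -/
theorem LocalMetric.fderiv_eq_christoffelFirst (hG : LocalMetric G p) (u v w : Coord m) :
    fderiv ℝ G p u v w = christoffelFirst G p u v w + christoffelFirst G p u w v := by
  rw [christoffelFirst_apply, christoffelFirst_apply, hG.fderiv_symm u w v, hG.fderiv_symm w u v,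
    hG.fderiv_symm v u w]
  ring

theorem christoffelFirst_add_left (u u' v : Coord m) :
    christoffelFirst G p (u + u') v = christoffelFirst G p u v + christoffelFirst G p u' v := by
  ext w; simp only [christoffelFirst_apply, map_add, add_apply]; ring

theorem christoffelFirst_smul_left (a : ℝ) (u v : Coord m) :
    christoffelFirst G p (a • u) v = a • christoffelFirst G p u v := by
  ext w
  simp only [christoffelFirst_apply, map_smul, smul_apply, smul_eq_mul]; ring

theorem christoffelFirst_add_right (u v v' : Coord m) :
    christoffelFirst G p u (v + v') = christoffelFirst G p u v + christoffelFirst G p u v' := by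
  ext w; simp only [christoffelFirst_apply, map_add, add_apply]; ring

theorem christoffelFirst_smul_right (a : ℝ) (u v : Coord m) :
    christoffelFirst G p u (a • v) = a • christoffelFirst G p u v := by
  ext w
  simp only [christoffelFirst_apply, map_smul, smul_apply, smul_eq_mul]; ring

/-- The Christoffel symbols of the first kind as a bilinear map into covectors. -/
noncomputable def christoffelMap (G : Coord m → Bilin m) (y : Coord m) :
    Coord m →L[ℝ] Coord m →L[ℝ] Coord m →L[ℝ] ℝ :=
  (1 / 2 : ℝ) • (fderiv ℝ G y + (fderiv ℝ G y).flip -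
    (ContinuousLinearMap.flipₗᵢ ℝ (Coord m) (Coord m) ℝ :
      Bilin m →L[ℝ] Bilin m).comp (fderiv ℝ G y).flip)

@[simp]
theorem christoffelMap_apply (y u v : Coord m) :
    christoffelMap G y u v = christoffelFirst G y u v := by
  rfl

theorem LocalMetric.smooth_christoffelMap (hG : LocalMetric G p) :
    SmoothNear (christoffelMap G) p := by
  have h1 : SmoothNear (fun y => (fderiv ℝ G y).flip) p := by
    filter_upwards [hG.smooth.fderiv_right] with y hy
    exact (ContinuousLinearMap.flipₗᵢ ℝ (Coord m) (Coord m)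
      (Coord m →L[ℝ] ℝ)).toContinuousLinearEquiv.contDiff.contDiffAt.comp y hy
  refine SmoothNear.smul (.const _) ((hG.smooth.fderiv_right.add h1).sub ?_)
  filter_upwards [h1] with y hy using contDiffAt_const.clm_comp hy

theorem LocalMetric.smooth_christoffelFirst (hG : LocalMetric G p) {X Y : Coord m → Coord m}
    (hX : SmoothNear X p) (hY : SmoothNear Y p) :
    SmoothNear (fun y => christoffelFirst G y (X y) (Y y)) p :=
  (hG.smooth_christoffelMap.clm_apply hX).clm_apply hY

/-- The derivative of the relation `g ∘ adj = det • id`, evaluated on a radical vector. -/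
theorem LocalMetric.fderiv_gramDet_mul (hG : LocalMetric G q) {r : Coord m} (hr : G q r = 0)
    (α : Coord m →L[ℝ] ℝ) (u : Coord m) :
    fderiv ℝ (gramDet G) q u * α r = fderiv ℝ G q u (adjMap G q α) r := by
  have h1 : (fun y => G y (adjMap G y α) r) = fun y => gramDet G y * α r := by
    funext y; rw [apply_adjMap]; simp
  have hA : DifferentiableAt ℝ (fun y => adjMap G y α) q :=
    hG.smooth_adjMap.differentiableAt.clm_apply (differentiableAt_const _)
  have h2 : fderiv ℝ (fun y => G y (adjMap G y α) r) q u =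
      fderiv ℝ (fun y => gramDet G y * α r) q u := by rw [h1]
  rw [fderiv_clm_apply (hG.smooth.differentiableAt.clm_apply hA) (differentiableAt_const _),
    fderiv_clm_apply hG.smooth.differentiableAt hA,
    fderiv_mul_const hG.smooth_gramDet.differentiableAt] at h2
  have h3 : ∀ w, G q w r = 0 := fun w => by rw [hG.symm_self, hr]; rfl
  simp [h3] at h2
  linarith

/-- At a singular point the adjugate is a nonzero multiple of the square of a radical vector. -/
theorem TransverseMetric.exists_adjMap_eq (hG : TransverseMetric G q) {r : Coord m} (hr0 : r ≠ 0)
    (hr : G q r = 0) : ∃ c : ℝ, c ≠ 0 ∧ ∀ α, adjMap G q α = (c * α r) • r := by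
  have hδ : gramDet G q = 0 := gramDet_eq_zero_iff.2 ⟨r, hr0, hr⟩
  have hne : adjMap G q ≠ 0 := by
    intro h0
    obtain ⟨α, -, hα⟩ := exists_dual_vector ℝ r (norm_ne_zero_iff.2 hr0)
    refine hG.fderiv_ne (ContinuousLinearMap.ext fun u => ?_)
    have := hG.fderiv_gramDet_mul hr α u
    rw [h0, hα] at this
    simpa [hr0] using this
  have hspan : ∀ α, ∃ l : ℝ, adjMap G q α = l • r := by
    intro α
    by_contra! h
    refine hne (adjMap_eq_zero hG.symm_self hr (v₂ := adjMap G q α) ?_ ?_)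
    · rw [apply_adjMap, hδ, zero_smul]
    · rw [LinearIndependent.pair_iff]
      intro s t hst
      have ht : t = 0 := by
        by_contra ht
        refine h (-(t⁻¹ * s)) ?_
        have := congrArg (fun x => t⁻¹ • x) hst
        simp only [smul_add, smul_smul, inv_mul_cancel₀ ht, one_smul, smul_zero] at this
        rw [neg_smul]
        exact eq_neg_of_add_eq_zero_right this
      subst ht
      simpa [hr0] using hst
  choose l hl using hspan
  obtain ⟨β, -, hβ⟩ := exists_dual_vector ℝ r (norm_ne_zero_iff.2 hr0)
  have hβ0 : β r ≠ 0 := by rw [hβ]; simpa using hr0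
  have key : ∀ α, adjMap G q α = (l β / β r * α r) • r := by
    intro α
    have := apply_adjMap_comm hG.symm_self α β
    rw [hl, hl] at this
    simp only [map_smul, smul_eq_mul] at this
    rw [hl]
    congr 1
    field_simp
    linarith
  refine ⟨l β / β r, fun h0 => hne ?_, key⟩
  ext α : 1
  rw [key, h0]; simp

theorem TransverseMetric.fderiv_gramDet_eq (hG : TransverseMetric G q) {r : Coord m} (hr0 : r ≠ 0)
    (hr : G q r = 0) {c : ℝ} (hc : ∀ α, adjMap G q α = (c * α r) • r) (u : Coord m) :
    fderiv ℝ (gramDet G) q u = 2 * c * christoffelFirst G q u r r := by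
  obtain ⟨β, -, hβ⟩ := exists_dual_vector ℝ r (norm_ne_zero_iff.2 hr0)
  have hβ0 : β r ≠ 0 := by rw [hβ]; simpa using hr0
  have := hG.fderiv_gramDet_mul hr β u
  rw [hc, hG.fderiv_eq_christoffelFirst, christoffelFirst_smul_right] at this
  simp only [map_smul, smul_apply, smul_eq_mul] at this
  have h2 : β r * (fderiv ℝ (gramDet G) q u - 2 * c * christoffelFirst G q u r r) = 0 := by
    linear_combination this
  have := (mul_eq_zero.1 h2).resolve_left hβ0
  linarith

/-- Radical vectors at a point are unique up to scaling. -/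
theorem TransverseMetric.exists_eq_smul (hG : TransverseMetric G q) {r s : Coord m} (hr0 : r ≠ 0)
    (hr : G q r = 0) (hs : G q s = 0) : ∃ a : ℝ, s = a • r := by
  by_contra! h
  obtain ⟨c, hc0, hc⟩ := hG.exists_adjMap_eq hr0 hr
  obtain ⟨β, -, hβ⟩ := exists_dual_vector ℝ r (norm_ne_zero_iff.2 hr0)
  have hβ0 : β r ≠ 0 := by rw [hβ]; simpa using hr0
  have h0 := adjMap_eq_zero hG.symm_self hr hs (by
    rw [LinearIndependent.pair_iff]
    intro a b hab
    have hb : b = 0 := by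
      by_contra hb
      refine h (-(b⁻¹ * a)) ?_
      have := congrArg (fun x => b⁻¹ • x) hab
      simp only [smul_add, smul_smul, inv_mul_cancel₀ hb, one_smul, smul_zero] at this
      rw [neg_smul]
      exact eq_neg_of_add_eq_zero_right this
    subst hb
    simpa [hr0] using hab)
  have := hc β
  rw [h0] at this
  exact smul_ne_zero (mul_ne_zero hc0 hβ0) hr0 this.symm

end LocalMetric

/-! ### Traces of quadrilinear forms and the Kulkarni-Nomizu product -/

section Algebra

variable {m : ℕ}

theorem proj_apply (a : Fin m) (v : Coord m) :
    (EuclideanSpace.proj a : Coord m →L[ℝ] ℝ) v = v a := rfl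

/-- Quadrilinear forms on `ℝᵐ`. -/
abbrev Quad (m : ℕ) : Type := Coord m →L[ℝ] Coord m →L[ℝ] Bilin m

noncomputable scoped instance (m : ℕ) : NormedAddCommGroup (Quad m) :=
  ContinuousLinearMap.toNormedAddCommGroup
noncomputable scoped instance (m : ℕ) : NormedSpace ℝ (Quad m) := ContinuousLinearMap.toNormedSpace

/-- The quadrilinear form with prescribed components. -/
noncomputable def quadOfComponents (F : Fin m → Fin m → Fin m → Fin m → ℝ) : Quad m :=
  ∑ a, ∑ b, ∑ c, ∑ d, F a b c d •
    (EuclideanSpace.proj a : Coord m →L[ℝ] ℝ).smulRight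
      ((EuclideanSpace.proj b : Coord m →L[ℝ] ℝ).smulRight
        ((EuclideanSpace.proj c : Coord m →L[ℝ] ℝ).smulRight
          (EuclideanSpace.proj d : Coord m →L[ℝ] ℝ)))

theorem isLinearMap_apply_eq_sum {f : Coord m → ℝ} (hf : IsLinearMap ℝ f) (v : Coord m) :
    f v = ∑ a, v a * f (basisVec a) := by
  have := covector_apply (LinearMap.toContinuousLinearMap (IsLinearMap.mk' f hf)) v
  simpa using this

/-- A function of four vectors is linear in each of them. -/
structure IsQuadrilinear (f : Coord m → Coord m → Coord m → Coord m → ℝ) : Prop where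
  fst : ∀ v w t, IsLinearMap ℝ fun u => f u v w t
  snd : ∀ u w t, IsLinearMap ℝ fun v => f u v w t
  trd : ∀ u v t, IsLinearMap ℝ fun w => f u v w t
  fth : ∀ u v w, IsLinearMap ℝ fun t => f u v w t

theorem quadOfComponents_apply {f : Coord m → Coord m → Coord m → Coord m → ℝ}
    (hf : IsQuadrilinear f) (u v w t : Coord m) :
    quadOfComponents (fun a b c d => f (basisVec a) (basisVec b) (basisVec c) (basisVec d)) u v w t
      = f u v w t := by
  rw [isLinearMap_apply_eq_sum (hf.fst v w t) u]
  simp only [isLinearMap_apply_eq_sum (hf.snd _ w t) v, isLinearMap_apply_eq_sum (hf.trd _ _ t) w,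
    isLinearMap_apply_eq_sum (hf.fth _ _ _) t]
  simp only [quadOfComponents, sum_apply, smul_apply,
    ContinuousLinearMap.smulRight_apply, Finset.mul_sum]
  refine Finset.sum_congr rfl fun a _ => Finset.sum_congr rfl fun b _ =>
    Finset.sum_congr rfl fun c _ => Finset.sum_congr rfl fun d _ => ?_
  simp
  ring

/-- The contraction of the first and third slot of a quadrilinear form with `J`, as a bilinear form
in the second and fourth slot. For the curvature and `J = g⁻¹` this is the Ricci tensor. -/
noncomputable def ricciTrace (Q : Quad m) (J : (Coord m →L[ℝ] ℝ) →L[ℝ] Coord m) : Bilin m :=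
  ∑ a, (Q (basisVec a)).flip (J (EuclideanSpace.proj a))

theorem ricciTrace_apply (Q : Quad m) (J : (Coord m →L[ℝ] ℝ) →L[ℝ] Coord m) (v t : Coord m) :
    ricciTrace Q J v t = ∑ a, Q (basisVec a) v (J (EuclideanSpace.proj a)) t := by
  simp [ricciTrace, sum_apply]

/-- The contraction of a bilinear form with `J`. For `J = g⁻¹` this is the metric trace. -/
noncomputable def metricTrace (B : Bilin m) (J : (Coord m →L[ℝ] ℝ) →L[ℝ] Coord m) : ℝ :=
  ∑ a, B (basisVec a) (J (EuclideanSpace.proj a))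

theorem metricTrace_of_rank_one (B : Bilin m) {J : (Coord m →L[ℝ] ℝ) →L[ℝ] Coord m} {c : ℝ}
    {r : Coord m} (hJ : ∀ α, J α = (c * α r) • r) : metricTrace B J = c * B r r := by
  simp only [metricTrace, hJ, map_smul, smul_eq_mul, proj_apply]
  have := covector_apply (B.flip r) r
  simp only [ContinuousLinearMap.flip_apply] at this
  rw [this, Finset.mul_sum]
  exact Finset.sum_congr rfl fun a _ => by ring

theorem ricciTrace_of_rank_one (Q : Quad m) {J : (Coord m →L[ℝ] ℝ) →L[ℝ] Coord m} {c : ℝ}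
    {r : Coord m} (hJ : ∀ α, J α = (c * α r) • r) (v t : Coord m) :
    ricciTrace Q J v t = c * Q r v r t := by
  rw [ricciTrace_apply]
  simp only [hJ, map_smul, smul_apply, smul_eq_mul, proj_apply]
  have := covector_apply (((Q.flip v).flip r).flip t) r
  simp only [ContinuousLinearMap.flip_apply] at this
  rw [this, Finset.mul_sum]
  exact Finset.sum_congr rfl fun a _ => by ring

theorem ricciTrace_smul_smul (a b : ℝ) (Q : Quad m) (J : (Coord m →L[ℝ] ℝ) →L[ℝ] Coord m) :
    ricciTrace (a • Q) (b • J) = (a * b) • ricciTrace Q J := by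
  ext v t
  simp only [ricciTrace_apply, smul_apply, map_smul, smul_eq_mul, Finset.mul_sum]
  exact Finset.sum_congr rfl fun _ _ => by ring

theorem metricTrace_smul_smul (a b : ℝ) (B : Bilin m) (J : (Coord m →L[ℝ] ℝ) →L[ℝ] Coord m) :
    metricTrace (a • B) (b • J) = (a * b) * metricTrace B J := by
  simp only [metricTrace, smul_apply, map_smul, smul_eq_mul, Finset.mul_sum]
  exact Finset.sum_congr rfl fun _ _ => by ring

/-- The Kulkarni-Nomizu product with a symmetric form of rank at least three is injective. -/
theorem eq_zero_of_kulkarniNomizu_eq_zero (hm : 4 ≤ m) {g θ : Bilin m}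
    (hg : ∀ u v, g u v = g v u) {r : Coord m} (hker : ∀ s, g s = 0 → ∃ a : ℝ, s = a • r)
    (h : ∀ x y z t, kulkarniNomizu (fun a b => θ a b) (fun a b => g a b) x y z t = 0) : θ = 0 := by
  let B : LinearMap.BilinForm ℝ (Coord m) :=
    LinearMap.mk₂ ℝ (fun u v => g u v) (by simp) (by simp) (by simp) (by simp)
  have hB : ∀ u v, B u v = g u v := fun u v => rfl
  obtain ⟨v₀, hv₀⟩ := LinearMap.BilinForm.exists_orthogonal_basis (B := B)
    (LinearMap.isSymm_def.2 fun u v => by simp [hB, hg u v])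
  set e := v₀.reindex (finCongr finrank_euclideanSpace_fin) with he
  have ho : ∀ i j, i ≠ j → g (e i) (e j) = 0 := fun i j hij => by
    rw [← hB, he, Module.Basis.reindex_apply, Module.Basis.reindex_apply]
    exact hv₀ fun h => hij (by simpa using h)
  have hext : ∀ α β : Coord m →L[ℝ] ℝ, (∀ i, α (e i) = β (e i)) → α = β := fun α β hαβ =>
    ContinuousLinearMap.coe_injective (e.ext hαβ)
  have hzero : ∀ i, g (e i) (e i) = 0 → g (e i) = 0 := fun i hi => hext _ _ fun j => by
    by_cases hij : i = j
    · subst hij; simpa using hi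
    · simpa using ho i j hij
  -- at most one diagonal entry vanishes
  obtain ⟨z, hz⟩ : ∃ z, ∀ k, k ≠ z → g (e k) (e k) ≠ 0 := by
    by_cases hex : ∃ z, g (e z) (e z) = 0
    · obtain ⟨z, hz⟩ := hex
      refine ⟨z, fun k hk hk0 => ?_⟩
      obtain ⟨a, ha⟩ := hker _ (hzero z hz)
      obtain ⟨b, hb⟩ := hker _ (hzero k hk0)
      have hab : a • e k = b • e z := by rw [ha, hb, smul_comm]
      have ha0 : a = 0 := by
        simpa [Finsupp.single_apply, hk.symm] using congrArg (fun x => e.repr x k) hab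
      exact e.ne_zero z (by rw [ha, ha0, zero_smul])
    · push Not at hex
      exact ⟨⟨0, by omega⟩, fun k _ => hex k⟩
  have hpick : ∀ i j : Fin m, ∃ k, k ≠ i ∧ k ≠ j ∧ k ≠ z := by
    intro i j
    have hc : ({i, j, z} : Finset (Fin m)).card < (Finset.univ : Finset (Fin m)).card := by
      rw [Finset.card_univ, Fintype.card_fin]
      exact lt_of_le_of_lt Finset.card_le_three (by omega)
    obtain ⟨k, -, hk⟩ := Finset.exists_mem_notMem_of_card_lt_card hc
    simp only [Finset.mem_insert, Finset.mem_singleton, not_or] at hk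
    exact ⟨k, hk⟩
  have hθ : ∀ i j, θ (e i) (e j) = 0 := by
    intro i j
    by_cases hij : i = j
    · subst hij
      obtain ⟨k, hki, -, hkz⟩ := hpick i i
      obtain ⟨l, hli, hlk, hlz⟩ := hpick i k
      have h1 := h (e i) (e k) (e i) (e k)
      have h2 := h (e i) (e l) (e i) (e l)
      have h3 := h (e k) (e l) (e k) (e l)
      simp only [kulkarniNomizu, ho i k hki.symm, ho k i hki, ho i l hli.symm, ho l i hli,
        ho k l hlk.symm, ho l k hlk] at h1 h2 h3
      have : θ (e i) (e i) * (g (e k) (e k) * g (e l) (e l)) = 0 := by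
        linear_combination (1 / 2 : ℝ) * (g (e l) (e l) * h1 + g (e k) (e k) * h2
          - g (e i) (e i) * h3)
      exact (mul_eq_zero.1 this).resolve_right (mul_ne_zero (hz k hkz) (hz l hlz))
    · obtain ⟨k, hki, hkj, hkz⟩ := hpick i j
      have h1 := h (e i) (e k) (e j) (e k)
      simp only [kulkarniNomizu, ho i k hki.symm, ho k j hkj, ho i j hij] at h1
      have : θ (e i) (e j) * g (e k) (e k) = 0 := by linear_combination h1
      exact (mul_eq_zero.1 this).resolve_right (hz k hkz)
  ext1 x
  refine hext _ _ fun j => ?_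
  have : θ.flip (e j) = 0 := hext _ _ fun i => by simpa using hθ i j
  simpa using congrArg (fun α => α x) this

end Algebra

/-! ### The curvature of a nondegenerate metric in coordinates -/

section Curvature

variable {m : ℕ} {G : Coord m → Bilin m} {p q y : Coord m}

theorem coordNabla_const (v w : Coord m) :
    coordNabla G (fun _ => v) (fun _ => w) y = (G y).inverse (christoffelFirst G y v w) := by
  simp [coordNabla, coordDualConn]

theorem LocalMetric.smooth_inverse (hG : LocalMetric G y) (h : gramDet G y ≠ 0) :
    SmoothNear (fun z => (G z).inverse) y := by
  refine ((hG.smooth_gramDet.inv h).smul hG.smooth_adjMap).congr ?_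
  filter_upwards [hG.smooth_gramDet.continuousAt.eventually_ne h] with z hz
    using inverse_eq_smul_adjMap hz

theorem LocalMetric.fderiv_christoffelFirst (hG : LocalMetric G y) (u v w t : Coord m) :
    fderiv ℝ (fun z => christoffelFirst G z v w t) y u = fderiv ℝ (christoffelMap G) y u v w t := by
  have h := hG.smooth_christoffelMap.differentiableAt
  have h1 : (fun z => christoffelFirst G z v w t) = fun z => christoffelMap G z v w t := by
    funext z; simp
  rw [h1, fderiv_clm_apply ((h.clm_apply (differentiableAt_const v)).clm_apply
    (differentiableAt_const w)) (differentiableAt_const t),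
    fderiv_clm_apply (h.clm_apply (differentiableAt_const v)) (differentiableAt_const w),
    fderiv_clm_apply h (differentiableAt_const v)]
  simp

theorem LocalMetric.apply_coordNabla_coordNabla (hG : LocalMetric G y) (h : gramDet G y ≠ 0)
    (u v t w : Coord m) :
    G y (coordNabla G (fun _ => u) (coordNabla G (fun _ => v) fun _ => t) y) w =
      fderiv ℝ (christoffelMap G) y u v t w -
        christoffelFirst G y u w ((G y).inverse (christoffelFirst G y v t)) := by
  set Γ : Coord m → Coord m := coordNabla G (fun _ => v) fun _ => t with hΓ
  have hΓ' : Γ = fun z => (G z).inverse (christoffelFirst G z v t) := by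
    funext z; exact coordNabla_const v t
  have hΓs : DifferentiableAt ℝ Γ y := by
    rw [hΓ']
    exact ((hG.smooth_inverse h).clm_apply
      (hG.smooth_christoffelFirst (.const v) (.const t))).differentiableAt
  have h1 : (fun z => G z (Γ z) w) =ᶠ[𝓝 y] fun z => christoffelFirst G z v t w := by
    filter_upwards [hG.smooth_gramDet.continuousAt.eventually_ne h] with z hz
    rw [hΓ', inverse_apply hz]
  have h2 := hG.fderiv_christoffelFirst u v t w
  rw [← h1.fderiv_eq, fderiv_clm_apply (hG.smooth.differentiableAt.clm_apply hΓs)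
    (differentiableAt_const w), fderiv_clm_apply hG.smooth.differentiableAt hΓs] at h2
  simp only [fderiv_fun_const, Pi.zero_apply, ContinuousLinearMap.comp_zero, zero_add,
    ContinuousLinearMap.flip_apply, add_apply, ContinuousLinearMap.comp_apply] at h2
  rw [coordNabla, inverse_apply h, coordDualConn, ← h2, hG.fderiv_eq_christoffelFirst]
  rw [show (G y).inverse (christoffelFirst G y v t) = Γ y by rw [hΓ']]
  simp only [add_apply]
  ring

/-- The product of the curvature with `gramDet G`; it is smooth also where `G` degenerates. -/
noncomputable def curvNumerator (G : Coord m → Bilin m) (y u v w t : Coord m) : ℝ :=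
  gramDet G y * (fderiv ℝ (christoffelMap G) y u v t w - fderiv ℝ (christoffelMap G) y v u t w) -
    christoffelFirst G y u w (adjMap G y (christoffelFirst G y v t)) +
    christoffelFirst G y v w (adjMap G y (christoffelFirst G y u t))

theorem isQuadrilinear_curvNumerator : IsQuadrilinear (curvNumerator G y) := by
  constructor <;> intros <;> constructor <;> intros <;>
  simp only [curvNumerator, christoffelFirst_add_left, christoffelFirst_add_right,
    christoffelFirst_smul_left, christoffelFirst_smul_right, map_add, map_smul, add_apply,
    smul_apply, smul_eq_mul] <;> ring

/-- `curvNumerator` as a map into quadrilinear forms. -/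
noncomputable def curvQuad (G : Coord m → Bilin m) (y : Coord m) : Quad m :=
  quadOfComponents fun a b c d =>
    curvNumerator G y (basisVec a) (basisVec b) (basisVec c) (basisVec d)

@[simp]
theorem curvQuad_apply (u v w t : Coord m) : curvQuad G y u v w t = curvNumerator G y u v w t :=
  quadOfComponents_apply isQuadrilinear_curvNumerator u v w t

theorem LocalMetric.smooth_curvNumerator (hG : LocalMetric G p) (u v w t : Coord m) :
    SmoothNear (fun y => curvNumerator G y u v w t) p := by
  have hD : ∀ u v t w : Coord m,
      SmoothNear (fun y => fderiv ℝ (christoffelMap G) y u v t w) p := fun u v t w =>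
    (((hG.smooth_christoffelMap.fderiv_right.clm_apply (.const u)).clm_apply (.const v)).clm_apply
      (.const t)).clm_apply (.const w)
  have hC : ∀ u v : Coord m, SmoothNear (fun y => christoffelFirst G y u v) p := fun u v =>
    hG.smooth_christoffelFirst (.const u) (.const v)
  exact ((hG.smooth_gramDet.mul ((hD u v t w).sub (hD v u t w))).sub
    ((hC u w).clm_apply (hG.smooth_adjMap.clm_apply (hC v t)))).add
    ((hC v w).clm_apply (hG.smooth_adjMap.clm_apply (hC u t)))

theorem LocalMetric.smooth_curvQuad (hG : LocalMetric G p) : SmoothNear (curvQuad G) p := by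
  unfold curvQuad quadOfComponents
  exact SmoothNear.sum (s := Finset.univ) fun _ _ => SmoothNear.sum (s := Finset.univ) fun _ _ =>
    SmoothNear.sum (s := Finset.univ) fun _ _ => SmoothNear.sum (s := Finset.univ) fun _ _ =>
      (hG.smooth_curvNumerator _ _ _ _).smul (.const _)

theorem LocalMetric.coordCurv_eq (hG : LocalMetric G y) (h : gramDet G y ≠ 0)
    (u v w t : Coord m) :
    coordCurv G y u v w t = ((gramDet G y)⁻¹ • curvQuad G y) u v w t := by
  rw [coordCurv, coordRiem, map_sub, sub_apply,
    hG.apply_coordNabla_coordNabla h, hG.apply_coordNabla_coordNabla h]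
  simp only [smul_apply, curvQuad_apply, curvNumerator, inverse_eq_smul_adjMap h, map_smul,
    smul_eq_mul]
  field_simp
  ring

theorem LocalMetric.coordRic_eq (hG : LocalMetric G y) (h : gramDet G y ≠ 0) {K : Quad m}
    (hK : ∀ u v w t, coordCurv G y u v w t = K u v w t) (v t : Coord m) :
    coordRic G y v t = ricciTrace K (G y).inverse v t := by
  rw [coordRic, ricciTrace_apply]
  refine Finset.sum_congr rfl fun a _ => ?_
  rw [← hK, coordCurv, hG.symm_self, inverse_apply h, proj_apply]

theorem LocalMetric.coordScal_eq (hG : LocalMetric G y) (h : gramDet G y ≠ 0) {K : Quad m}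
    (hK : ∀ u v w t, coordCurv G y u v w t = K u v w t) :
    coordScal G y = metricTrace (ricciTrace K (G y).inverse) (G y).inverse := by
  rw [coordScal, metricTrace]
  exact Finset.sum_congr rfl fun a _ => hG.coordRic_eq h hK _ _

/-- The Schouten tensor from the Ricci and scalar contractions. -/
noncomputable def schoutenForm (ric : Bilin m) (s : ℝ) (g : Bilin m) : Bilin m :=
  (1 / ((m : ℝ) - 2)) • (ric - (s / (2 * ((m : ℝ) - 1))) • g)

theorem LocalMetric.coordWeyl_eq (hG : LocalMetric G y) (h : gramDet G y ≠ 0) {K : Quad m}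
    (hK : ∀ u v w t, coordCurv G y u v w t = K u v w t) (u v w t : Coord m) :
    coordWeyl G y u v w t = K u v w t - kulkarniNomizu
      (fun a b => schoutenForm (ricciTrace K (G y).inverse)
        (metricTrace (ricciTrace K (G y).inverse) (G y).inverse) (G y) a b)
      (fun a b => G y a b) u v w t := by
  rw [coordWeyl, hK]
  congr 2
  funext a b
  simp [coordSchouten, schoutenForm, hG.coordRic_eq h hK, hG.coordScal_eq h hK]

/-- The Weyl tensor in terms of the smooth numerator of the curvature. -/
theorem LocalMetric.gramDet_sq_mul_coordWeyl (hG : LocalMetric G y) (h : gramDet G y ≠ 0) {s : ℝ}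
    (hs : metricTrace (ricciTrace (curvQuad G y) (adjMap G y)) (adjMap G y) = gramDet G y * s)
    (u v w t : Coord m) :
    gramDet G y ^ 2 * coordWeyl G y u v w t = gramDet G y * curvQuad G y u v w t - kulkarniNomizu
      (fun a b => schoutenForm (ricciTrace (curvQuad G y) (adjMap G y)) s (G y) a b)
      (fun a b => G y a b) u v w t := by
  rw [hG.coordWeyl_eq h (hG.coordCurv_eq h), inverse_eq_smul_adjMap h, ricciTrace_smul_smul,
    metricTrace_smul_smul, hs]
  simp only [schoutenForm, kulkarniNomizu, smul_apply, sub_apply, smul_eq_mul]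
  field_simp

end Curvature

/-! ### The pole of the Weyl tensor along the singular hypersurface -/

section Poles

variable {m : ℕ} {G : Coord m → Bilin m} {R : Coord m → Coord m} {p q y : Coord m}

/-- `R` is smooth near `p` and spans the radical of `G` at the singular points near `p`. -/
structure RadicalGerm (G : Coord m → Bilin m) (R : Coord m → Coord m) (p : Coord m) : Prop where
  smooth : SmoothNear R p
  radical : ∀ᶠ y in 𝓝 p, gramDet G y = 0 → G y (R y) = 0 ∧ R y ≠ 0

/-- The Weyl tensor of `G` extends smoothly to a neighbourhood of `p`. -/
def WeylExtendsNear (G : Coord m → Bilin m) (p : Coord m) : Prop :=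
  ∃ T : Coord m → Quad m, SmoothNear T p ∧ ∀ᶠ y in 𝓝 p, gramDet G y ≠ 0 →
    ∀ u v w t, coordWeyl G y u v w t = T y u v w t

theorem SmoothNear.quad_apply {Q : Coord m → Quad m} {a b c d : Coord m → Coord m}
    (hQ : SmoothNear Q p) (ha : SmoothNear a p) (hb : SmoothNear b p) (hc : SmoothNear c p)
    (hd : SmoothNear d p) : SmoothNear (fun y => Q y (a y) (b y) (c y) (d y)) p :=
  (((hQ.clm_apply ha).clm_apply hb).clm_apply hc).clm_apply hd

theorem SmoothNear.bilin_apply {B : Coord m → Bilin m} {a b : Coord m → Coord m}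
    (hB : SmoothNear B p) (ha : SmoothNear a p) (hb : SmoothNear b p) :
    SmoothNear (fun y => B y (a y) (b y)) p :=
  (hB.clm_apply ha).clm_apply hb

theorem SmoothNear.ricciTrace {Q : Coord m → Quad m}
    {J : Coord m → (Coord m →L[ℝ] ℝ) →L[ℝ] Coord m} (hQ : SmoothNear Q p) (hJ : SmoothNear J p) :
    SmoothNear (fun y => ricciTrace (Q y) (J y)) p := by
  refine SmoothNear.sum (s := Finset.univ) fun a _ => ?_
  have h1 : SmoothNear (fun y => (Q y (basisVec a)).flip) p := by
    filter_upwards [hQ.clm_apply (.const (basisVec a))] with y hy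
    exact (ContinuousLinearMap.flipₗᵢ ℝ (Coord m) (Coord m)
      (Coord m →L[ℝ] ℝ)).toContinuousLinearEquiv.contDiff.contDiffAt.comp y hy
  exact h1.clm_apply (hJ.clm_apply (.const _))

theorem SmoothNear.metricTrace {B : Coord m → Bilin m}
    {J : Coord m → (Coord m →L[ℝ] ℝ) →L[ℝ] Coord m} (hB : SmoothNear B p) (hJ : SmoothNear J p) :
    SmoothNear (fun y => metricTrace (B y) (J y)) p :=
  SmoothNear.sum (s := Finset.univ) fun _ _ => hB.bilin_apply (.const _) (hJ.clm_apply (.const _))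

theorem SmoothNear.kulkarniNomizu {A B : Coord m → Bilin m} (hA : SmoothNear A p)
    (hB : SmoothNear B p) (u v w t : Coord m) :
    SmoothNear (fun y => kulkarniNomizu (fun a b => A y a b) (fun a b => B y a b) u v w t) p := by
  have hA' : ∀ a b : Coord m, SmoothNear (fun y => A y a b) p := fun a b =>
    hA.bilin_apply (.const a) (.const b)
  have hB' : ∀ a b : Coord m, SmoothNear (fun y => B y a b) p := fun a b =>
    hB.bilin_apply (.const a) (.const b)
  exact (((hA' _ _).mul (hB' _ _)).sub ((hB' _ _).mul (hA' _ _))).add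
    (((hB' _ _).mul (hA' _ _)).sub ((hA' _ _).mul (hB' _ _)))

theorem SmoothNear.schoutenForm {A B : Coord m → Bilin m} {s : Coord m → ℝ}
    (hA : SmoothNear A p) (hs : SmoothNear s p) (hB : SmoothNear B p) :
    SmoothNear (fun y => schoutenForm (A y) (s y) (B y)) p := by
  have hs' : SmoothNear (fun y => s y / (2 * ((m : ℝ) - 1))) p := by
    simp only [div_eq_mul_inv]
    exact hs.mul (.const _)
  exact (SmoothNear.const _).smul (hA.sub (hs'.smul hB))

theorem RadicalGerm.eventually (hR : RadicalGerm G R p) : ∀ᶠ q in 𝓝 p, RadicalGerm G R q := by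
  filter_upwards [hR.smooth.eventually, eventually_eventually_nhds.2 hR.radical] with q h1 h2
    using ⟨h1, h2⟩

theorem RadicalGerm.apply_right (hR : G y (R y) = 0) (hG : LocalMetric G y) (v : Coord m) :
    G y v (R y) = 0 := by
  rw [hG.symm_self, hR]; rfl

/-- The factor `c` in `adj = c R ⊗ R` along the singular set can be chosen smooth. -/
theorem RadicalGerm.exists_factor (hR : RadicalGerm G R p) (hG : TransverseMetric G p)
    (hp : gramDet G p = 0) : ∃ c : Coord m → ℝ, SmoothNear c p ∧ c p ≠ 0 ∧ ∀ᶠ y in 𝓝 p,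
      gramDet G y = 0 → c y ≠ 0 ∧ ∀ α, adjMap G y α = (c y * α (R y)) • R y := by
  obtain ⟨hRp, hRp0⟩ := hR.radical.self_of_nhds hp
  obtain ⟨β, -, hβ⟩ := exists_dual_vector ℝ (R p) (norm_ne_zero_iff.2 hRp0)
  have hβ0 : β (R p) ≠ 0 := by rw [hβ]; simpa using hRp0
  have hβR : SmoothNear (fun y => β (R y)) p := (SmoothNear.const β).clm_apply hR.smooth
  have key : ∀ᶠ y in 𝓝 p, gramDet G y = 0 →
      β (adjMap G y β) * (β (R y) * β (R y))⁻¹ ≠ 0 ∧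
      ∀ α, adjMap G y α = (β (adjMap G y β) * (β (R y) * β (R y))⁻¹ * α (R y)) • R y := by
    filter_upwards [hG.eventually, hR.radical, hβR.continuousAt.eventually_ne hβ0]
      with y h1 h2 h3 hy
    obtain ⟨h4, h5⟩ := h2 hy
    obtain ⟨c, hc0, hc⟩ := h1.exists_adjMap_eq h5 h4
    have : β (adjMap G y β) * (β (R y) * β (R y))⁻¹ = c := by
      rw [hc]; simp only [map_smul, smul_eq_mul]; field_simp
    rw [this]
    exact ⟨hc0, hc⟩
  exact ⟨_, ((SmoothNear.const β).clm_apply (hG.smooth_adjMap.clm_apply (.const β))).mul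
    ((hβR.mul hβR).inv (mul_ne_zero hβ0 hβ0)), (key.self_of_nhds hp).1, key⟩

theorem curvNumerator_self_left (u w t : Coord m) : curvNumerator G y u u w t = 0 := by
  simp [curvNumerator]

/-- The leading coefficient of the pole of the curvature is the Gauss product of `II^R`. -/
theorem curvNumerator_eq (hy : gramDet G y = 0) {r : Coord m} {c : ℝ}
    (hc : ∀ α, adjMap G y α = (c * α r) • r) (u v w t : Coord m) :
    curvNumerator G y u v w t = c * (christoffelFirst G y u t r * christoffelFirst G y v w r -
      christoffelFirst G y v t r * christoffelFirst G y u w r) := by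
  simp only [curvNumerator, hy, hc, map_smul, smul_eq_mul]
  ring

/-- If the Weyl tensor extends, its poles of second order vanish; this expresses `II^R` on the
singular set through `II^R(R, ·)` and the metric. -/
theorem WeylExtendsNear.secondForm_identity (hm : 4 ≤ m) (hG : TransverseMetric G p)
    (hp : gramDet G p = 0) (hR : RadicalGerm G R p) (hW : WeylExtendsNear G p) :
    ∃ s : Coord m → ℝ, SmoothNear s p ∧ ∀ᶠ y in 𝓝 p, gramDet G y = 0 → ∀ v t,
      christoffelFirst G y v (R y) (R y) * christoffelFirst G y (R y) t (R y) -
        christoffelFirst G y (R y) (R y) (R y) * christoffelFirst G y v t (R y) =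
      s y * G y v t := by
  obtain ⟨T, hT, hTW⟩ := hW
  obtain ⟨c, hcs, hcp, hc⟩ := hR.exists_factor hG hp
  have hm1 : (m : ℝ) - 1 ≠ 0 := by
    have : (4 : ℝ) ≤ m := by exact_mod_cast hm
    linarith
  have hm2 : (m : ℝ) - 2 ≠ 0 := by
    have : (4 : ℝ) ≤ m := by exact_mod_cast hm
    linarith
  have hric : SmoothNear (fun y => ricciTrace (curvQuad G y) (adjMap G y)) p :=
    hG.smooth_curvQuad.ricciTrace hG.smooth_adjMap
  obtain ⟨s, hs, hsδ⟩ := exists_smul_eq_of_eq_zero (hric.metricTrace hG.smooth_adjMap)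
    hG.smooth_gramDet hG.fderiv_ne (by
      filter_upwards [hc] with y hcy hy
      rw [metricTrace_of_rank_one _ (hcy hy).2, ricciTrace_of_rank_one _ (hcy hy).2,
        curvQuad_apply, curvNumerator_self_left]
      simp)
  have hid : ∀ᶠ y in 𝓝 p, gramDet G y ≠ 0 → ∀ u v w t,
      gramDet G y * gramDet G y * T y u v w t = gramDet G y * curvQuad G y u v w t -
        kulkarniNomizu (fun a b => schoutenForm (ricciTrace (curvQuad G y) (adjMap G y)) (s y)
          (G y) a b) (fun a b => G y a b) u v w t := by
    filter_upwards [hG.toLocalMetric.eventually, hTW, hsδ] with y h1 h2 h3 hy u v w t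
    rw [← h2 hy, ← pow_two]
    exact h1.gramDet_sq_mul_coordWeyl hy h3 u v w t
  refine ⟨fun y => s y * (2 * ((m : ℝ) - 1))⁻¹ * (c y * c y)⁻¹,
    (hs.mul (.const _)).mul ((hcs.mul hcs).inv (mul_ne_zero hcp hcp)), ?_⟩
  filter_upwards [hG.eventually, hR.radical, hc, hT.eventually, hs.eventually, hric.eventually,
    eventually_eventually_nhds.2 hid] with y hGy hRy hcy hTy hsy hricy hidy hy v t
  obtain ⟨hr, hr0⟩ := hRy hy
  obtain ⟨hc0, hcA⟩ := hcy hy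
  have hS : schoutenForm (ricciTrace (curvQuad G y) (adjMap G y)) (s y) (G y) = 0 := by
    refine eq_zero_of_kulkarniNomizu_eq_zero hm hGy.symm_self (r := R y)
      (fun s hs => hGy.exists_eq_smul hr0 hr hs) fun a b c d => ?_
    have hδ := hGy.smooth_gramDet
    have := eq_of_eventually_ne_zero hGy.fderiv_ne
      ((hδ.mul hδ).mul (hTy.quad_apply (.const a) (.const b) (.const c) (.const d))).continuousAt
      ((hδ.mul (hGy.smooth_curvQuad.quad_apply (.const a) (.const b) (.const c)
        (.const d))).sub ((hricy.schoutenForm hsy hGy.smooth).kulkarniNomizu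
          hGy.smooth a b c d)).continuousAt
      (hidy.mono fun y h hy => h hy a b c d)
    simpa [hy] using this
  have h1 := congrArg (fun B : Bilin m => B v t) hS
  simp only [schoutenForm, smul_apply, sub_apply, smul_eq_mul, zero_apply,
    ricciTrace_of_rank_one _ hcA, curvQuad_apply, curvNumerator_eq hy hcA] at h1
  field_simp at h1 ⊢
  linear_combination h1

theorem TransverseMetric.christoffelFirst_right_eq (hG : TransverseMetric G y) {r : Coord m}
    (hr0 : r ≠ 0) (hr : G y r = 0) : ∃ c : ℝ, c ≠ 0 ∧
      ∀ u, christoffelFirst G y u r r = c * fderiv ℝ (gramDet G) y u := by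
  obtain ⟨c, hc0, hc⟩ := hG.exists_adjMap_eq hr0 hr
  refine ⟨(2 * c)⁻¹, by positivity, fun u => ?_⟩
  rw [hG.fderiv_gramDet_eq hr0 hr hc]
  field_simp

/-- If the Weyl tensor extends, then the radical is transverse and `II^R` is conformal to the
metric along the singular hypersurface. -/
theorem WeylExtendsNear.secondForm_eq (hm : 4 ≤ m) (hG : TransverseMetric G p)
    (hp : gramDet G p = 0) (hR : RadicalGerm G R p) (hW : WeylExtendsNear G p) :
    fderiv ℝ (gramDet G) p (R p) ≠ 0 ∧
    ∃ h : Coord m → ℝ, SmoothNear h p ∧ ∀ᶠ y in 𝓝 p, gramDet G y = 0 → ∀ u v,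
      fderiv ℝ (gramDet G) y u = 0 → fderiv ℝ (gramDet G) y v = 0 →
      christoffelFirst G y u v (R y) = h y * G y u v := by
  obtain ⟨s, hs, hsI⟩ := hW.secondForm_identity hm hG hp hR
  have hRRR : SmoothNear (fun y => christoffelFirst G y (R y) (R y) (R y)) p :=
    (hG.smooth_christoffelFirst hR.smooth hR.smooth).clm_apply hR.smooth
  obtain ⟨hr, hr0⟩ := hR.radical.self_of_nhds hp
  obtain ⟨c, hc0, hc⟩ := hG.christoffelFirst_right_eq hr0 hr
  have htrans : christoffelFirst G p (R p) (R p) (R p) ≠ 0 := by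
    intro h0
    have hI := hsI.self_of_nhds hp
    simp only [h0, zero_mul, sub_zero, hG.christoffelFirst_comm (R p), hc] at hI
    -- otherwise the metric would have rank at most one at `p`
    have hG0 : s p • G p = 0 := by
      refine eq_zero_of_kulkarniNomizu_eq_zero hm (g := G p) hG.symm_self (r := R p)
        (fun s hs => hG.exists_eq_smul hr0 hr hs) fun a b d e => ?_
      by_cases hs0 : s p = 0
      · simp [kulkarniNomizu, hs0]
      · have hG' : ∀ a b, G p a b =
            (s p)⁻¹ * (c * fderiv ℝ (gramDet G) p a * (c * fderiv ℝ (gramDet G) p b)) := by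
          intro a b; rw [hI]; field_simp
        simp only [kulkarniNomizu, smul_apply, smul_eq_mul, hG']
        ring
    refine hG.fderiv_ne (ContinuousLinearMap.ext fun u => ?_)
    have h1 := hI u u
    rw [show s p * G p u u = 0 by simpa using congrArg (fun B : Bilin m => B u u) hG0] at h1
    simpa [hc0] using h1
  refine ⟨fun h0 => htrans (by rw [hc, h0, mul_zero]), fun y => -s y *
    (christoffelFirst G y (R y) (R y) (R y))⁻¹, ?_, ?_⟩
  · refine SmoothNear.mul ?_ (hRRR.inv htrans)
    simpa using (SmoothNear.const (0 : ℝ)).sub hs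
  · filter_upwards [hsI, hRRR.continuousAt.eventually_ne htrans, hG.eventually, hR.radical]
      with y h1 h2 h3 h4 hy u v hu hv
    obtain ⟨c, hc0, hc⟩ := h3.christoffelFirst_right_eq (h4 hy).2 (h4 hy).1
    have := h1 hy u v
    rw [hc u, hu] at this
    field_simp
    linear_combination -this

/-- The value of `II^R` when it vanishes on tangent vectors and the radical is transverse. -/
theorem TransverseMetric.christoffelFirst_radical (hG : TransverseMetric G y) {r : Coord m}
    (hr0 : r ≠ 0) (hr : G y r = 0) (htr : fderiv ℝ (gramDet G) y r ≠ 0)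
    (hII : ∀ u v, fderiv ℝ (gramDet G) y u = 0 → fderiv ℝ (gramDet G) y v = 0 →
      christoffelFirst G y u v r = 0) : ∃ a : ℝ, ∀ u v, christoffelFirst G y u v r =
        a * (fderiv ℝ (gramDet G) y u * fderiv ℝ (gramDet G) y v) := by
  obtain ⟨c, hc0, hc⟩ := hG.christoffelFirst_right_eq hr0 hr
  set D := fderiv ℝ (gramDet G) y
  refine ⟨c / D r, fun u v => ?_⟩
  have ht : ∀ u, D (u - (D u / D r) • r) = 0 := fun u => by simp [htr]
  have h1 := hII _ _ (ht u) (ht v)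
  have hd : ∀ u, u = (u - (D u / D r) • r) + (D u / D r) • r := fun u => by simp
  have h2 : ∀ u, christoffelFirst G y (u - (D u / D r) • r) r r = 0 := fun u => by
    rw [hc, ht, mul_zero]
  conv_lhs => rw [hd u, hd v]
  rw [christoffelFirst_add_left, christoffelFirst_add_right, christoffelFirst_add_right,
    christoffelFirst_smul_right, christoffelFirst_smul_right, christoffelFirst_smul_left,
    christoffelFirst_smul_left, hG.christoffelFirst_comm r]
  simp only [add_apply, smul_apply, h1, h2, smul_eq_mul, hc r]
  field_simp
  ring

/-- `κ` is a smooth extension of the covariant curvature of `G` to a neighbourhood of `p`. -/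
structure CurvExtension (G : Coord m → Bilin m) (κ : Coord m → Quad m) (p : Coord m) : Prop where
  smooth : SmoothNear κ p
  eq : ∀ᶠ y in 𝓝 p, curvQuad G y = gramDet G y • κ y

/-- `II^R` vanishes on the vectors tangent to the singular hypersurface. -/
def FlatGerm (G : Coord m → Bilin m) (R : Coord m → Coord m) (p : Coord m) : Prop :=
  ∀ᶠ y in 𝓝 p, gramDet G y = 0 → ∀ u v, fderiv ℝ (gramDet G) y u = 0 →
    fderiv ℝ (gramDet G) y v = 0 → christoffelFirst G y u v (R y) = 0

theorem eventually_transverse (hG : TransverseMetric G p) (hR : RadicalGerm G R p)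
    (htr : fderiv ℝ (gramDet G) p (R p) ≠ 0) :
    ∀ᶠ y in 𝓝 p, fderiv ℝ (gramDet G) y (R y) ≠ 0 :=
  (hG.smooth_gramDet.fderiv_right.clm_apply hR.smooth).continuousAt.eventually_ne htr

/-- The curvature of a `II`-flat metric with transverse radical extends smoothly. -/
theorem FlatGerm.exists_curvExtension (hG : TransverseMetric G p) (hR : RadicalGerm G R p)
    (htr : fderiv ℝ (gramDet G) p (R p) ≠ 0) (hII : FlatGerm G R p) :
    ∃ κ, CurvExtension G κ p := by
  obtain ⟨κ, hκ, hκe⟩ := exists_smul_eq_of_eq_zero hG.smooth_curvQuad hG.smooth_gramDet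
    hG.fderiv_ne (by
      filter_upwards [hG.eventually, hR.radical, hII, eventually_transverse hG hR htr]
        with y h1 h2 h3 h4 hy
      obtain ⟨c, hc0, hc⟩ := h1.exists_adjMap_eq (h2 hy).2 (h2 hy).1
      obtain ⟨a, ha⟩ := h1.christoffelFirst_radical (h2 hy).2 (h2 hy).1 h4 (h3 hy)
      ext u v w t
      rw [curvQuad_apply, curvNumerator_eq hy hc, ha, ha, ha, ha]
      simp only [zero_apply]
      ring)
  exact ⟨κ, hκ, hκe⟩

end Poles

/-! ### The simple pole of the Weyl tensor -/

section SimplePole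

variable {m : ℕ} {G : Coord m → Bilin m} {R : Coord m → Coord m} {p q y : Coord m}
  {κ : Coord m → Quad m}

theorem LocalMetric.curvNumerator_self_right (hG : LocalMetric G y) (u v w : Coord m) :
    curvNumerator G y u v w w = 0 := by
  have hd := hG.smooth.fderiv_right.differentiableAt
  have h1 : ∀ u v, fderiv ℝ (christoffelMap G) y u v w w =
      1 / 2 * fderiv ℝ (fderiv ℝ G) y u v w w := by
    intro u v
    have h2 : (fun z => christoffelFirst G z v w w) = fun z => 1 / 2 * fderiv ℝ G z v w w := by
      funext z; rw [christoffelFirst_apply]; ring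
    rw [← hG.fderiv_christoffelFirst, h2, fderiv_const_mul
      (((hd.clm_apply (differentiableAt_const v)).clm_apply (differentiableAt_const w)).clm_apply
      (differentiableAt_const w)), fderiv_clm_apply
      ((hd.clm_apply (differentiableAt_const v)).clm_apply
      (differentiableAt_const w)) (differentiableAt_const w), fderiv_clm_apply
      (hd.clm_apply (differentiableAt_const v)) (differentiableAt_const w),
      fderiv_clm_apply hd (differentiableAt_const v)]
    simp
  have h3 : fderiv ℝ (fderiv ℝ G) y u v = fderiv ℝ (fderiv ℝ G) y v u :=
    (hG.smooth.contDiffAt.isSymmSndFDerivAt (by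
      rw [minSmoothness_of_isRCLikeNormedField]
      exact WithTop.coe_le_coe.2 (le_top : (2 : ℕ∞) ≤ ⊤))).eq u v
  rw [curvNumerator, h1, h1, h3, apply_adjMap_comm hG.symm_self]
  ring

theorem CurvExtension.eventually (h : CurvExtension G κ p) :
    ∀ᶠ q in 𝓝 p, CurvExtension G κ q := by
  filter_upwards [h.smooth.eventually, eventually_eventually_nhds.2 h.eq] with q h1 h2
    using ⟨h1, h2⟩

theorem CurvExtension.eq_zero_of_curvNumerator (h : CurvExtension G κ p)
    (hG : TransverseMetric G p) (u v w t : Coord m)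
    (h0 : ∀ᶠ y in 𝓝 p, curvNumerator G y u v w t = 0) : κ p u v w t = 0 := by
  refine eq_of_eventually_ne_zero (F := fun y => κ y u v w t) (F' := fun _ => 0) hG.fderiv_ne
    (h.smooth.quad_apply (.const u) (.const v) (.const w) (.const t)).continuousAt
    continuousAt_const ?_
  filter_upwards [h.eq, h0] with y h1 h2 hy
  have := congrArg (fun Q : Quad m => Q u v w t) h1
  simp only [curvQuad_apply, h2, smul_apply, smul_eq_mul] at this
  exact (mul_eq_zero.1 this.symm).resolve_left hy

theorem CurvExtension.self_left (h : CurvExtension G κ p) (hG : TransverseMetric G p)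
    (u w t : Coord m) : κ p u u w t = 0 :=
  h.eq_zero_of_curvNumerator hG u u w t (.of_forall fun _ => curvNumerator_self_left u w t)

theorem CurvExtension.self_right (h : CurvExtension G κ p) (hG : TransverseMetric G p)
    (u v w : Coord m) : κ p u v w w = 0 :=
  h.eq_zero_of_curvNumerator hG u v w w
    (hG.toLocalMetric.eventually.mono fun _ hy => hy.curvNumerator_self_right u v w)

theorem CurvExtension.swap_swap (h : CurvExtension G κ p) (hG : TransverseMetric G p)
    (u v w t : Coord m) : κ p u v w t = κ p v u t w := by
  have h1 := h.self_left hG (u + v) w t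
  have h2 := h.self_right hG v u (w + t)
  simp only [map_add, add_apply, h.self_left hG, h.self_right hG] at h1 h2
  linarith

/-- The relation `g^{ab} g_ab = m`, written without denominators. -/
theorem LocalMetric.metricTrace_adjMap (hG : LocalMetric G y) :
    metricTrace (G y) (adjMap G y) = m * gramDet G y := by
  have : ∀ a : Fin m, G y (basisVec a) (adjMap G y (EuclideanSpace.proj a)) = gramDet G y := by
    intro a
    rw [hG.symm_self, apply_adjMap]
    simp [basisVec_apply]
  simp [metricTrace, this]

/-- The double trace of a quadrilinear form with respect to two maps `J, J'`. -/
noncomputable def doubleTrace (Q : Quad m) (J J' : (Coord m →L[ℝ] ℝ) →L[ℝ] Coord m) : ℝ :=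
  metricTrace (ricciTrace Q J) J'

theorem doubleTrace_add_add (Q : Quad m) (J₁ J₂ : (Coord m →L[ℝ] ℝ) →L[ℝ] Coord m) :
    doubleTrace Q (J₁ + J₂) (J₁ + J₂) = doubleTrace Q J₁ J₁ + doubleTrace Q J₁ J₂ +
      doubleTrace Q J₂ J₁ + doubleTrace Q J₂ J₂ := by
  simp only [doubleTrace, metricTrace, ricciTrace_apply, add_apply, map_add, Finset.sum_add_distrib]
  ring

theorem doubleTrace_smul_right (a : ℝ) (Q : Quad m) (J J' : (Coord m →L[ℝ] ℝ) →L[ℝ] Coord m) :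
    doubleTrace Q J (a • J') = a * doubleTrace Q J J' := by
  simp only [doubleTrace, metricTrace, smul_apply, map_smul, smul_eq_mul, Finset.mul_sum]

theorem doubleTrace_smul_left (a : ℝ) (Q : Quad m) (J J' : (Coord m →L[ℝ] ℝ) →L[ℝ] Coord m) :
    doubleTrace Q (a • J) J' = a * doubleTrace Q J J' := by
  simp only [doubleTrace, metricTrace, ricciTrace_apply, smul_apply, map_smul, smul_eq_mul,
    Finset.mul_sum]

theorem doubleTrace_comm {Q : Quad m} (hQ : ∀ u v w t, Q u v w t = Q v u t w)
    (J J' : (Coord m →L[ℝ] ℝ) →L[ℝ] Coord m) : doubleTrace Q J J' = doubleTrace Q J' J := by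
  simp only [doubleTrace, metricTrace, ricciTrace_apply]
  rw [Finset.sum_comm]
  exact Finset.sum_congr rfl fun a _ => Finset.sum_congr rfl fun b _ => hQ _ _ _ _

/-- The square `c r ⊗ r` as a map from covectors to vectors. -/
noncomputable def squareMap (c : ℝ) (r : Coord m) : (Coord m →L[ℝ] ℝ) →L[ℝ] Coord m :=
  (c • ContinuousLinearMap.apply ℝ ℝ r).smulRight r

theorem squareMap_apply (c : ℝ) (r : Coord m) (α : Coord m →L[ℝ] ℝ) :
    squareMap c r α = (c * α r) • r := by
  simp [squareMap]

theorem SmoothNear.squareMap {c : Coord m → ℝ} (hc : SmoothNear c p) (hR : SmoothNear R p) :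
    SmoothNear (fun y => squareMap (c y) (R y)) p := by
  have h1 : SmoothNear (fun y => c y • ContinuousLinearMap.apply ℝ ℝ (R y)) p :=
    hc.smul ((SmoothNear.const (ContinuousLinearMap.apply ℝ ℝ (E := Coord m))).clm_apply hR)
  filter_upwards [h1, hR] with y h1 h2 using h1.smulRight h2

/-- Along the singular hypersurface, if `κ(R, v, R, t) = k g(v, t)`, then the double trace of `κ`
has leading coefficient `2 (m - 1) c k`, where `adj = c R ⊗ R`. -/
theorem CurvExtension.doubleTrace_eq (hG : TransverseMetric G p) (hp : gramDet G p = 0)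
    (hR : RadicalGerm G R p) (h : CurvExtension G κ p) {c : Coord m → ℝ} (hcs : SmoothNear c p)
    (hc : ∀ᶠ y in 𝓝 p, gramDet G y = 0 → c y ≠ 0 ∧ ∀ α, adjMap G y α = (c y * α (R y)) • R y)
    {s : Coord m → ℝ} (hs : SmoothNear s p)
    (hsδ : ∀ᶠ y in 𝓝 p, doubleTrace (κ y) (adjMap G y) (adjMap G y) = gramDet G y * s y) {k : ℝ}
    (hk : ∀ v t, κ p (R p) v (R p) t = k * G p v t) : s p = 2 * ((m : ℝ) - 1) * (c p * k) := by
  have hδ := hG.smooth_gramDet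
  have hA := hG.smooth_adjMap
  have hR2 := hcs.squareMap hR.smooth
  -- `adj = c R ⊗ R + det • B` and `g R = det • ρ`
  obtain ⟨B, hB, hBe⟩ := exists_smul_eq_of_eq_zero (hA.sub hR2) hδ hG.fderiv_ne (by
    filter_upwards [hc] with y hy h0
    ext1 α
    rw [sub_apply, (hy h0).2, squareMap_apply, sub_self, zero_apply])
  obtain ⟨ρ, hρ, hρe⟩ := exists_smul_eq_of_eq_zero (hG.smooth.clm_apply hR.smooth) hδ
    hG.fderiv_ne (by filter_upwards [hR.radical] with y hy h0 using (hy h0).1)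
  obtain ⟨hr, hr0⟩ := hR.radical.self_of_nhds hp
  obtain ⟨hc0, hcA⟩ := hc.self_of_nhds hp
  have hρR : c p * ρ p (R p) = 1 := by
    have h1 : adjMap G p (ρ p) = R p := by
      refine eq_of_eventually_ne_zero (F := fun y => adjMap G y (ρ y)) (F' := R) hG.fderiv_ne
        (hA.clm_apply hρ).continuousAt hR.smooth.continuousAt ?_
      filter_upwards [hρe] with y h1 hy
      have := adjMap_apply_self (G := G) (y := y) (R y)
      rw [h1, map_smul] at this
      exact smul_right_injective _ hy this
    rw [hcA] at h1
    by_contra hne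
    refine hr0 ?_
    have : (c p * ρ p (R p) - 1) • R p = 0 := by rw [sub_smul, h1, one_smul, sub_self]
    exact (smul_eq_zero.1 this).resolve_left (sub_ne_zero.2 hne)
  have hdec : ∀ᶠ y in 𝓝 p, adjMap G y = squareMap (c y) (R y) + gramDet G y • B y := by
    filter_upwards [hBe] with y hy
    rw [← hy]; simp
  have hGB : metricTrace (G p) (B p) = (m : ℝ) - 1 := by
    have h1 : (fun y => c y * ρ y (R y) + metricTrace (G y) (B y)) p = (fun _ => (m : ℝ)) p := by
      refine eq_of_eventually_ne_zero (δ := gramDet G) hG.fderiv_ne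
        ((hcs.mul (hρ.clm_apply hR.smooth)).add (hG.smooth.metricTrace hB)).continuousAt
        continuousAt_const ?_
      filter_upwards [hdec, hρe, hG.toLocalMetric.eventually] with y h1 h2 h3 hy
      have h4 := h3.metricTrace_adjMap
      have h5 : metricTrace (G y) (adjMap G y) = metricTrace (G y) (squareMap (c y) (R y)) +
          gramDet G y * metricTrace (G y) (B y) := by
        rw [h1]
        simp only [metricTrace, add_apply, smul_apply, map_add, map_smul, smul_eq_mul,
          Finset.sum_add_distrib, Finset.mul_sum]
      rw [h4, metricTrace_of_rank_one _ (squareMap_apply _ _), h2, smul_apply, smul_eq_mul] at h5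
      refine mul_left_cancel₀ hy ?_
      linear_combination -h5
    simp only [hρR] at h1
    linarith
  have hsp : s p = (fun y => 2 * doubleTrace (κ y) (squareMap (c y) (R y)) (B y) +
      gramDet G y * doubleTrace (κ y) (B y) (B y)) p := by
    refine eq_of_eventually_ne_zero (δ := gramDet G) hG.fderiv_ne hs.continuousAt
      (((SmoothNear.const (2 : ℝ)).mul ((h.smooth.ricciTrace hR2).metricTrace hB)).add
        (hδ.mul ((h.smooth.ricciTrace hB).metricTrace hB))).continuousAt ?_
    filter_upwards [hdec, hsδ, h.eventually, hG.eventually] with y h1 h2 h3 h4 hy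
    rw [h1, doubleTrace_add_add, doubleTrace_smul_right, doubleTrace_smul_left,
      doubleTrace_smul_left, doubleTrace_smul_right,
      doubleTrace_comm (h3.swap_swap h4) (B y) (squareMap (c y) (R y))] at h2
    have h5 : doubleTrace (κ y) (squareMap (c y) (R y)) (squareMap (c y) (R y)) = 0 := by
      rw [doubleTrace, metricTrace_of_rank_one _ (squareMap_apply _ _),
        ricciTrace_of_rank_one _ (squareMap_apply _ _), h3.self_left h4]
      simp
    rw [h5] at h2
    refine mul_left_cancel₀ hy ?_
    change _ = gramDet G y * (2 * doubleTrace (κ y) (squareMap (c y) (R y)) (B y) +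
      gramDet G y * doubleTrace (κ y) (B y) (B y))
    linear_combination -h2
  have hsq : ricciTrace (κ p) (squareMap (c p) (R p)) = (c p * k) • G p := by
    ext v t
    rw [ricciTrace_of_rank_one _ (squareMap_apply _ _), hk]
    simp [mul_assoc]
  rw [hsp]
  simp only [hp, zero_mul, add_zero, doubleTrace, hsq]
  have : metricTrace ((c p * k) • G p) (B p) = (c p * k) * metricTrace (G p) (B p) := by
    simp [metricTrace, Finset.mul_sum]
  rw [this, hGB]
  ring

/-- The Weyl tensor in terms of a smooth extension of the curvature. -/
theorem CurvExtension.coordWeyl_eq (hG : LocalMetric G y) (hy : gramDet G y ≠ 0)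
    (h : curvQuad G y = gramDet G y • κ y) {s : ℝ}
    (hs : doubleTrace (κ y) (adjMap G y) (adjMap G y) = gramDet G y * s) (u v w t : Coord m) :
    gramDet G y * coordWeyl G y u v w t = gramDet G y * κ y u v w t - kulkarniNomizu
      (fun a b => schoutenForm (ricciTrace (κ y) (adjMap G y)) s (G y) a b)
      (fun a b => G y a b) u v w t := by
  have hK : ∀ u v w t, coordCurv G y u v w t = κ y u v w t := fun u v w t => by
    rw [hG.coordCurv_eq hy, h]
    simp only [smul_apply, smul_eq_mul]
    exact inv_mul_cancel_left₀ hy _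
  have h1 : ricciTrace (κ y) ((gramDet G y)⁻¹ • adjMap G y) =
      (gramDet G y)⁻¹ • ricciTrace (κ y) (adjMap G y) := by
    ext v t
    simp [ricciTrace_apply, Finset.mul_sum]
  rw [doubleTrace] at hs
  rw [hG.coordWeyl_eq hy hK, inverse_eq_smul_adjMap hy, h1, metricTrace_smul_smul, hs]
  simp only [schoutenForm, kulkarniNomizu, smul_apply, sub_apply, smul_eq_mul]
  field_simp

theorem CurvExtension.exists_scalar (hG : TransverseMetric G p)
    (h : CurvExtension G κ p) {c : Coord m → ℝ}
    (hc : ∀ᶠ y in 𝓝 p, gramDet G y = 0 → c y ≠ 0 ∧ ∀ α, adjMap G y α = (c y * α (R y)) • R y) :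
    ∃ s : Coord m → ℝ, SmoothNear s p ∧
      ∀ᶠ y in 𝓝 p, doubleTrace (κ y) (adjMap G y) (adjMap G y) = gramDet G y * s y := by
  obtain ⟨s, hs, hsδ⟩ := exists_smul_eq_of_eq_zero
    ((h.smooth.ricciTrace hG.smooth_adjMap).metricTrace hG.smooth_adjMap)
    hG.smooth_gramDet hG.fderiv_ne (by
      filter_upwards [hc, h.eventually, hG.eventually] with y hcy h1 h2 hy
      rw [metricTrace_of_rank_one _ (hcy hy).2, ricciTrace_of_rank_one _ (hcy hy).2,
        h1.self_left h2]
      simp)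
  exact ⟨s, hs, hsδ⟩

/-- If the curvature and the Weyl tensor both extend, then the Jacobi form `κ(R, ·, R, ·)` is
conformal to the metric along the singular hypersurface. -/
theorem WeylExtendsNear.jacobi_eq (hm : 4 ≤ m) (hG : TransverseMetric G p)
    (hp : gramDet G p = 0) (hR : RadicalGerm G R p) (h : CurvExtension G κ p)
    (hW : WeylExtendsNear G p) :
    ∃ k : Coord m → ℝ, SmoothNear k p ∧ ∀ᶠ y in 𝓝 p, gramDet G y = 0 → ∀ v t,
      κ y (R y) v (R y) t = k y * G y v t := by
  obtain ⟨T, hT, hTW⟩ := hW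
  obtain ⟨c, hcs, hcp, hc⟩ := hR.exists_factor hG hp
  obtain ⟨s, hs, hsδ⟩ := h.exists_scalar hG hc
  have hm2 : (m : ℝ) - 2 ≠ 0 := by
    have : (4 : ℝ) ≤ m := by exact_mod_cast hm
    linarith
  have hric : SmoothNear (fun y => ricciTrace (κ y) (adjMap G y)) p :=
    h.smooth.ricciTrace hG.smooth_adjMap
  have hid : ∀ᶠ y in 𝓝 p, gramDet G y ≠ 0 → ∀ u v w t,
      gramDet G y * T y u v w t = gramDet G y * κ y u v w t -
        kulkarniNomizu (fun a b => schoutenForm (ricciTrace (κ y) (adjMap G y)) (s y)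
          (G y) a b) (fun a b => G y a b) u v w t := by
    filter_upwards [hG.toLocalMetric.eventually, hTW, hsδ, h.eq] with y h1 h2 h3 h4 hy u v w t
    rw [← h2 hy]
    exact CurvExtension.coordWeyl_eq h1 hy h4 h3 u v w t
  refine ⟨fun y => s y * (2 * ((m : ℝ) - 1))⁻¹ * (c y)⁻¹,
    (hs.mul (.const _)).mul (hcs.inv hcp), ?_⟩
  filter_upwards [hG.eventually, hR.radical, hc, hT.eventually, hs.eventually, hric.eventually,
    eventually_eventually_nhds.2 hid, h.smooth.eventually]
    with y hGy hRy hcy hTy hsy hricy hidy hκ hy v t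
  obtain ⟨hr, hr0⟩ := hRy hy
  obtain ⟨hc0, hcA⟩ := hcy hy
  have hS : schoutenForm (ricciTrace (κ y) (adjMap G y)) (s y) (G y) = 0 := by
    refine eq_zero_of_kulkarniNomizu_eq_zero hm hGy.symm_self (r := R y)
      (fun s hs => hGy.exists_eq_smul hr0 hr hs) fun a b d e => ?_
    have hδ := hGy.smooth_gramDet
    have := eq_of_eventually_ne_zero hGy.fderiv_ne
      (hδ.mul (hTy.quad_apply (.const a) (.const b) (.const d) (.const e))).continuousAt
      ((hδ.mul (hκ.quad_apply (.const a) (.const b) (.const d)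
        (.const e))).sub ((hricy.schoutenForm hsy hGy.smooth).kulkarniNomizu
          hGy.smooth a b d e)).continuousAt
      (hidy.mono fun y h hy => h hy a b d e)
    simpa [hy] using this
  have h1 := congrArg (fun B : Bilin m => B v t) hS
  simp only [schoutenForm, smul_apply, sub_apply, smul_eq_mul, zero_apply,
    ricciTrace_of_rank_one _ hcA] at h1
  field_simp at h1 ⊢
  linear_combination h1

theorem isQuadrilinear_kulkarniNomizu (A B : Bilin m) :
    IsQuadrilinear (kulkarniNomizu (fun a b => A a b) (fun a b => B a b)) := by
  constructor <;> intros <;> constructor <;> intros <;>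
  simp only [kulkarniNomizu, map_add, map_smul, add_apply, smul_apply, smul_eq_mul] <;> ring

/-- If the curvature extends and the Jacobi form `κ(R, ·, R, ·)` is conformal to the metric along
the singular hypersurface, then the Weyl tensor extends. -/
theorem CurvExtension.weylExtendsNear (hm : 4 ≤ m) (hG : TransverseMetric G p)
    (hp : gramDet G p = 0) (hR : RadicalGerm G R p) (h : CurvExtension G κ p)
    (hk : ∀ᶠ y in 𝓝 p, gramDet G y = 0 → ∃ k : ℝ, ∀ v t,
      κ y (R y) v (R y) t = k * G y v t) : WeylExtendsNear G p := by
  obtain ⟨c, hcs, hcp, hc⟩ := hR.exists_factor hG hp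
  obtain ⟨s, hs, hsδ⟩ := h.exists_scalar hG hc
  have hm1 : (m : ℝ) - 1 ≠ 0 := by
    have : (4 : ℝ) ≤ m := by exact_mod_cast hm
    linarith
  have hSm : SmoothNear (fun y => schoutenForm (ricciTrace (κ y) (adjMap G y)) (s y) (G y)) p :=
    (h.smooth.ricciTrace hG.smooth_adjMap).schoutenForm hs hG.smooth
  obtain ⟨S, hS, hSe⟩ := exists_smul_eq_of_eq_zero hSm hG.smooth_gramDet hG.fderiv_ne (by
    filter_upwards [hk, hc, hG.eventually, hR.eventually, h.eventually, hcs.eventually,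
      hs.eventually, eventually_eventually_nhds.2 hc, eventually_eventually_nhds.2 hsδ]
      with y hky hcy h1 h2 h3 h4 h5 h6 h7 hy
    obtain ⟨k, hk⟩ := hky hy
    have hsy := h3.doubleTrace_eq h1 hy h2 h4 h6 h5 h7 hk
    ext v t
    simp only [schoutenForm, smul_apply, sub_apply, smul_eq_mul, zero_apply,
      ricciTrace_of_rank_one _ (hcy hy).2, hk, hsy]
    field_simp
    ring)
  refine ⟨fun y => κ y - quadOfComponents fun a b c d => kulkarniNomizu (fun a b => S y a b)
    (fun a b => G y a b) (basisVec a) (basisVec b) (basisVec c) (basisVec d), ?_, ?_⟩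
  · refine h.smooth.sub ?_
    unfold quadOfComponents
    exact SmoothNear.sum (s := Finset.univ) fun _ _ => SmoothNear.sum (s := Finset.univ) fun _ _ =>
      SmoothNear.sum (s := Finset.univ) fun _ _ => SmoothNear.sum (s := Finset.univ) fun _ _ =>
      (hS.kulkarniNomizu hG.smooth _ _ _ _).smul (.const _)
  · filter_upwards [hSe, hG.toLocalMetric.eventually, h.eq, hsδ] with y h1 h2 h3 h4 hy u v w t
    have := CurvExtension.coordWeyl_eq h2 hy h3 h4 u v w t
    rw [h1] at this
    refine mul_left_cancel₀ hy ?_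
    rw [this, sub_apply, sub_apply, sub_apply, sub_apply,
      quadOfComponents_apply (isQuadrilinear_kulkarniNomizu _ _)]
    simp only [kulkarniNomizu, smul_apply, smul_eq_mul]
    ring

end SimplePole

/-! ### The third fundamental form and the curvature -/

section ThirdForm

variable {m : ℕ} {G : Coord m → Bilin m} {R X Y N : Coord m → Coord m} {p q y : Coord m}
  {κ : Coord m → Quad m}

theorem LocalMetric.smooth_coordDualConn (hG : LocalMetric G p) (hX : SmoothNear X p)
    (hY : SmoothNear Y p) : SmoothNear (coordDualConn G X Y) p :=
  (hG.smooth.clm_apply (hY.fderiv_right.clm_apply hX)).add (hG.smooth_christoffelFirst hX hY)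

/-- For a `II`-flat metric with transverse radical, the Levi-Civita derivative of fields tangent to
the singular hypersurface extends smoothly. -/
theorem FlatGerm.exists_nabla (hG : TransverseMetric G p) (hR : RadicalGerm G R p)
    (hII : FlatGerm G R p) (hX : SmoothNear X p) (hY : SmoothNear Y p)
    (hXt : ∀ᶠ y in 𝓝 p, gramDet G y = 0 → fderiv ℝ (gramDet G) y (X y) = 0)
    (hYt : ∀ᶠ y in 𝓝 p, gramDet G y = 0 → fderiv ℝ (gramDet G) y (Y y) = 0) :
    ∃ N : Coord m → Coord m, SmoothNear N p ∧
      ∀ᶠ y in 𝓝 p, gramDet G y ≠ 0 → G y (N y) = coordDualConn G X Y y := by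
  obtain ⟨N, hN, hNe⟩ := exists_smul_eq_of_eq_zero
    (hG.smooth_adjMap.clm_apply (hG.smooth_coordDualConn hX hY)) hG.smooth_gramDet hG.fderiv_ne (by
      filter_upwards [hG.eventually, hR.radical, hII, hXt, hYt] with y h1 h2 h3 h4 h5 hy
      obtain ⟨hr, hr0⟩ := h2 hy
      obtain ⟨c, hc0, hc⟩ := h1.exists_adjMap_eq hr0 hr
      rw [hc, coordDualConn, add_apply, RadicalGerm.apply_right hr h1.toLocalMetric,
        h3 hy _ _ (h4 hy) (h5 hy)]
      simp)
  refine ⟨N, hN, ?_⟩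
  filter_upwards [hNe] with y h1 hy
  have := apply_adjMap (G := G) (y := y) (coordDualConn G X Y y)
  rw [h1, map_smul] at this
  exact smul_right_injective _ hy this

/-- Derivative in a radical direction of `α (adj β)`, where `α` vanishes on the radical. -/
theorem TransverseMetric.fderiv_adjMap (hG : TransverseMetric G p) {r n : Coord m}
    {c : ℝ} (hc : ∀ α, adjMap G p α = (c * α r) • r)
    (hδp : gramDet G p = 0) {α β : Coord m → Coord m →L[ℝ] ℝ} (hα : SmoothNear α p)
    (hβ : SmoothNear β p) (hn : α p = G p n) :
    fderiv ℝ (fun y => α y (adjMap G y (β y))) p r = c * β p r * fderiv ℝ α p r r +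
      fderiv ℝ (gramDet G) p r * β p n - c * β p r * fderiv ℝ G p r r n := by
  have hA := hG.smooth_adjMap.clm_apply hβ
  rw [fderiv_clm_apply hα.differentiableAt hA.differentiableAt]
  have h1 : (fun y => G y (adjMap G y (β y))) = fun y => gramDet G y • β y := by
    funext y; rw [apply_adjMap]
  have h2 : fderiv ℝ (fun y => G y (adjMap G y (β y))) p r n =
      fderiv ℝ (fun y => gramDet G y • β y) p r n := by rw [h1]
  rw [fderiv_clm_apply hG.smooth.differentiableAt hA.differentiableAt,
    fderiv_fun_smul hG.smooth_gramDet.differentiableAt hβ.differentiableAt] at h2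
  simp only [add_apply, ContinuousLinearMap.comp_apply, ContinuousLinearMap.flip_apply, hδp,
    zero_smul, smul_apply, ContinuousLinearMap.smulRight_apply, smul_eq_mul, hc, map_smul] at h2 ⊢
  rw [hn, hG.symm_self n]
  simp at h2
  linear_combination h2

/-- The numerator of the curvature has derivative `dδ ⊗ κ` along the singular hypersurface. -/
theorem CurvExtension.fderiv_mul_apply (hG : LocalMetric G p) (hp : gramDet G p = 0)
    (h : CurvExtension G κ p) (r u v : Coord m) :
    fderiv ℝ (gramDet G) p r * κ p r u r v =
      fderiv ℝ (gramDet G) p r * (fderiv ℝ (christoffelMap G) p r u v r -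
        fderiv ℝ (christoffelMap G) p u r v r) -
      fderiv ℝ (fun y => christoffelFirst G y u v (adjMap G y (christoffelFirst G y r r))) p r +
      fderiv ℝ (fun y => christoffelFirst G y u r (adjMap G y (christoffelFirst G y r v))) p r := by
  have hδ := hG.smooth_gramDet
  have hC : ∀ b d : Coord m, SmoothNear (fun y => christoffelFirst G y b d) p := fun b d =>
    hG.smooth_christoffelFirst (.const b) (.const d)
  set f : Coord m → ℝ := fun y => christoffelFirst G y u v (adjMap G y
    (christoffelFirst G y r r)) with hf
  set g : Coord m → ℝ := fun y => christoffelFirst G y u r (adjMap G y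
    (christoffelFirst G y r v)) with hg
  have hfs : DifferentiableAt ℝ f p :=
    ((hC u v).clm_apply (hG.smooth_adjMap.clm_apply (hC r r))).differentiableAt
  have hgs : DifferentiableAt ℝ g p :=
    ((hC u r).clm_apply (hG.smooth_adjMap.clm_apply (hC r v))).differentiableAt
  set e : Coord m → ℝ := fun y => fderiv ℝ (christoffelMap G) y r u v r -
    fderiv ℝ (christoffelMap G) y u r v r with he
  have hes : DifferentiableAt ℝ e p := by
    have hD : ∀ u v t w : Coord m,
        SmoothNear (fun y => fderiv ℝ (christoffelMap G) y u v t w) p := fun u v t w =>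
      (((hG.smooth_christoffelMap.fderiv_right.clm_apply (.const u)).clm_apply
        (.const v)).clm_apply (.const t)).clm_apply (.const w)
    exact ((hD _ _ _ _).sub (hD _ _ _ _)).differentiableAt
  have hκ : DifferentiableAt ℝ (fun y => κ y r u r v) p :=
    (h.smooth.quad_apply (.const _) (.const _) (.const _) (.const _)).differentiableAt
  have h3 : (fun y => gramDet G y * κ y r u r v) =ᶠ[𝓝 p]
      fun y => gramDet G y * e y - f y + g y := by
    filter_upwards [h.eq, hG.symm] with y h4 h5
    have := congrArg (fun Q : Quad m => Q r u r v) h4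
    simp only [curvQuad_apply, smul_apply, smul_eq_mul] at this
    rw [← this, curvNumerator, apply_adjMap_comm h5]
  have h4 : fderiv ℝ (fun y => gramDet G y * κ y r u r v) p r =
      fderiv ℝ (fun y => gramDet G y * e y - f y + g y) p r := by rw [h3.fderiv_eq]
  have hδd := hδ.differentiableAt
  rw [fderiv_fun_mul hδd hκ, fderiv_fun_add ((hδd.fun_mul hes).fun_sub hfs) hgs,
    fderiv_fun_sub (hδd.fun_mul hes) hfs, fderiv_fun_mul hδd hes] at h4
  simp only [hp, zero_smul, zero_add, add_apply, sub_apply, smul_apply, smul_eq_mul] at h4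
  linear_combination h4

set_option maxHeartbeats 1000000 in
/-- On the singular hypersurface `III^R(X, Y) = II^R(∇_X Y, R)` equals the extended curvature
`κ(R, X, R, Y)`, for a `II`-flat metric with transverse radical and `X, Y` tangent to it. -/
theorem CurvExtension.thirdForm_eq (hG : TransverseMetric G p) (hp : gramDet G p = 0)
    (hR : RadicalGerm G R p) (htr : fderiv ℝ (gramDet G) p (R p) ≠ 0) (hII : FlatGerm G R p)
    (h : CurvExtension G κ p) (hX : SmoothNear X p) (hY : SmoothNear Y p) (hN : SmoothNear N p)
    (hXt : fderiv ℝ (gramDet G) p (X p) = 0)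
    (hYt : ∀ᶠ y in 𝓝 p, gramDet G y = 0 → fderiv ℝ (gramDet G) y (Y y) = 0)
    (hNe : ∀ᶠ y in 𝓝 p, gramDet G y ≠ 0 → G y (N y) = coordDualConn G X Y y) :
    christoffelFirst G p (N p) (R p) (R p) = κ p (R p) (X p) (R p) (Y p) := by
  obtain ⟨hr, hr0⟩ := hR.radical.self_of_nhds hp
  obtain ⟨c, hc0, hc⟩ := hG.exists_adjMap_eq hr0 hr
  have hYp := hYt.self_of_nhds hp
  obtain ⟨a, ha⟩ := hG.christoffelFirst_radical hr0 hr htr (hII.self_of_nhds hp)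
  have hD := hG.fderiv_gramDet_eq hr0 hr hc (R p)
  have hδ := hG.smooth_gramDet
  have hGs := hG.smooth.differentiableAt
  have hΓ := hG.smooth_christoffelMap
  have hcomm := hG.christoffelFirst_comm
  -- differentiation along the hypersurface of functions vanishing on it
  have tang : ∀ {V : Type} [NormedAddCommGroup V] [NormedSpace ℝ V] [CompleteSpace V]
      {F : Coord m → V}, SmoothNear F p → (∀ᶠ y in 𝓝 p, gramDet G y = 0 → F y = 0) →
      ∀ w, fderiv ℝ (gramDet G) p w = 0 → fderiv ℝ F p w = 0 := by
    intro V _ _ _ F hF h0 w hw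
    obtain ⟨x, hx⟩ := exists_fderiv_apply_eq_smul hF hδ hG.fderiv_ne hp h0
    rw [hx, hw, zero_smul]
  have hGR : ∀ w, fderiv ℝ (gramDet G) p w = 0 → ∀ z,
      fderiv ℝ G p w (R p) z = - G p (fderiv ℝ R p w) z := by
    intro w hw z
    have := tang (hG.smooth.clm_apply hR.smooth)
      (hR.radical.mono fun y hy h0 => (hy h0).1) w hw
    rw [fderiv_clm_apply hGs hR.smooth.differentiableAt] at this
    have := congrArg (fun α : Coord m →L[ℝ] ℝ => α z) this
    simp at this
    linarith
  have hCR : ∀ w, fderiv ℝ (gramDet G) p w = 0 → ∀ z,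
      christoffelFirst G p w (R p) z = - G p (fderiv ℝ R p w) z := by
    intro w hw z
    have h1 := hG.fderiv_eq_christoffelFirst w (R p) z
    rw [hGR w hw, ha w z, hw] at h1
    linarith
  set n := N p - fderiv ℝ Y p (X p) with hn
  set M := fderiv ℝ (christoffelMap G) p with hM
  have hMf : ∀ w b d : Coord m,
      fderiv ℝ (fun y => christoffelFirst G y b d) p w = M w b d := by
    intro w b d
    have h1 : (fun y => christoffelFirst G y b d) = fun y => christoffelMap G y b d := rfl
    rw [h1, fderiv_clm_apply (hΓ.differentiableAt.clm_apply (differentiableAt_const _))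
      (differentiableAt_const _), fderiv_clm_apply hΓ.differentiableAt (differentiableAt_const _)]
    simp [hM]
  -- the derivative of `II(R, Y) = 0` along the hypersurface
  have hb : M (X p) (R p) (Y p) (R p) + christoffelFirst G p (R p) (fderiv ℝ Y p (X p)) (R p) -
      G p (fderiv ℝ R p (Y p)) (fderiv ℝ R p (X p)) = 0 := by
    have h1 := tang (F := fun y => christoffelMap G y (R y) (Y y) (R y))
      (((hΓ.clm_apply hR.smooth).clm_apply hY).clm_apply hR.smooth) (by
        filter_upwards [hG.eventually, hR.radical, hYt] with y h1 h2 h3 hy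
        obtain ⟨c, -, hc⟩ := h1.christoffelFirst_right_eq (h2 hy).2 (h2 hy).1
        rw [christoffelMap_apply, h1.christoffelFirst_comm, hc, h3 hy, mul_zero]) (X p) hXt
    rw [fderiv_clm_apply ((hΓ.clm_apply hR.smooth).clm_apply hY).differentiableAt
      hR.smooth.differentiableAt, fderiv_clm_apply (hΓ.clm_apply hR.smooth).differentiableAt
      hY.differentiableAt, fderiv_clm_apply hΓ.differentiableAt hR.smooth.differentiableAt] at h1
    simp only [add_apply, ContinuousLinearMap.comp_apply, ContinuousLinearMap.flip_apply,
      christoffelMap_apply] at h1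
    rw [ha (fderiv ℝ R p (X p)) (Y p), hYp, hcomm (R p) (Y p), hCR _ hYp] at h1
    linear_combination h1
  -- the relation `g(∇_X Y, ·) = □_X Y` holds on the hypersurface too
  have hNe' : ∀ᶠ y in 𝓝 p, G y (N y) = coordDualConn G X Y y :=
    eventually_eq_of_eventually_ne_zero hδ hG.fderiv_ne (hG.smooth.clm_apply hN)
      (hG.smooth_coordDualConn hX hY) hNe
  have hnG : christoffelFirst G p (X p) (Y p) = G p n := by
    have := hNe'.self_of_nhds
    rw [coordDualConn] at this
    rw [hn, map_sub, this]
    simp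
  have he : fderiv ℝ G p (R p) n (R p) = M (R p) (X p) (Y p) (R p) := by
    have h1 : (fun y => G y (N y) (R p)) =ᶠ[𝓝 p] fun y => G y (fderiv ℝ Y y (X y)) (R p) +
        christoffelMap G y (X y) (Y y) (R p) := by
      filter_upwards [hNe'] with y hy
      rw [hy, coordDualConn]; simp
    have hYX := hY.fderiv_right.clm_apply hX
    have h2 : fderiv ℝ (fun y => G y (N y) (R p)) p (R p) =
      fderiv ℝ (fun y => G y (fderiv ℝ Y y (X y)) (R p) +
        christoffelMap G y (X y) (Y y) (R p)) p (R p) := by rw [h1.fderiv_eq]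
    have hcst := differentiableAt_const (𝕜 := ℝ) (x := p) (R p)
    rw [fderiv_fun_add ((hG.smooth.clm_apply hYX).differentiableAt.clm_apply hcst)
        (((hΓ.clm_apply hX).clm_apply hY).differentiableAt.clm_apply hcst),
      fderiv_clm_apply (hG.smooth.clm_apply hN).differentiableAt hcst,
      fderiv_clm_apply hGs hN.differentiableAt,
      fderiv_clm_apply (hG.smooth.clm_apply hYX).differentiableAt hcst,
      fderiv_clm_apply hGs hYX.differentiableAt,
      fderiv_clm_apply ((hΓ.clm_apply hX).clm_apply hY).differentiableAt hcst,
      fderiv_clm_apply (hΓ.clm_apply hX).differentiableAt hY.differentiableAt,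
      fderiv_clm_apply hΓ.differentiableAt hX.differentiableAt] at h2
    simp only [fderiv_fun_const, Pi.zero_apply, ContinuousLinearMap.comp_zero, zero_add, add_apply,
      ContinuousLinearMap.comp_apply, ContinuousLinearMap.flip_apply, christoffelMap_apply] at h2
    rw [RadicalGerm.apply_right hr hG.toLocalMetric, RadicalGerm.apply_right hr hG.toLocalMetric,
      ha (fderiv ℝ X p (R p)), ha (X p), hYp, hXt] at h2
    rw [hn, map_sub, sub_apply]
    linear_combination h2
  -- the derivative of the numerator of the curvature in the radical direction
  have hK : fderiv ℝ (gramDet G) p (R p) * κ p (R p) (X p) (R p) (Y p) =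
      fderiv ℝ (gramDet G) p (R p) * (M (R p) (X p) (Y p) (R p) - M (X p) (R p) (Y p) (R p)) -
      (c * christoffelFirst G p (R p) (R p) (R p) * M (R p) (X p) (Y p) (R p) +
        fderiv ℝ (gramDet G) p (R p) * christoffelFirst G p (R p) (R p) n -
        c * christoffelFirst G p (R p) (R p) (R p) * fderiv ℝ G p (R p) (R p) n) +
      fderiv ℝ (gramDet G) p (R p) * G p (fderiv ℝ R p (Y p)) (fderiv ℝ R p (X p)) := by
    have hC : ∀ b d : Coord m, SmoothNear (fun y => christoffelFirst G y b d) p := fun b d =>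
      hG.smooth_christoffelFirst (.const b) (.const d)
    have h1 := hG.fderiv_adjMap hc hp (hC (X p) (Y p)) (hC (R p) (R p)) hnG
    have h2 := hG.fderiv_adjMap hc hp (hC (X p) (R p)) (hC (R p) (Y p))
      (n := - fderiv ℝ R p (X p)) (by ext z; rw [hCR _ hXt]; simp)
    rw [ha (R p) (Y p), hYp, hcomm (R p) (Y p), hCR _ hYp, hMf] at h2
    rw [hMf] at h1
    rw [h.fderiv_mul_apply hG.toLocalMetric hp, h1, h2, map_neg]
    ring
  have hDG := hG.fderiv_eq_christoffelFirst (R p) n (R p)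
  have hsymm := hG.fderiv_symm (R p) (R p) n
  have hNp : christoffelFirst G p (N p) (R p) (R p) =
      christoffelFirst G p (R p) (fderiv ℝ Y p (X p)) (R p) +
      christoffelFirst G p (R p) n (R p) := by
    rw [← add_apply, ← christoffelFirst_add_right, hn, hcomm (N p)]
    simp
  refine mul_left_cancel₀ htr ?_
  rw [hK, hNp]
  rw [hsymm]
  rw [he] at hDG ⊢
  linear_combination fderiv ℝ (gramDet G) p (R p) * (hb - hDG)

end ThirdForm

/-! ### Conformal change of the metric -/

section Conformal

variable {m : ℕ} {G G' : Coord m → Bilin m} {f : Coord m → ℝ} {p y : Coord m}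

/-- The metric germs `G'` and `e^{2f} G` at `p` agree. -/
structure ConformalGerm (G G' : Coord m → Bilin m) (f : Coord m → ℝ) (p : Coord m) : Prop where
  smooth : SmoothNear f p
  eq : ∀ᶠ y in 𝓝 p, G' y = Real.exp (2 * f y) • G y

theorem ConformalGerm.eventually (h : ConformalGerm G G' f p) :
    ∀ᶠ q in 𝓝 p, ConformalGerm G G' f q := by
  filter_upwards [h.smooth.eventually, eventually_eventually_nhds.2 h.eq] with q h1 h2
    using ⟨h1, h2⟩

theorem SmoothNear.exp_two_mul (hf : SmoothNear f p) :
    SmoothNear (fun y => Real.exp (2 * f y)) p := by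
  filter_upwards [hf] with y hy using (contDiffAt_const.mul hy).exp

theorem ConformalGerm.localMetric (h : ConformalGerm G G' f p) (hG : LocalMetric G p) :
    LocalMetric G' p := by
  refine ⟨(h.smooth.exp_two_mul.smul hG.smooth).congr h.eq, ?_⟩
  filter_upwards [h.eq, hG.symm] with y h1 h2 u v
  rw [h1]
  simp [h2 u v]

theorem gramDet_smul (a : ℝ) (h : G' y = a • G y) : gramDet G' y = a ^ m * gramDet G y := by
  have : gramMatrix G' y = a • gramMatrix G y := by
    ext i j; simp [gramMatrix, h]
  rw [gramDet_eq, this, Matrix.det_smul, Fintype.card_fin, gramDet_eq]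

theorem ConformalGerm.gramDet_eq_zero_iff (h : ConformalGerm G G' f p) :
    gramDet G' p = 0 ↔ gramDet G p = 0 := by
  rw [gramDet_smul _ h.eq.self_of_nhds]
  simp [(Real.exp_pos _).ne']

theorem ConformalGerm.fderiv_gramDet (h : ConformalGerm G G' f p) (hG : LocalMetric G p)
    (hp : gramDet G p = 0) : fderiv ℝ (gramDet G') p =
      (Real.exp (2 * f p) ^ m) • fderiv ℝ (gramDet G) p := by
  have h1 : gramDet G' =ᶠ[𝓝 p] fun y => Real.exp (2 * f y) ^ m * gramDet G y := by
    filter_upwards [h.eq] with y hy using gramDet_smul _ hy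
  rw [h1.fderiv_eq, fderiv_fun_mul (h.smooth.exp_two_mul.differentiableAt.fun_pow m)
    hG.smooth_gramDet.differentiableAt]
  simp [hp]

theorem ConformalGerm.fderiv_gramDet_eq_zero_iff (h : ConformalGerm G G' f p)
    (hG : LocalMetric G p) (hp : gramDet G p = 0) (u : Coord m) :
    fderiv ℝ (gramDet G') p u = 0 ↔ fderiv ℝ (gramDet G) p u = 0 := by
  rw [h.fderiv_gramDet hG hp]
  simp [(Real.exp_pos _).ne']

theorem ConformalGerm.transverseMetric (h : ConformalGerm G G' f p) (hG : TransverseMetric G p)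
    (hp : gramDet G p = 0) : TransverseMetric G' p := by
  refine ⟨h.localMetric hG.toLocalMetric, ?_⟩
  rw [h.fderiv_gramDet hG.toLocalMetric hp]
  exact smul_ne_zero (pow_pos (Real.exp_pos _) m).ne' hG.fderiv_ne

theorem ConformalGerm.fderiv_eq (h : ConformalGerm G G' f p) (hG : LocalMetric G p)
    (u v w : Coord m) : fderiv ℝ G' p u v w =
      Real.exp (2 * f p) * (fderiv ℝ G p u v w + 2 * fderiv ℝ f p u * G p v w) := by
  have h1 : G' =ᶠ[𝓝 p] fun y => Real.exp (2 * f y) • G y := h.eq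
  have hd := h.smooth.differentiableAt
  have h2 : fderiv ℝ (fun y => Real.exp (2 * f y)) p u =
      Real.exp (2 * f p) * (2 * fderiv ℝ f p u) := by
    rw [_root_.fderiv_exp (hd.const_mul 2), fderiv_const_mul hd]
    simp
  rw [h1.fderiv_eq, fderiv_fun_smul h.smooth.exp_two_mul.differentiableAt
    hG.smooth.differentiableAt]
  simp only [add_apply, smul_apply, ContinuousLinearMap.smulRight_apply, smul_eq_mul, h2]
  ring

theorem ConformalGerm.christoffelFirst_eq (h : ConformalGerm G G' f p) (hG : LocalMetric G p)
    (u v : Coord m) : christoffelFirst G' p u v = Real.exp (2 * f p) •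
      (christoffelFirst G p u v + fderiv ℝ f p u • G p v + fderiv ℝ f p v • G p u -
        G p u v • fderiv ℝ f p) := by
  ext w
  simp only [christoffelFirst_apply, h.fderiv_eq hG, smul_apply, add_apply, sub_apply, smul_eq_mul]
  rw [hG.symm_self u v, hG.symm_self v u]
  ring

/-- The tensor `Hess f - df ⊗ df + ½ |df|² g` governing the conformal change of the curvature. -/
noncomputable def conformalTensor (G : Coord m → Bilin m) (f : Coord m → ℝ) (y : Coord m) :
    Bilin m :=
  fderiv ℝ (fderiv ℝ f) y -
    (ContinuousLinearMap.compL ℝ (Coord m) (Coord m →L[ℝ] ℝ) ℝ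
      ((fderiv ℝ f y).comp (G y).inverse)).comp (christoffelMap G y) -
    (fderiv ℝ f y).smulRight (fderiv ℝ f y) +
    (1 / 2 * fderiv ℝ f y ((G y).inverse (fderiv ℝ f y))) • G y

theorem conformalTensor_apply (u v : Coord m) : conformalTensor G f y u v =
    fderiv ℝ (fderiv ℝ f) y u v - fderiv ℝ f y ((G y).inverse (christoffelFirst G y u v)) -
      fderiv ℝ f y u * fderiv ℝ f y v +
      1 / 2 * fderiv ℝ f y ((G y).inverse (fderiv ℝ f y)) * G y u v := by
  simp [conformalTensor]

/-- The covariant curvature in terms of the Christoffel symbols of the first kind. -/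
theorem LocalMetric.coordCurv_eq_christoffel (hG : LocalMetric G y) (h : gramDet G y ≠ 0)
    (u v w t : Coord m) : coordCurv G y u v w t =
      fderiv ℝ (christoffelMap G) y u v t w - fderiv ℝ (christoffelMap G) y v u t w -
        christoffelFirst G y u w ((G y).inverse (christoffelFirst G y v t)) +
        christoffelFirst G y v w ((G y).inverse (christoffelFirst G y u t)) := by
  rw [coordCurv, coordRiem, map_sub, sub_apply,
    hG.apply_coordNabla_coordNabla h, hG.apply_coordNabla_coordNabla h]
  ring

theorem LocalMetric.inverse_comm (hG : LocalMetric G y) (h : gramDet G y ≠ 0)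
    (α β : Coord m →L[ℝ] ℝ) : α ((G y).inverse β) = β ((G y).inverse α) := by
  rw [inverse_eq_smul_adjMap h]
  simp [apply_adjMap_comm hG.symm_self α β]

theorem ConformalGerm.fderiv_christoffelMap (h : ConformalGerm G G' f p) (hG : LocalMetric G p)
    (u v t w : Coord m) : fderiv ℝ (christoffelMap G') p u v t w =
      Real.exp (2 * f p) * (2 * fderiv ℝ f p u * (christoffelFirst G p v t w +
          fderiv ℝ f p v * G p t w + fderiv ℝ f p t * G p v w - G p v t * fderiv ℝ f p w) +
        fderiv ℝ (christoffelMap G) p u v t w +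
        (fderiv ℝ (fderiv ℝ f) p u v * G p t w + fderiv ℝ f p v * fderiv ℝ G p u t w) +
        (fderiv ℝ (fderiv ℝ f) p u t * G p v w + fderiv ℝ f p t * fderiv ℝ G p u v w) -
        (fderiv ℝ G p u v t * fderiv ℝ f p w + G p v t * fderiv ℝ (fderiv ℝ f) p u w)) := by
  have hd := h.smooth.differentiableAt
  have hdd : ∀ a : Coord m, DifferentiableAt ℝ (fun z => fderiv ℝ f z a) p := fun a =>
    (h.smooth.fderiv_right.clm_apply (.const a)).differentiableAt
  have hGd : ∀ a b : Coord m, DifferentiableAt ℝ (fun z => G z a b) p := fun a b =>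
    (hG.smooth_apply a b).differentiableAt
  have hC : DifferentiableAt ℝ (fun z => christoffelFirst G z v t w) p :=
    ((hG.smooth_christoffelFirst (.const v) (.const t)).clm_apply (.const w)).differentiableAt
  have h1 : (fun z => christoffelFirst G' z v t w) =ᶠ[𝓝 p] fun z => Real.exp (2 * f z) *
      (christoffelFirst G z v t w + fderiv ℝ f z v * G z t w + fderiv ℝ f z t * G z v w -
        G z v t * fderiv ℝ f z w) := by
    filter_upwards [h.eventually, hG.eventually] with z h1 h2
    rw [h1.christoffelFirst_eq h2]
    simp
  have h2 : fderiv ℝ (fun y => Real.exp (2 * f y)) p u =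
      Real.exp (2 * f p) * (2 * fderiv ℝ f p u) := by
    rw [_root_.fderiv_exp (hd.const_mul 2), fderiv_const_mul hd]
    simp
  have h3 : ∀ a, fderiv ℝ (fun z => fderiv ℝ f z a) p u = fderiv ℝ (fderiv ℝ f) p u a := by
    intro a
    rw [fderiv_clm_apply h.smooth.fderiv_right.differentiableAt (differentiableAt_const a)]
    simp
  have hs1 := (hdd v).fun_mul (hGd t w)
  have hs2 := (hdd t).fun_mul (hGd v w)
  have hs3 := (hGd v t).fun_mul (hdd w)
  rw [← (h.localMetric hG).fderiv_christoffelFirst, ← hG.fderiv_christoffelFirst, h1.fderiv_eq,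
    fderiv_fun_mul h.smooth.exp_two_mul.differentiableAt
      (((hC.fun_add hs1).fun_add hs2).fun_sub hs3),
    fderiv_fun_sub ((hC.fun_add hs1).fun_add hs2) hs3, fderiv_fun_add (hC.fun_add hs1) hs2,
    fderiv_fun_add hC hs1, fderiv_fun_mul (hdd v) (hGd t w), fderiv_fun_mul (hdd t) (hGd v w),
    fderiv_fun_mul (hGd v t) (hdd w)]
  simp only [add_apply, sub_apply, smul_apply, smul_eq_mul, h2, h3,
    fderiv_apply₂ hG.smooth.differentiableAt]
  ring

/-- Conformal change of the covariant curvature. -/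
theorem ConformalGerm.coordCurv_eq (h : ConformalGerm G G' f p) (hG : LocalMetric G p)
    (hp : gramDet G p ≠ 0) (u v w t : Coord m) : coordCurv G' p u v w t =
      Real.exp (2 * f p) * (coordCurv G p u v w t - kulkarniNomizu
        (fun a b => conformalTensor G f p a b) (fun a b => G p a b) u v w t) := by
  have hp' : gramDet G' p ≠ 0 := fun h0 => hp (h.gramDet_eq_zero_iff.1 h0)
  have hG' := h.localMetric hG
  set J := (G p).inverse with hJ
  have hJ' : (G' p).inverse = (Real.exp (2 * f p))⁻¹ • J := by
    refine ContinuousLinearMap.inverse_eq ?_ ?_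
    · ext α v
      simp [h.eq.self_of_nhds, hJ, inverse_apply hp, (Real.exp_pos _).ne']
    · ext v : 1
      simp [h.eq.self_of_nhds, hJ, inverse_apply_self hp, (Real.exp_pos _).ne', smul_smul]
  have hJG : ∀ a, J (G p a) = a := inverse_apply_self hp
  have hGJ : ∀ a (α : Coord m →L[ℝ] ℝ), G p a (J α) = α a := fun a α => by
    rw [hG.symm_self, hJ, inverse_apply hp]
  have hsec : ∀ a b, fderiv ℝ (fderiv ℝ f) p a b = fderiv ℝ (fderiv ℝ f) p b a :=
    (h.smooth.contDiffAt.isSymmSndFDerivAt (by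
      rw [minSmoothness_of_isRCLikeNormedField]
      exact WithTop.coe_le_coe.2 (le_top : (2 : ℕ∞) ≤ ⊤))).eq
  have hcm := hG.christoffelFirst_comm
  have hexp : Real.exp (2 * f p) ≠ 0 := (Real.exp_pos _).ne'
  have hJC : ∀ a b, (G' p).inverse (christoffelFirst G' p a b) =
      J (christoffelFirst G p a b) + fderiv ℝ f p a • b + fderiv ℝ f p b • a -
        G p a b • J (fderiv ℝ f p) := by
    intro a b
    rw [hJ', h.christoffelFirst_eq hG, map_smul, smul_apply, smul_smul, mul_inv_cancel₀ hexp,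
      one_smul, map_sub, map_add, map_add, map_smul, map_smul, map_smul, hJG, hJG]
  have hCJ : ∀ a b (α : Coord m →L[ℝ] ℝ),
      christoffelFirst G p a b (J α) = α (J (christoffelFirst G p a b)) := fun a b α =>
    hG.inverse_comm hp _ _
  rw [hG.coordCurv_eq_christoffel hp, hG'.coordCurv_eq_christoffel hp',
    h.fderiv_christoffelMap hG, h.fderiv_christoffelMap hG, hJC, hJC, h.christoffelFirst_eq hG u w,
    h.christoffelFirst_eq hG v w]
  simp only [kulkarniNomizu, conformalTensor_apply, ← hJ, smul_apply, add_apply, sub_apply, map_add,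
    map_sub, map_smul, smul_eq_mul, hGJ, hCJ _ _ (fderiv ℝ f p), hG.fderiv_eq_christoffelFirst]
  rw [hsec v u, hcm v u, hG.symm_self w t, hG.symm_self w v, hG.symm_self w u,
    hG.symm_self v u]
  ring

/-- The Kulkarni-Nomizu product of two bilinear forms as a quadrilinear form. -/
noncomputable def kulkarniNomizuQuad (A B : Bilin m) : Quad m :=
  quadOfComponents fun a b c d => kulkarniNomizu (fun a b => A a b) (fun a b => B a b)
    (basisVec a) (basisVec b) (basisVec c) (basisVec d)

theorem kulkarniNomizuQuad_apply (A B : Bilin m) (u v w t : Coord m) :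
    kulkarniNomizuQuad A B u v w t =
      kulkarniNomizu (fun a b => A a b) (fun a b => B a b) u v w t :=
  quadOfComponents_apply (isQuadrilinear_kulkarniNomizu A B) u v w t

theorem LocalMetric.metricTrace_inverse (hG : LocalMetric G y) (h : gramDet G y ≠ 0) :
    metricTrace (G y) (G y).inverse = m := by
  have := hG.metricTrace_adjMap
  rw [inverse_eq_smul_adjMap h]
  have h1 := metricTrace_smul_smul 1 (gramDet G y)⁻¹ (G y) (adjMap G y)
  rw [one_smul] at h1
  rw [h1, this]
  field_simp

theorem LocalMetric.ricciTrace_kulkarniNomizuQuad (hG : LocalMetric G y) (h : gramDet G y ≠ 0)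
    (P : Bilin m) : ricciTrace (kulkarniNomizuQuad P (G y)) (G y).inverse =
      ((m : ℝ) - 2) • P + metricTrace P (G y).inverse • G y := by
  ext v t
  set J := (G y).inverse with hJ
  have h1 : ∑ a, P (basisVec a) (J (EuclideanSpace.proj a)) * G y v t =
      metricTrace P J * G y v t := by rw [metricTrace, Finset.sum_mul]
  have h2 : ∑ a, G y (basisVec a) t * P v (J (EuclideanSpace.proj a)) = P v t := by
    have := congrArg (fun α => P v (J α)) (covector_eq_sum (G y t))
    simp only [map_sum, map_smul, smul_eq_mul] at this
    rw [hJ, inverse_apply_self h] at this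
    rw [this]
    exact Finset.sum_congr rfl fun a _ => by rw [hG.symm_self]
  have h3 : ∑ a, G y (basisVec a) (J (EuclideanSpace.proj a)) * P v t = m * P v t := by
    rw [← Finset.sum_mul]
    congr 1
    exact hG.metricTrace_inverse h
  have h4 : ∑ a, P (basisVec a) t * G y v (J (EuclideanSpace.proj a)) = P v t := by
    have := covector_apply (P.flip t) v
    simp only [ContinuousLinearMap.flip_apply] at this
    rw [this]
    refine Finset.sum_congr rfl fun a _ => ?_
    rw [hG.symm_self v, hJ, inverse_apply h, proj_apply, mul_comm]
  rw [ricciTrace_apply]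
  simp only [kulkarniNomizuQuad_apply, kulkarniNomizu, Finset.sum_add_distrib,
    Finset.sum_sub_distrib, h1, h2, h3, h4, add_apply, smul_apply, smul_eq_mul]
  ring

theorem ricciTrace_sub (Q Q' : Quad m) (J : (Coord m →L[ℝ] ℝ) →L[ℝ] Coord m) :
    ricciTrace (Q - Q') J = ricciTrace Q J - ricciTrace Q' J := by
  ext v t
  simp [ricciTrace_apply]

theorem metricTrace_sub (B B' : Bilin m) (J : (Coord m →L[ℝ] ℝ) →L[ℝ] Coord m) :
    metricTrace (B - B') J = metricTrace B J - metricTrace B' J := by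
  simp [metricTrace]

/-- Conformal invariance of the Weyl tensor. -/
theorem ConformalGerm.coordWeyl_eq (hm : 4 ≤ m) (h : ConformalGerm G G' f p) (hG : LocalMetric G p)
    (hp : gramDet G p ≠ 0) (u v w t : Coord m) :
    coordWeyl G' p u v w t = Real.exp (2 * f p) * coordWeyl G p u v w t := by
  have hp' : gramDet G' p ≠ 0 := fun h0 => hp (h.gramDet_eq_zero_iff.1 h0)
  have hG' := h.localMetric hG
  have hexp : Real.exp (2 * f p) ≠ 0 := (Real.exp_pos _).ne'
  have hm1 : (m : ℝ) - 1 ≠ 0 := by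
    have : (4 : ℝ) ≤ m := by exact_mod_cast hm
    linarith
  have hm2 : (m : ℝ) - 2 ≠ 0 := by
    have : (4 : ℝ) ≤ m := by exact_mod_cast hm
    linarith
  set E := Real.exp (2 * f p) with hE
  obtain ⟨K, hK1⟩ : ∃ K : Quad m, ∀ u v w t, coordCurv G p u v w t = K u v w t :=
    ⟨_, hG.coordCurv_eq hp⟩
  set P := conformalTensor G f p with hP
  have hJ' : (G' p).inverse = E⁻¹ • (G p).inverse := by
    refine ContinuousLinearMap.inverse_eq ?_ ?_
    · ext α v
      simp [h.eq.self_of_nhds, inverse_apply hp, hexp, ← hE]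
    · ext v : 1
      simp [h.eq.self_of_nhds, inverse_apply_self hp, hexp, ← hE, smul_smul]
  have hK' : ∀ u v w t, coordCurv G' p u v w t =
      (E • (K - kulkarniNomizuQuad P (G p))) u v w t := by
    intro u v w t
    rw [h.coordCurv_eq hG hp, hK1]
    simp only [smul_apply, sub_apply, kulkarniNomizuQuad_apply, smul_eq_mul]
    rfl
  rw [hG.coordWeyl_eq hp hK1, hG'.coordWeyl_eq hp' hK', hJ', ricciTrace_smul_smul,
    mul_inv_cancel₀ hexp, one_smul, ricciTrace_sub, hG.ricciTrace_kulkarniNomizuQuad hp]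
  have htr : metricTrace (ricciTrace K (G p).inverse - (((m : ℝ) - 2) • P +
      metricTrace P (G p).inverse • G p)) (E⁻¹ • (G p).inverse) =
      E⁻¹ * (metricTrace (ricciTrace K (G p).inverse) (G p).inverse -
        2 * ((m : ℝ) - 1) * metricTrace P (G p).inverse) := by
    have h1 := metricTrace_smul_smul 1 E⁻¹ (ricciTrace K (G p).inverse - (((m : ℝ) - 2) • P +
      metricTrace P (G p).inverse • G p)) (G p).inverse
    have h2 : metricTrace (((m : ℝ) - 2) • P + metricTrace P (G p).inverse • G p) (G p).inverse =
        ((m : ℝ) - 2) * metricTrace P (G p).inverse +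
        metricTrace P (G p).inverse * metricTrace (G p) (G p).inverse := by
      simp [metricTrace, Finset.sum_add_distrib, Finset.mul_sum]
    rw [one_smul, one_mul] at h1
    rw [h1, metricTrace_sub, h2, hG.metricTrace_inverse hp]
    ring
  rw [htr]
  generalize metricTrace (ricciTrace K (G p).inverse) (G p).inverse = s
  generalize metricTrace P (G p).inverse = τ
  simp only [h.eq.self_of_nhds, ← hE, schoutenForm, kulkarniNomizu, kulkarniNomizuQuad_apply,
    smul_apply, sub_apply, add_apply, smul_eq_mul]
  field_simp
  ring

/-- Conformal change of the second fundamental form. -/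
theorem ConformalGerm.christoffelFirst_radical (h : ConformalGerm G G' f p) (hG : LocalMetric G p)
    {r : Coord m} (hr : G p r = 0) (u v : Coord m) : christoffelFirst G' p u v r =
      Real.exp (2 * f p) * (christoffelFirst G p u v r - fderiv ℝ f p r * G p u v) := by
  have h0 : ∀ v, G p v r = 0 := fun v => by
    rw [hG.symm_self, hr]
    rfl
  rw [h.christoffelFirst_eq hG]
  simp only [smul_apply, add_apply, sub_apply, smul_eq_mul, h0]
  ring

theorem ConformalGerm.weylExtendsNear (hm : 4 ≤ m) (h : ConformalGerm G G' f p)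
    (hG : LocalMetric G p) (hW : WeylExtendsNear G p) : WeylExtendsNear G' p := by
  obtain ⟨T, hT, hTW⟩ := hW
  refine ⟨fun y => Real.exp (2 * f y) • T y, h.smooth.exp_two_mul.smul hT, ?_⟩
  filter_upwards [h.eventually, hG.eventually, hTW] with y h1 h2 h3 hy u v w t
  have hy' : gramDet G y ≠ 0 := fun h0 => hy (h1.gramDet_eq_zero_iff.2 h0)
  rw [h1.coordWeyl_eq hm h2 hy', h3 hy']
  simp only [smul_apply, smul_eq_mul]

end Conformal

/-! ### Change of coordinates -/

section Pullback

variable {m : ℕ} {G G' : Coord m → Bilin m} {ψ : Coord m → Coord m} {y : Coord m}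

/-- The metric germ `G` at `y` is the pullback under `ψ` of the metric germ `G'` at `ψ y`. -/
structure PullbackGerm (G G' : Coord m → Bilin m) (ψ : Coord m → Coord m) (y : Coord m) :
    Prop where
  smooth : SmoothNear ψ y
  eq : ∀ᶠ z in 𝓝 y, G z = (G' (ψ z)).bilinearComp (fderiv ℝ ψ z) (fderiv ℝ ψ z)

theorem PullbackGerm.eventually (h : PullbackGerm G G' ψ y) :
    ∀ᶠ z in 𝓝 y, PullbackGerm G G' ψ z := by
  filter_upwards [h.smooth.eventually, eventually_eventually_nhds.2 h.eq] with z h1 h2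
    using ⟨h1, h2⟩

theorem PullbackGerm.apply (h : PullbackGerm G G' ψ y) (u v : Coord m) :
    G y u v = G' (ψ y) (fderiv ℝ ψ y u) (fderiv ℝ ψ y v) := by
  rw [h.eq.self_of_nhds]
  rfl

theorem det_eq_det_basisVec (L : Coord m →L[ℝ] Coord m) :
    L.det = (Matrix.of fun c a : Fin m => L (basisVec a) c).det := by
  rw [ContinuousLinearMap.det, ← LinearMap.det_toMatrix (EuclideanSpace.basisFun (Fin m) ℝ).toBasis]
  rfl

theorem PullbackGerm.gramDet_eq (h : PullbackGerm G G' ψ y) :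
    gramDet G y = (fderiv ℝ ψ y).det ^ 2 * gramDet G' (ψ y) := by
  set A : Matrix (Fin m) (Fin m) ℝ := Matrix.of fun c a => fderiv ℝ ψ y (basisVec a) c with hA
  have h1 : gramMatrix G y = A.transpose * gramMatrix G' (ψ y) * A := by
    ext a b
    have e1 : ∀ a, fderiv ℝ ψ y (basisVec a) = ∑ c, A c a • basisVec c := fun a =>
      (sum_smul_basisVec _).symm
    simp only [gramMatrix, Matrix.of_apply, h.apply, Matrix.mul_apply, Matrix.transpose_apply]
    rw [e1 a, e1 b]
    simp only [map_sum, map_smul, sum_apply, smul_apply, smul_eq_mul, Finset.mul_sum,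
      Finset.sum_mul]
    refine Finset.sum_congr rfl fun c _ => Finset.sum_congr rfl fun d _ => by ring
  rw [RiemannLorentz.gramDet_eq, RiemannLorentz.gramDet_eq, h1, Matrix.det_mul, Matrix.det_mul,
    Matrix.det_transpose, det_eq_det_basisVec]
  ring

theorem symm_fderiv_fderiv (hψ : SmoothNear ψ y) (u v : Coord m) :
    fderiv ℝ (fderiv ℝ ψ) y u v = fderiv ℝ (fderiv ℝ ψ) y v u :=
  (hψ.contDiffAt.isSymmSndFDerivAt (by
    rw [minSmoothness_of_isRCLikeNormedField]
    exact WithTop.coe_le_coe.2 (le_top : (2 : ℕ∞) ≤ ⊤))).eq u v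

theorem PullbackGerm.fderiv_eq (h : PullbackGerm G G' ψ y) (hG : LocalMetric G y)
    (hG' : LocalMetric G' (ψ y)) (u v w : Coord m) :
    fderiv ℝ G y u v w =
      fderiv ℝ G' (ψ y) (fderiv ℝ ψ y u) (fderiv ℝ ψ y v) (fderiv ℝ ψ y w) +
      G' (ψ y) (fderiv ℝ (fderiv ℝ ψ) y u v) (fderiv ℝ ψ y w) +
      G' (ψ y) (fderiv ℝ ψ y v) (fderiv ℝ (fderiv ℝ ψ) y u w) := by
  have h1 : (fun z => G z v w) =ᶠ[𝓝 y]
      fun z => G' (ψ z) (fderiv ℝ ψ z v) (fderiv ℝ ψ z w) := by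
    filter_upwards [h.eventually] with z hz using hz.apply v w
  have hd : ∀ a, DifferentiableAt ℝ (fun z => fderiv ℝ ψ z a) y := fun a =>
    (h.smooth.fderiv_right.clm_apply (.const a)).differentiableAt
  have hda : ∀ a b, fderiv ℝ (fun z => fderiv ℝ ψ z a) y b = fderiv ℝ (fderiv ℝ ψ) y b a := by
    intro a b
    rw [fderiv_clm_apply h.smooth.fderiv_right.differentiableAt (differentiableAt_const a)]
    simp
  have hGψ : DifferentiableAt ℝ (fun z => G' (ψ z)) y := (hG'.smooth.comp h.smooth).differentiableAt
  have hc : fderiv ℝ (fun z => G' (ψ z)) y = (fderiv ℝ G' (ψ y)).comp (fderiv ℝ ψ y) :=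
    fderiv_comp y hG'.smooth.differentiableAt h.smooth.differentiableAt
  rw [← fderiv_apply₂ hG.smooth.differentiableAt, h1.fderiv_eq,
    fderiv_clm_apply (hGψ.clm_apply (hd v)) (hd w), fderiv_clm_apply hGψ (hd v), hc]
  simp only [add_apply, ContinuousLinearMap.comp_apply, ContinuousLinearMap.flip_apply, hda]
  ring

/-- Change of the Christoffel symbols of the first kind under a coordinate change. -/
theorem PullbackGerm.christoffelFirst_eq (h : PullbackGerm G G' ψ y) (hG : LocalMetric G y)
    (hG' : LocalMetric G' (ψ y)) (u v w : Coord m) : christoffelFirst G y u v w =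
      G' (ψ y) (fderiv ℝ (fderiv ℝ ψ) y u v) (fderiv ℝ ψ y w) +
      christoffelFirst G' (ψ y) (fderiv ℝ ψ y u) (fderiv ℝ ψ y v) (fderiv ℝ ψ y w) := by
  simp only [christoffelFirst_apply, h.fderiv_eq hG hG']
  rw [symm_fderiv_fderiv h.smooth v u, symm_fderiv_fderiv h.smooth w u,
    symm_fderiv_fderiv h.smooth w v,
    hG'.symm_self (fderiv ℝ ψ y v) (fderiv ℝ (fderiv ℝ ψ) y u w),
    hG'.symm_self (fderiv ℝ ψ y u) (fderiv ℝ (fderiv ℝ ψ) y v w)]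
  ring

theorem PullbackGerm.fderiv_christoffelMap (h : PullbackGerm G G' ψ y) (hG : LocalMetric G y)
    (hG' : LocalMetric G' (ψ y)) (u v t w : Coord m) : fderiv ℝ (christoffelMap G) y u v t w =
      fderiv ℝ G' (ψ y) (fderiv ℝ ψ y u) (fderiv ℝ (fderiv ℝ ψ) y v t) (fderiv ℝ ψ y w) +
      G' (ψ y) (fderiv ℝ (fderiv ℝ (fderiv ℝ ψ)) y u v t) (fderiv ℝ ψ y w) +
      G' (ψ y) (fderiv ℝ (fderiv ℝ ψ) y v t) (fderiv ℝ (fderiv ℝ ψ) y u w) +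
      (fderiv ℝ (christoffelMap G') (ψ y) (fderiv ℝ ψ y u) (fderiv ℝ ψ y v) (fderiv ℝ ψ y t)
        (fderiv ℝ ψ y w) +
      christoffelFirst G' (ψ y) (fderiv ℝ (fderiv ℝ ψ) y u v) (fderiv ℝ ψ y t) (fderiv ℝ ψ y w) +
      christoffelFirst G' (ψ y) (fderiv ℝ ψ y v) (fderiv ℝ (fderiv ℝ ψ) y u t) (fderiv ℝ ψ y w) +
      christoffelFirst G' (ψ y) (fderiv ℝ ψ y v) (fderiv ℝ ψ y t)
        (fderiv ℝ (fderiv ℝ ψ) y u w)) := by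
  have hψ1 := h.smooth.fderiv_right
  have hψ2 := hψ1.fderiv_right
  have h1 : (fun z => christoffelFirst G z v t w) =ᶠ[𝓝 y] fun z =>
      G' (ψ z) (fderiv ℝ (fderiv ℝ ψ) z v t) (fderiv ℝ ψ z w) +
      christoffelMap G' (ψ z) (fderiv ℝ ψ z v) (fderiv ℝ ψ z t) (fderiv ℝ ψ z w) := by
    filter_upwards [h.eventually, hG.eventually,
      h.smooth.continuousAt.eventually hG'.eventually] with z h1 h2 h3
    rw [h1.christoffelFirst_eq h2 h3, christoffelMap_apply]
  have hd : ∀ a, DifferentiableAt ℝ (fun z => fderiv ℝ ψ z a) y := fun a =>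
    (hψ1.clm_apply (.const a)).differentiableAt
  have hda : ∀ a b, fderiv ℝ (fun z => fderiv ℝ ψ z a) y b = fderiv ℝ (fderiv ℝ ψ) y b a := by
    intro a b
    rw [fderiv_clm_apply hψ1.differentiableAt (differentiableAt_const a)]
    simp
  have hdd : DifferentiableAt ℝ (fun z => fderiv ℝ (fderiv ℝ ψ) z v t) y :=
    ((hψ2.clm_apply (.const v)).clm_apply (.const t)).differentiableAt
  have hdda : fderiv ℝ (fun z => fderiv ℝ (fderiv ℝ ψ) z v t) y u =
      fderiv ℝ (fderiv ℝ (fderiv ℝ ψ)) y u v t := by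
    rw [fderiv_clm_apply (hψ2.clm_apply (.const v)).differentiableAt (differentiableAt_const t),
      fderiv_clm_apply hψ2.differentiableAt (differentiableAt_const v)]
    simp
  have hGψ : DifferentiableAt ℝ (fun z => G' (ψ z)) y := (hG'.smooth.comp h.smooth).differentiableAt
  have hGc : fderiv ℝ (fun z => G' (ψ z)) y = (fderiv ℝ G' (ψ y)).comp (fderiv ℝ ψ y) :=
    fderiv_comp y hG'.smooth.differentiableAt h.smooth.differentiableAt
  have hCψ : DifferentiableAt ℝ (fun z => christoffelMap G' (ψ z)) y :=
    (hG'.smooth_christoffelMap.comp h.smooth).differentiableAt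
  have hCc : fderiv ℝ (fun z => christoffelMap G' (ψ z)) y =
      (fderiv ℝ (christoffelMap G') (ψ y)).comp (fderiv ℝ ψ y) :=
    fderiv_comp y hG'.smooth_christoffelMap.differentiableAt h.smooth.differentiableAt
  have hC1 := hCψ.clm_apply (hd v)
  have hC2 := hC1.clm_apply (hd t)
  have hG1 := hGψ.clm_apply hdd
  rw [← hG.fderiv_christoffelFirst, h1.fderiv_eq,
    fderiv_fun_add (hG1.clm_apply (hd w)) (hC2.clm_apply (hd w)), fderiv_clm_apply hG1 (hd w),
    fderiv_clm_apply hGψ hdd, fderiv_clm_apply hC2 (hd w), fderiv_clm_apply hC1 (hd t),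
    fderiv_clm_apply hCψ (hd v), hGc, hCc]
  simp only [add_apply, ContinuousLinearMap.comp_apply, ContinuousLinearMap.flip_apply, hda, hdda,
    christoffelMap_apply]
  ring

section Invertible

variable {D : Coord m ≃L[ℝ] Coord m}

theorem det_equiv_ne_zero (D : Coord m ≃L[ℝ] Coord m) :
    (D : Coord m →L[ℝ] Coord m).det ≠ 0 :=
  (LinearEquiv.isUnit_det' D.toLinearEquiv).ne_zero

theorem PullbackGerm.gramDet_eq_zero_iff (h : PullbackGerm G G' ψ y)
    (hD : fderiv ℝ ψ y = D) : gramDet G y = 0 ↔ gramDet G' (ψ y) = 0 := by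
  rw [h.gramDet_eq, hD]
  simp [det_equiv_ne_zero D]

theorem PullbackGerm.fderiv_gramDet (h : PullbackGerm G G' ψ y) (hG' : LocalMetric G' (ψ y))
    (hy : gramDet G' (ψ y) = 0) (u : Coord m) : fderiv ℝ (gramDet G) y u =
      (fderiv ℝ ψ y).det ^ 2 * fderiv ℝ (gramDet G') (ψ y) (fderiv ℝ ψ y u) := by
  have h1 : gramDet G =ᶠ[𝓝 y] fun z => ((fderiv ℝ ψ z).det * (fderiv ℝ ψ z).det) *
      gramDet G' (ψ z) := by
    filter_upwards [h.eventually] with z hz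
    rw [hz.gramDet_eq, sq]
  have hd : SmoothNear (fun z => (fderiv ℝ ψ z).det) y := by
    simp only [det_eq_det_basisVec]
    refine smoothNear_det fun c a => ?_
    exact (SmoothNear.const (EuclideanSpace.proj c : Coord m →L[ℝ] ℝ)).clm_apply
      (h.smooth.fderiv_right.clm_apply (.const (basisVec a)))
  have hc : fderiv ℝ (fun z => gramDet G' (ψ z)) y =
      (fderiv ℝ (gramDet G') (ψ y)).comp (fderiv ℝ ψ y) :=
    fderiv_comp y hG'.smooth_gramDet.differentiableAt h.smooth.differentiableAt
  rw [h1.fderiv_eq, fderiv_fun_mul (hd.mul hd).differentiableAt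
    (hG'.smooth_gramDet.comp h.smooth).differentiableAt, hc]
  simp [hy, sq]

theorem PullbackGerm.fderiv_gramDet_eq_zero_iff (h : PullbackGerm G G' ψ y)
    (hG' : LocalMetric G' (ψ y)) (hD : fderiv ℝ ψ y = D) (hy : gramDet G' (ψ y) = 0)
    (u : Coord m) :
    fderiv ℝ (gramDet G) y u = 0 ↔ fderiv ℝ (gramDet G') (ψ y) (D u) = 0 := by
  rw [h.fderiv_gramDet hG' hy, hD]
  simp [det_equiv_ne_zero D]

theorem PullbackGerm.apply_eq_zero_iff (h : PullbackGerm G G' ψ y) (hD : fderiv ℝ ψ y = D)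
    (r : Coord m) : G y r = 0 ↔ G' (ψ y) (D r) = 0 := by
  constructor
  · intro h0
    ext v
    have := h.apply r (D.symm v)
    rw [h0, hD] at this
    simpa using this.symm
  · intro h0
    ext v
    rw [h.apply, hD]
    simp [h0]

/-- The second fundamental form in radical directions is a tensor. -/
theorem PullbackGerm.christoffelFirst_radical (h : PullbackGerm G G' ψ y) (hG : LocalMetric G y)
    (hG' : LocalMetric G' (ψ y)) (hD : fderiv ℝ ψ y = D) {r : Coord m} (hr : G y r = 0)
    (u v : Coord m) :
    christoffelFirst G y u v r = christoffelFirst G' (ψ y) (D u) (D v) (D r) := by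
  rw [h.christoffelFirst_eq hG hG', hD, hG'.symm_self, ContinuousLinearEquiv.coe_coe,
    (h.apply_eq_zero_iff hD r).1 hr]
  simp

/-- The dual connection of vector fields `X, Y` does not depend on coordinates. -/
theorem PullbackGerm.coordDualConn_eq (h : PullbackGerm G G' ψ y) (hG : LocalMetric G y)
    (hG' : LocalMetric G' (ψ y)) {X Y X' Y' : Coord m → Coord m} (hY : DifferentiableAt ℝ Y y)
    (hY' : DifferentiableAt ℝ Y' (ψ y)) (hX : X' (ψ y) = fderiv ℝ ψ y (X y))
    (hYY : ∀ᶠ z in 𝓝 y, Y' (ψ z) = fderiv ℝ ψ z (Y z)) (w : Coord m) :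
    coordDualConn G X Y y w = coordDualConn G' X' Y' (ψ y) (fderiv ℝ ψ y w) := by
  have h1 : fderiv ℝ Y' (ψ y) (fderiv ℝ ψ y (X y)) =
      fderiv ℝ ψ y (fderiv ℝ Y y (X y)) + fderiv ℝ (fderiv ℝ ψ) y (X y) (Y y) := by
    have e1 : fderiv ℝ (fun z => Y' (ψ z)) y = (fderiv ℝ Y' (ψ y)).comp (fderiv ℝ ψ y) :=
      fderiv_comp y hY' h.smooth.differentiableAt
    have e2 : (fun z => Y' (ψ z)) =ᶠ[𝓝 y] fun z => fderiv ℝ ψ z (Y z) := hYY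
    rw [← ContinuousLinearMap.comp_apply, ← e1, e2.fderiv_eq,
      fderiv_clm_apply h.smooth.fderiv_right.differentiableAt hY]
    simp
  rw [coordDualConn, coordDualConn, hX, hYY.self_of_nhds, h1]
  simp only [add_apply, map_add, h.christoffelFirst_eq hG hG', h.apply]
  ring

theorem PullbackGerm.inverse_eq (h : PullbackGerm G G' ψ y) (hD : fderiv ℝ ψ y = D)
    (hy : gramDet G y ≠ 0) (α : Coord m →L[ℝ] ℝ) :
    (G' (ψ y)).inverse α = D ((G y).inverse (α.comp (D : Coord m →L[ℝ] Coord m))) := by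
  have hy' : gramDet G' (ψ y) ≠ 0 := fun h0 => hy ((h.gramDet_eq_zero_iff hD).2 h0)
  set z := (G y).inverse (α.comp (D : Coord m →L[ℝ] Coord m)) with hz
  have h1 : G' (ψ y) (D z) = α := by
    ext w
    have := h.apply z (D.symm w)
    rw [hD, ContinuousLinearEquiv.coe_coe, ContinuousLinearEquiv.apply_symm_apply] at this
    rw [← this, hz, inverse_apply hy]
    simp
  rw [← h1, inverse_apply_self hy']

/-- The covariant curvature does not depend on coordinates. -/
theorem PullbackGerm.coordCurv_eq (h : PullbackGerm G G' ψ y) (hG : LocalMetric G y)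
    (hG' : LocalMetric G' (ψ y)) (hD : fderiv ℝ ψ y = D) (hy : gramDet G y ≠ 0)
    (u v w t : Coord m) :
    coordCurv G y u v w t = coordCurv G' (ψ y) (D u) (D v) (D w) (D t) := by
  have hy' : gramDet G' (ψ y) ≠ 0 := fun h0 => hy ((h.gramDet_eq_zero_iff hD).2 h0)
  have hDa : ∀ a, fderiv ℝ ψ y a = D a := fun a => by rw [hD]; rfl
  have hΓ : ∀ a b, D ((G y).inverse (christoffelFirst G y a b)) =
      fderiv ℝ (fderiv ℝ ψ) y a b +
        (G' (ψ y)).inverse (christoffelFirst G' (ψ y) (D a) (D b)) := by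
    intro a b
    have h1 : christoffelFirst G y a b = (G' (ψ y) (fderiv ℝ (fderiv ℝ ψ) y a b) +
        christoffelFirst G' (ψ y) (D a) (D b)).comp (D : Coord m →L[ℝ] Coord m) := by
      ext w
      rw [h.christoffelFirst_eq hG hG']
      simp [hDa]
    rw [h1, ← h.inverse_eq hD hy, map_add, inverse_apply_self hy']
  have hJ : ∀ a, G' (ψ y) a ((G' (ψ y)).inverse (christoffelFirst G' (ψ y) (D v) (D t))) =
      christoffelFirst G' (ψ y) (D v) (D t) a := fun a => by
    rw [hG'.symm_self, inverse_apply hy']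
  have hJ' : ∀ a, G' (ψ y) a ((G' (ψ y)).inverse (christoffelFirst G' (ψ y) (D u) (D t))) =
      christoffelFirst G' (ψ y) (D u) (D t) a := fun a => by
    rw [hG'.symm_self, inverse_apply hy']
  have hT : fderiv ℝ (fderiv ℝ (fderiv ℝ ψ)) y u v t =
      fderiv ℝ (fderiv ℝ (fderiv ℝ ψ)) y v u t := by
    have := h.smooth.fderiv_right.contDiffAt.isSymmSndFDerivAt (by
      rw [minSmoothness_of_isRCLikeNormedField]
      exact WithTop.coe_le_coe.2 (le_top : (2 : ℕ∞) ≤ ⊤))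
    rw [this.eq u v]
  rw [hG.coordCurv_eq_christoffel hy, hG'.coordCurv_eq_christoffel hy',
    h.fderiv_christoffelMap hG hG', h.fderiv_christoffelMap hG hG']
  rw [h.christoffelFirst_eq hG hG' u w, h.christoffelFirst_eq hG hG' v w]
  simp only [hDa, hΓ, map_add, hJ, hJ', hG'.fderiv_eq_christoffelFirst]
  rw [hT, symm_fderiv_fderiv h.smooth v u,
    hG'.symm_self (fderiv ℝ (fderiv ℝ ψ) y v t) (fderiv ℝ (fderiv ℝ ψ) y u w),
    hG'.symm_self (fderiv ℝ (fderiv ℝ ψ) y u t) (fderiv ℝ (fderiv ℝ ψ) y v w)]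
  ring

/-- Traces with respect to the metric do not depend on coordinates. -/
theorem metricTrace_bilinearComp (D : Coord m ≃L[ℝ] Coord m) (B : Bilin m)
    {J J' : (Coord m →L[ℝ] ℝ) →L[ℝ] Coord m}
    (hJ : ∀ α : Coord m →L[ℝ] ℝ, J' α = D (J (α.comp (D : Coord m →L[ℝ] Coord m)))) :
    metricTrace (B.bilinearComp (D : Coord m →L[ℝ] Coord m) (D : Coord m →L[ℝ] Coord m)) J =
      metricTrace B J' := by
  have h1 : ∀ a, D (basisVec a) = ∑ c, D (basisVec a) c • basisVec c := fun a =>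
    (sum_smul_basisVec _).symm
  have h2 : ∀ c, (EuclideanSpace.proj c : Coord m →L[ℝ] ℝ).comp (D : Coord m →L[ℝ] Coord m) =
      ∑ a, D (basisVec a) c • (EuclideanSpace.proj a : Coord m →L[ℝ] ℝ) := fun c =>
    covector_eq_sum _
  simp only [metricTrace, ContinuousLinearMap.bilinearComp_apply, ContinuousLinearEquiv.coe_coe, hJ,
    h2, map_sum, map_smul]
  rw [Finset.sum_comm]
  refine Finset.sum_congr rfl fun a _ => ?_
  conv_lhs => rw [h1 a]
  simp [map_sum, sum_apply]

theorem ricciTrace_comp (D : Coord m ≃L[ℝ] Coord m) {Q Q' : Quad m}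
    (hQ : ∀ u v w t, Q u v w t = Q' (D u) (D v) (D w) (D t))
    {J J' : (Coord m →L[ℝ] ℝ) →L[ℝ] Coord m}
    (hJ : ∀ α : Coord m →L[ℝ] ℝ, J' α = D (J (α.comp (D : Coord m →L[ℝ] Coord m)))) 
    (v t : Coord m) : ricciTrace Q J v t = ricciTrace Q' J' (D v) (D t) := by
  have h1 : ∀ (Q : Quad m) (J : (Coord m →L[ℝ] ℝ) →L[ℝ] Coord m) (v t : Coord m),
      ricciTrace Q J v t = metricTrace
        ((ContinuousLinearMap.compL ℝ (Coord m) (Coord m →L[ℝ] ℝ) ℝ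
          (ContinuousLinearMap.apply ℝ ℝ t)).comp (Q.flip v)) J := by
    intro Q J v t
    simp [ricciTrace_apply, metricTrace]
  rw [h1, h1, ← metricTrace_bilinearComp D _ hJ]
  congr 1
  ext a b
  simp [hQ]

/-- The Weyl tensor does not depend on coordinates. -/
theorem PullbackGerm.coordWeyl_eq (h : PullbackGerm G G' ψ y) (hG : LocalMetric G y)
    (hG' : LocalMetric G' (ψ y)) (hD : fderiv ℝ ψ y = D) (hy : gramDet G y ≠ 0)
    (u v w t : Coord m) :
    coordWeyl G y u v w t = coordWeyl G' (ψ y) (D u) (D v) (D w) (D t) := by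
  have hy' : gramDet G' (ψ y) ≠ 0 := fun h0 => hy ((h.gramDet_eq_zero_iff hD).2 h0)
  obtain ⟨K, hK⟩ : ∃ K : Quad m, ∀ u v w t, coordCurv G y u v w t = K u v w t :=
    ⟨_, hG.coordCurv_eq hy⟩
  obtain ⟨K', hK'⟩ : ∃ K : Quad m, ∀ u v w t, coordCurv G' (ψ y) u v w t = K u v w t :=
    ⟨_, hG'.coordCurv_eq hy'⟩
  have hKK : ∀ u v w t, K u v w t = K' (D u) (D v) (D w) (D t) := fun u v w t => by
    rw [← hK, ← hK', h.coordCurv_eq hG hG' hD hy]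
  have hJ := h.inverse_eq hD hy
  have hric := ricciTrace_comp D hKK hJ
  have htr : metricTrace (ricciTrace K (G y).inverse) (G y).inverse =
      metricTrace (ricciTrace K' (G' (ψ y)).inverse) (G' (ψ y)).inverse := by
    rw [← metricTrace_bilinearComp D _ hJ]
    congr 1
    ext a b
    simp [hric]
  have hGy : ∀ a b, G y a b = G' (ψ y) (D a) (D b) := fun a b => by rw [h.apply, hD]; rfl
  rw [hG.coordWeyl_eq hy hK, hG'.coordWeyl_eq hy' hK', htr, hKK]
  simp only [kulkarniNomizu, schoutenForm, hric, hGy, smul_apply, sub_apply, smul_eq_mul]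

end Invertible

end Pullback

/-! ### Reading tensors and fields in charts -/

section Charts

variable {m : ℕ} {M : Type*} [TopologicalSpace M] {φ φ' : OpenPartialHomeomorph M (Coord m)}

/-- The coordinate change from `φ` to `φ'`. -/
def transition (φ φ' : OpenPartialHomeomorph M (Coord m)) (z : Coord m) : Coord m := φ' (φ.symm z)

theorem transition_apply {x : M} (hx : x ∈ φ.source) : transition φ φ' (φ x) = φ' x := by
  rw [transition, φ.left_inv hx]

theorem eventually_mem_source {z : Coord m} (hz : z ∈ φ.target) {U : Set M} (hU : IsOpen U)
    (hzU : φ.symm z ∈ U) : ∀ᶠ y in 𝓝 z, y ∈ φ.target ∧ φ.symm y ∈ U :=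
  (φ.open_target.eventually_mem hz).and
    ((φ.continuousAt_symm hz).eventually (hU.eventually_mem hzU))

variable [ChartedSpace (Coord m) M]

theorem chart_mdifferentiable (hφ : φ ∈ IsManifold.maximalAtlas (𝓡 m) ∞ M) :
    φ.MDifferentiable (𝓡 m) (𝓡 m) :=
  ⟨(contMDiffOn_of_mem_maximalAtlas hφ).mdifferentiableOn (by simp),
    (contMDiffOn_symm_of_mem_maximalAtlas hφ).mdifferentiableOn (by simp)⟩

theorem chartDiff_chartSymmDiff (hφ : φ ∈ IsManifold.maximalAtlas (𝓡 m) ∞ M) {z : Coord m}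
    (hz : z ∈ φ.target) (v : Coord m) :
    chartDiff φ (φ.symm z) (chartSymmDiff φ z v) = v :=
  DFunLike.congr_fun ((chart_mdifferentiable hφ).comp_symm_deriv hz) v

theorem chartSymmDiff_chartDiff (hφ : φ ∈ IsManifold.maximalAtlas (𝓡 m) ∞ M) {z : Coord m}
    (hz : z ∈ φ.target) (ξ : TangentSpace (𝓡 m) (φ.symm z)) :
    chartSymmDiff φ z (chartDiff φ (φ.symm z) ξ) = ξ := by
  have := DFunLike.congr_fun ((chart_mdifferentiable hφ).symm_comp_deriv (φ.map_target hz)) ξ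
  rw [φ.right_inv hz] at this
  exact this

/-- The differential of a chart of the maximal atlas, as an isomorphism. -/
noncomputable def chartEquiv (hφ : φ ∈ IsManifold.maximalAtlas (𝓡 m) ∞ M) {x : M}
    (hx : x ∈ φ.source) : TangentSpace (𝓡 m) x ≃L[ℝ] Coord m :=
  (chart_mdifferentiable hφ).mfderiv hx

theorem chartEquiv_apply (hφ : φ ∈ IsManifold.maximalAtlas (𝓡 m) ∞ M) {x : M}
    (hx : x ∈ φ.source) (ξ : TangentSpace (𝓡 m) x) : chartEquiv hφ hx ξ = chartDiff φ x ξ := rfl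

theorem chartDiff_injective (hφ : φ ∈ IsManifold.maximalAtlas (𝓡 m) ∞ M) {x : M}
    (hx : x ∈ φ.source) : Function.Injective (chartDiff φ x) := (chartEquiv hφ hx).injective

theorem chartDiff_surjective (hφ : φ ∈ IsManifold.maximalAtlas (𝓡 m) ∞ M) {x : M}
    (hx : x ∈ φ.source) : Function.Surjective (chartDiff φ x) := (chartEquiv hφ hx).surjective

theorem chartDiff_eq_zero_iff (hφ : φ ∈ IsManifold.maximalAtlas (𝓡 m) ∞ M) {x : M}
    (hx : x ∈ φ.source) (ξ : TangentSpace (𝓡 m) x) : chartDiff φ x ξ = 0 ↔ ξ = 0 :=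
  (chartEquiv hφ hx).map_eq_zero_iff

theorem smoothNear_comp_symm {F : Type*} [NormedAddCommGroup F] [NormedSpace ℝ F]
    (hφ : φ ∈ IsManifold.maximalAtlas (𝓡 m) ∞ M) {z : Coord m} (hz : z ∈ φ.target) {f : M → F}
    {U : Set M} (hU : IsOpen U) (hzU : φ.symm z ∈ U) (hf : ContMDiffOn (𝓡 m) 𝓘(ℝ, F) ∞ f U) :
    SmoothNear (fun y => f (φ.symm y)) z := by
  filter_upwards [eventually_mem_source hz hU hzU] with y hy
  exact (ContMDiffAt.comp y (hf.contMDiffAt (hU.mem_nhds hy.2))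
    (contMDiffAt_symm_of_mem_maximalAtlas hφ hy.1)).contDiffAt

theorem contMDiffAt_comp_chart {F : Type*} [NormedAddCommGroup F] [NormedSpace ℝ F]
    (hφ : φ ∈ IsManifold.maximalAtlas (𝓡 m) ∞ M) {x : M} (hx : x ∈ φ.source) {f : Coord m → F}
    (hf : ContDiffAt ℝ ∞ f (φ x)) : ContMDiffAt (𝓡 m) 𝓘(ℝ, F) ∞ (fun x => f (φ x)) x :=
  ContMDiffAt.comp x hf.contMDiffAt (contMDiffAt_of_mem_maximalAtlas hφ hx)

theorem smoothNear_transition (hφ : φ ∈ IsManifold.maximalAtlas (𝓡 m) ∞ M)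
    (hφ' : φ' ∈ IsManifold.maximalAtlas (𝓡 m) ∞ M) {z : Coord m} (hz : z ∈ φ.target)
    (hz' : φ.symm z ∈ φ'.source) : SmoothNear (transition φ φ') z :=
  smoothNear_comp_symm hφ hz φ'.open_source hz' (contMDiffOn_of_mem_maximalAtlas hφ')

theorem fderiv_transition (hφ : φ ∈ IsManifold.maximalAtlas (𝓡 m) ∞ M)
    (hφ' : φ' ∈ IsManifold.maximalAtlas (𝓡 m) ∞ M) {z : Coord m} (hz : z ∈ φ.target)
    (hz' : φ.symm z ∈ φ'.source) (v : Coord m) : fderiv ℝ (transition φ φ') z v =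
      chartDiff φ' (φ.symm z) (chartSymmDiff φ z v) := by
  have h := mfderiv_comp z ((chart_mdifferentiable hφ').mdifferentiableAt hz')
    ((chart_mdifferentiable hφ).mdifferentiableAt_symm hz)
  have h2 : fderiv ℝ (transition φ φ') z = mfderiv (𝓡 m) (𝓡 m) (φ' ∘ φ.symm) z :=
    mfderiv_eq_fderiv.symm
  rw [h2, h]
  rfl

/-- The differential of a coordinate change, as an isomorphism. -/
noncomputable def transitionEquiv (hφ : φ ∈ IsManifold.maximalAtlas (𝓡 m) ∞ M)
    (hφ' : φ' ∈ IsManifold.maximalAtlas (𝓡 m) ∞ M) {x : M} (hx : x ∈ φ.source)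
    (hx' : x ∈ φ'.source) : Coord m ≃L[ℝ] Coord m :=
  (chartEquiv hφ hx).symm.trans (chartEquiv hφ' hx')

theorem transitionEquiv_chartDiff (hφ : φ ∈ IsManifold.maximalAtlas (𝓡 m) ∞ M)
    (hφ' : φ' ∈ IsManifold.maximalAtlas (𝓡 m) ∞ M) {x : M} (hx : x ∈ φ.source)
    (hx' : x ∈ φ'.source) (ξ : TangentSpace (𝓡 m) x) :
    transitionEquiv hφ hφ' hx hx' (chartDiff φ x ξ) = chartDiff φ' x ξ := by
  rw [transitionEquiv, ← chartEquiv_apply hφ hx, ContinuousLinearEquiv.trans_apply,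
    ContinuousLinearEquiv.symm_apply_apply, chartEquiv_apply]

theorem fderiv_transition_eq (hφ : φ ∈ IsManifold.maximalAtlas (𝓡 m) ∞ M)
    (hφ' : φ' ∈ IsManifold.maximalAtlas (𝓡 m) ∞ M) {x : M} (hx : x ∈ φ.source)
    (hx' : x ∈ φ'.source) :
    fderiv ℝ (transition φ φ') (φ x) = transitionEquiv hφ hφ' hx hx' := by
  obtain ⟨z, hz, rfl⟩ : ∃ z ∈ φ.target, φ.symm z = x := ⟨φ x, φ.map_source hx, φ.left_inv hx⟩
  ext1 v
  rw [φ.right_inv hz, fderiv_transition hφ hφ' hz hx']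
  have := transitionEquiv_chartDiff hφ hφ' hx hx' (chartSymmDiff φ z v)
  rw [chartDiff_chartSymmDiff hφ hz] at this
  exact this.symm

/-- The vector field with the coordinate expression `V` in the chart `φ`. -/
noncomputable def liftField (φ : OpenPartialHomeomorph M (Coord m)) (V : Coord m → Coord m)
    (x : M) : TangentSpace (𝓡 m) x :=
  (chartDiff φ x).inverse (V (φ x))

theorem chartDiff_liftField (hφ : φ ∈ IsManifold.maximalAtlas (𝓡 m) ∞ M) {x : M}
    (hx : x ∈ φ.source) (V : Coord m → Coord m) : chartDiff φ x (liftField φ V x) = V (φ x) := by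
  have h : chartDiff φ x = (chartEquiv hφ hx : TangentSpace (𝓡 m) x →L[ℝ] Coord m) := rfl
  rw [liftField, h, ContinuousLinearMap.inverse_equiv]
  exact (chartEquiv hφ hx).apply_symm_apply _

theorem coordField_liftField (hφ : φ ∈ IsManifold.maximalAtlas (𝓡 m) ∞ M) {z : Coord m}
    (hz : z ∈ φ.target) (V : Coord m → Coord m) : coordField φ (liftField φ V) z = V z := by
  rw [coordField, chartDiff_liftField hφ (φ.map_target hz), φ.right_inv hz]

variable [IsManifold (𝓡 m) ∞ M]

theorem contMDiffAt_field_iff_chartAt (X : ∀ x : M, TangentSpace (𝓡 m) x) {x₀ x : M}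
    (hx : x ∈ (chartAt (Coord m) x₀).source) :
    ContMDiffAt (𝓡 m) (𝓡 m).tangent ∞ (fun x => (⟨x, X x⟩ : TangentBundle (𝓡 m) M)) x ↔
      ContMDiffAt (𝓡 m) 𝓘(ℝ, Coord m) ∞
        (fun x => chartDiff (chartAt (Coord m) x₀) x (X x)) x := by
  refine (Trivialization.contMDiffAt_section_iff (IB := 𝓡 m)
    (trivializationAt (Coord m) (TangentSpace (𝓡 m)) x₀) hx).trans ?_
  refine Filter.EventuallyEq.contMDiffAt_iff ?_
  filter_upwards [(chartAt (Coord m) x₀).open_source.mem_nhds hx] with y hy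
  refine (congrFun (Trivialization.coe_linearMapAt_of_mem (R := ℝ)
    (trivializationAt (Coord m) (TangentSpace (𝓡 m)) x₀) hy) (X y)).symm.trans ?_
  exact DFunLike.congr_fun (TangentBundle.continuousLinearMapAt_trivializationAt (I := 𝓡 m) hy)
    (X y)

omit [IsManifold (𝓡 m) ∞ M] in
theorem contMDiffAt_iff_comp_symm {F : Type*} [NormedAddCommGroup F] [NormedSpace ℝ F]
    (hφ : φ ∈ IsManifold.maximalAtlas (𝓡 m) ∞ M) {x : M} (hx : x ∈ φ.source) {f : M → F} :
    ContMDiffAt (𝓡 m) 𝓘(ℝ, F) ∞ f x ↔ ContDiffAt ℝ ∞ (fun y => f (φ.symm y)) (φ x) := by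
  constructor
  · intro h
    rw [← φ.left_inv hx] at h
    exact (ContMDiffAt.comp (φ x) h
      (contMDiffAt_symm_of_mem_maximalAtlas hφ (φ.map_source hx))).contDiffAt
  · intro h
    refine (contMDiffAt_comp_chart hφ hx h).congr_of_eventuallyEq ?_
    filter_upwards [φ.open_source.mem_nhds hx] with y hy
    rw [φ.left_inv hy]

omit [IsManifold (𝓡 m) ∞ M] in
theorem coordField_transition (hφ : φ ∈ IsManifold.maximalAtlas (𝓡 m) ∞ M)
    (hφ' : φ' ∈ IsManifold.maximalAtlas (𝓡 m) ∞ M) (X : ∀ x : M, TangentSpace (𝓡 m) x)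
    {z : Coord m} (hz : z ∈ φ.target) (hz' : φ.symm z ∈ φ'.source) :
    coordField φ' X (transition φ φ' z) = fderiv ℝ (transition φ φ') z (coordField φ X z) := by
  rw [fderiv_transition hφ hφ' hz hz', coordField, coordField, chartSymmDiff_chartDiff hφ hz,
    transition, φ'.left_inv hz']

omit [IsManifold (𝓡 m) ∞ M] in
theorem contDiffAt_coordField (hφ : φ ∈ IsManifold.maximalAtlas (𝓡 m) ∞ M)
    (hφ' : φ' ∈ IsManifold.maximalAtlas (𝓡 m) ∞ M) {X : ∀ x : M, TangentSpace (𝓡 m) x} {x : M}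
    (hx : x ∈ φ.source) (hx' : x ∈ φ'.source) (h : ContDiffAt ℝ ∞ (coordField φ X) (φ x)) :
    ContDiffAt ℝ ∞ (coordField φ' X) (φ' x) := by
  have h1 : (φ' x) ∈ φ'.target := φ'.map_source hx'
  have h2 : φ'.symm (φ' x) ∈ φ.source := by rwa [φ'.left_inv hx']
  have hψ := (smoothNear_transition hφ' hφ h1 h2).contDiffAt
  have hψ' := (smoothNear_transition hφ hφ' (φ.map_source hx)
    (by rwa [φ.left_inv hx])).fderiv_right.contDiffAt
  have h3 : ContDiffAt ℝ ∞ (fun z' => fderiv ℝ (transition φ φ') (transition φ' φ z')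
      (coordField φ X (transition φ' φ z'))) (φ' x) := by
    rw [← transition_apply (φ' := φ) hx'] at h hψ'
    exact (hψ'.comp (φ' x) hψ).clm_apply (h.comp (φ' x) hψ)
  refine h3.congr_of_eventuallyEq ?_
  filter_upwards [eventually_mem_source h1 φ.open_source h2] with z' hz'
  have h4 : φ.symm (transition φ' φ z') = φ'.symm z' := φ.left_inv hz'.2
  have h5 : transition φ φ' (transition φ' φ z') = z' := by
    rw [transition, h4, φ'.right_inv hz'.1]
  have h6 := coordField_transition hφ hφ' X (z := transition φ' φ z') (φ.map_source hz'.2)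
    (by rw [h4]; exact φ'.map_target hz'.1)
  rwa [h5] at h6

/-- Smoothness of a vector field can be read in any chart of the maximal atlas. -/
theorem contMDiffAt_field_iff (hφ : φ ∈ IsManifold.maximalAtlas (𝓡 m) ∞ M)
    (X : ∀ x : M, TangentSpace (𝓡 m) x) {x : M} (hx : x ∈ φ.source) :
    ContMDiffAt (𝓡 m) (𝓡 m).tangent ∞ (fun x => (⟨x, X x⟩ : TangentBundle (𝓡 m) M)) x ↔
      ContDiffAt ℝ ∞ (coordField φ X) (φ x) := by
  have hc := IsManifold.chart_mem_maximalAtlas (I := 𝓡 m) (n := ∞) x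
  have hxc := mem_chart_source (Coord m) x
  rw [contMDiffAt_field_iff_chartAt X hxc, contMDiffAt_iff_comp_symm hc hxc]
  exact ⟨contDiffAt_coordField hc hφ hxc hx, contDiffAt_coordField hφ hc hx hxc⟩

theorem SmoothFieldOn.smoothNear {X : ∀ x : M, TangentSpace (𝓡 m) x} {U : Set M}
    (hX : SmoothFieldOn X U) (hU : IsOpen U) (hφ : φ ∈ IsManifold.maximalAtlas (𝓡 m) ∞ M)
    {x : M} (hx : x ∈ φ.source) (hxU : x ∈ U) : SmoothNear (coordField φ X) (φ x) := by
  filter_upwards [eventually_mem_source (φ.map_source hx) hU (by rwa [φ.left_inv hx])] with z hz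
  have := (contMDiffAt_field_iff hφ X (φ.map_target hz.1)).1
    (ContMDiffOn.contMDiffAt hX (hU.mem_nhds hz.2))
  rwa [φ.right_inv hz.1] at this

theorem smoothFieldOn_of_coordField {X : ∀ x : M, TangentSpace (𝓡 m) x} {U : Set M}
    (h : ∀ x ∈ U, ∃ φ ∈ IsManifold.maximalAtlas (𝓡 m) ∞ M, x ∈ φ.source ∧
      ContDiffAt ℝ ∞ (coordField φ X) (φ x)) : SmoothFieldOn X U := by
  intro x hx
  obtain ⟨φ, hφ, hxφ, hX⟩ := h x hx
  exact ((contMDiffAt_field_iff hφ X hxφ).2 hX).contMDiffWithinAt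

theorem smoothFieldOn_liftField (hφ : φ ∈ IsManifold.maximalAtlas (𝓡 m) ∞ M) {V : Coord m → Coord m}
    {U : Set M} (hU : U ⊆ φ.source) (hV : ∀ x ∈ U, ContDiffAt ℝ ∞ V (φ x)) :
    SmoothFieldOn (liftField φ V) U := by
  refine smoothFieldOn_of_coordField fun x hx => ⟨φ, hφ, hU hx, ?_⟩
  refine (hV x hx).congr_of_eventuallyEq ?_
  filter_upwards [φ.open_target.mem_nhds (φ.map_source (hU hx))] with z hz
    using coordField_liftField hφ hz V

end Charts

section CoordMetric

variable {m : ℕ} {M : Type*} [TopologicalSpace M] [ChartedSpace (Coord m) M]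
  [IsManifold (𝓡 m) ∞ M] {φ φ' : OpenPartialHomeomorph M (Coord m)} (g : SymTensorField m M)

theorem coordMetric_symm_apply (hφ : φ ∈ IsManifold.maximalAtlas (𝓡 m) ∞ M) {z : Coord m}
    (hz : z ∈ φ.target) (u v : TangentSpace (𝓡 m) (φ.symm z)) :
    coordMetric g φ z (chartDiff φ (φ.symm z) u) (chartDiff φ (φ.symm z) v) =
      g.form (φ.symm z) u v := by
  have h1 : coordMetric g φ z (chartDiff φ (φ.symm z) u) (chartDiff φ (φ.symm z) v) =
    g.form (φ.symm z) (chartSymmDiff φ z (chartDiff φ (φ.symm z) u))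
      (chartSymmDiff φ z (chartDiff φ (φ.symm z) v)) := rfl
  rw [h1, chartSymmDiff_chartDiff hφ hz, chartSymmDiff_chartDiff hφ hz]

theorem coordMetric_chartDiff (hφ : φ ∈ IsManifold.maximalAtlas (𝓡 m) ∞ M) {x : M}
    (hx : x ∈ φ.source) (u v : TangentSpace (𝓡 m) x) :
    coordMetric g φ (φ x) (chartDiff φ x u) (chartDiff φ x v) = g.form x u v := by
  obtain ⟨z, hz, rfl⟩ : ∃ z ∈ φ.target, φ.symm z = x := ⟨φ x, φ.map_source hx, φ.left_inv hx⟩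
  rw [φ.right_inv hz]
  exact coordMetric_symm_apply g hφ hz u v

theorem contMDiffAt_form_apply {X Y : ∀ x : M, TangentSpace (𝓡 m) x} {x : M}
    (hX : ContMDiffAt (𝓡 m) (𝓡 m).tangent ∞ (fun x => (⟨x, X x⟩ : TangentBundle (𝓡 m) M)) x)
    (hY : ContMDiffAt (𝓡 m) (𝓡 m).tangent ∞ (fun x => (⟨x, Y x⟩ : TangentBundle (𝓡 m) M)) x) :
    ContMDiffAt (𝓡 m) 𝓘(ℝ, ℝ) ∞ (fun x => g.form x (X x) (Y x)) x := by
  have : ContMDiffAt (𝓡 m) ((𝓡 m).prod 𝓘(ℝ, ℝ)) ∞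
      (fun x ↦ TotalSpace.mk' ℝ (E := Bundle.Trivial M ℝ) x (g.form x (X x) (Y x))) x := by
    apply ContMDiffAt.clm_bundle_apply₂ (F₁ := Coord m) (F₂ := Coord m)
    · exact g.contMDiff.contMDiffAt
    · exact hX
    · exact hY
  exact (contMDiffAt_totalSpace.1 this).2

/-- A tensor field of order two is smooth in every chart of the maximal atlas. -/
theorem smoothNear_coordMetric (hφ : φ ∈ IsManifold.maximalAtlas (𝓡 m) ∞ M) {z : Coord m}
    (hz : z ∈ φ.target) : SmoothNear (coordMetric g φ) z := by
  have h1 : ∀ a b : Fin m, SmoothNear (fun z => coordMetric g φ z (basisVec a) (basisVec b)) z := by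
    intro a b
    filter_upwards [φ.open_target.mem_nhds hz] with y hy
    have hE : ∀ a : Fin m, ContMDiffAt (𝓡 m) (𝓡 m).tangent ∞
        (fun x => (⟨x, liftField φ (fun _ => basisVec a) x⟩ : TangentBundle (𝓡 m) M))
        (φ.symm y) := fun a =>
      (smoothFieldOn_liftField hφ subset_rfl fun _ _ => contDiffAt_const).contMDiffAt
        (φ.open_source.mem_nhds (φ.map_target hy))
    have h2 := (contMDiffAt_iff_comp_symm hφ (φ.map_target hy)).1
      (contMDiffAt_form_apply g (hE a) (hE b))
    rw [φ.right_inv hy] at h2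
    refine h2.congr_of_eventuallyEq ?_
    filter_upwards [φ.open_target.mem_nhds hy] with w hw
    rw [← coordMetric_symm_apply g hφ hw, chartDiff_liftField hφ (φ.map_target hw),
      chartDiff_liftField hφ (φ.map_target hw)]
  have h2 : SmoothNear (fun z => ∑ a : Fin m, ∑ b : Fin m,
      coordMetric g φ z (basisVec a) (basisVec b) •
        ((EuclideanSpace.proj a : Coord m →L[ℝ] ℝ).smulRight
          (EuclideanSpace.proj b : Coord m →L[ℝ] ℝ) : Bilin m)) z :=
    SmoothNear.sum (s := Finset.univ) fun a _ => SmoothNear.sum (s := Finset.univ) fun b _ =>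
      (h1 a b).smul (.const _)
  refine h2.congr (.of_forall fun y => ?_)
  ext u v
  rw [covector_apply (coordMetric g φ y u) v]
  have h3 : ∀ b, coordMetric g φ y u (basisVec b) =
      ∑ a, u a * coordMetric g φ y (basisVec a) (basisVec b) := fun b =>
    covector_apply ((coordMetric g φ y).flip (basisVec b)) u
  simp only [sum_apply, smul_apply, ContinuousLinearMap.smulRight_apply, smul_eq_mul, proj_apply,
    h3, Finset.mul_sum]
  rw [Finset.sum_comm]
  exact Finset.sum_congr rfl fun a _ => Finset.sum_congr rfl fun b _ => by ring

theorem localMetric_coordMetric (hφ : φ ∈ IsManifold.maximalAtlas (𝓡 m) ∞ M) {z : Coord m}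
    (hz : z ∈ φ.target) : LocalMetric (coordMetric g φ) z :=
  ⟨smoothNear_coordMetric g hφ hz, .of_forall fun _ _ _ => g.symm _ _ _⟩

theorem pullbackGerm_transition (hφ : φ ∈ IsManifold.maximalAtlas (𝓡 m) ∞ M)
    (hφ' : φ' ∈ IsManifold.maximalAtlas (𝓡 m) ∞ M) {x : M} (hx : x ∈ φ.source)
    (hx' : x ∈ φ'.source) :
    PullbackGerm (coordMetric g φ) (coordMetric g φ') (transition φ φ') (φ x) := by
  have hz' : φ.symm (φ x) ∈ φ'.source := by rwa [φ.left_inv hx]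
  refine ⟨smoothNear_transition hφ hφ' (φ.map_source hx) hz', ?_⟩
  filter_upwards [eventually_mem_source (φ.map_source hx) φ'.open_source hz'] with z hz
  ext u v
  rw [ContinuousLinearMap.bilinearComp_apply, fderiv_transition hφ hφ' hz.1 hz.2,
    fderiv_transition hφ hφ' hz.1 hz.2, transition, coordMetric_chartDiff g hφ' hz.2]
  rfl

end CoordMetric

/-! ### The geometric notions in an arbitrary chart -/

section Transfer

variable {m : ℕ} {M : Type*} [TopologicalSpace M] [ChartedSpace (Coord m) M]
  [IsManifold (𝓡 m) ∞ M] {φ : OpenPartialHomeomorph M (Coord m)} {g g' : SymTensorField m M}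
  {x : M} {R X Y N : ∀ x : M, TangentSpace (𝓡 m) x} {U : Set M}

theorem mem_radical_iff (hφ : φ ∈ IsManifold.maximalAtlas (𝓡 m) ∞ M) (hx : x ∈ φ.source)
    (ξ : TangentSpace (𝓡 m) x) :
    ξ ∈ radical g x ↔ coordMetric g φ (φ x) (chartDiff φ x ξ) = 0 := by
  constructor
  · intro h
    ext v
    obtain ⟨w, rfl⟩ := chartDiff_surjective hφ hx v
    rw [coordMetric_chartDiff g hφ hx, h w]
    rfl
  · intro h w
    rw [← coordMetric_chartDiff g hφ hx, h]
    rfl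

theorem mem_singularSet_iff (hφ : φ ∈ IsManifold.maximalAtlas (𝓡 m) ∞ M) (hx : x ∈ φ.source) :
    x ∈ singularSet g ↔ gramDet (coordMetric g φ) (φ x) = 0 := by
  rw [gramDet_eq_zero_iff]
  constructor
  · rintro ⟨ξ, h1, h2⟩
    exact ⟨chartDiff φ x ξ, fun h => h2 ((chartDiff_eq_zero_iff hφ hx ξ).1 h),
      (mem_radical_iff hφ hx ξ).1 h1⟩
  · rintro ⟨v, h1, h2⟩
    obtain ⟨ξ, rfl⟩ := chartDiff_surjective hφ hx v
    exact ⟨ξ, (mem_radical_iff hφ hx ξ).2 h2, fun h => h1 (by rw [h, map_zero])⟩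

theorem symm_mem_singularSet_iff (hφ : φ ∈ IsManifold.maximalAtlas (𝓡 m) ∞ M) {z : Coord m}
    (hz : z ∈ φ.target) : φ.symm z ∈ singularSet g ↔ gramDet (coordMetric g φ) z = 0 := by
  rw [mem_singularSet_iff hφ (φ.map_target hz), φ.right_inv hz]

theorem mem_tangentSigma_iff (hφ : φ ∈ IsManifold.maximalAtlas (𝓡 m) ∞ M) (hx : x ∈ φ.source)
    (hs : x ∈ singularSet g) (v : TangentSpace (𝓡 m) x) : v ∈ tangentSigma g x ↔
      fderiv ℝ (gramDet (coordMetric g φ)) (φ x) (chartDiff φ x v) = 0 := by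
  have hc := IsManifold.chart_mem_maximalAtlas (I := 𝓡 m) (n := ∞) x
  have hxc := mem_chart_source (Coord m) x
  have hψ := pullbackGerm_transition g hφ hc hx hxc
  have hG' := localMetric_coordMetric g hc ((chartAt (Coord m) x).map_source hxc)
  rw [← transition_apply (φ := φ) hx] at hG'
  have hs' := (mem_singularSet_iff hc hxc).1 hs
  rw [← transition_apply (φ := φ) hx] at hs'
  rw [hψ.fderiv_gramDet_eq_zero_iff hG' (fderiv_transition_eq hφ hc hx hxc) hs',
    transitionEquiv_chartDiff, transition_apply hx]
  rfl

theorem secondForm_eq (hφ : φ ∈ IsManifold.maximalAtlas (𝓡 m) ∞ M) (hx : x ∈ φ.source)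
    {ξ : TangentSpace (𝓡 m) x} (hξ : ξ ∈ radical g x) (u v : TangentSpace (𝓡 m) x) :
    secondForm g x ξ u v = christoffelFirst (coordMetric g φ) (φ x) (chartDiff φ x u)
      (chartDiff φ x v) (chartDiff φ x ξ) := by
  have hc := IsManifold.chart_mem_maximalAtlas (I := 𝓡 m) (n := ∞) x
  have hxc := mem_chart_source (Coord m) x
  have hψ := pullbackGerm_transition g hφ hc hx hxc
  have hG := localMetric_coordMetric g hφ (φ.map_source hx)
  have hG' := localMetric_coordMetric g hc ((chartAt (Coord m) x).map_source hxc)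
  rw [← transition_apply (φ := φ) hx] at hG'
  rw [hψ.christoffelFirst_radical hG hG' (fderiv_transition_eq hφ hc hx hxc)
    ((mem_radical_iff hφ hx ξ).1 hξ), transitionEquiv_chartDiff, transitionEquiv_chartDiff,
    transitionEquiv_chartDiff, transition_apply hx, secondForm, coordDualConn]
  simp

theorem dualConn_eq (hφ : φ ∈ IsManifold.maximalAtlas (𝓡 m) ∞ M) (hx : x ∈ φ.source)
    (hY : ContDiffAt ℝ ∞ (coordField φ Y) (φ x)) (w : TangentSpace (𝓡 m) x) :
    dualConn g X Y x w = coordDualConn (coordMetric g φ) (coordField φ X) (coordField φ Y) (φ x)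
      (chartDiff φ x w) := by
  have hc := IsManifold.chart_mem_maximalAtlas (I := 𝓡 m) (n := ∞) x
  have hxc := mem_chart_source (Coord m) x
  have hψ := pullbackGerm_transition g hφ hc hx hxc
  have hG := localMetric_coordMetric g hφ (φ.map_source hx)
  have hG' := localMetric_coordMetric g hc ((chartAt (Coord m) x).map_source hxc)
  have hY' := contDiffAt_coordField hφ hc hx hxc hY
  rw [← transition_apply (φ := φ) hx] at hG' hY'
  have hz' : φ.symm (φ x) ∈ (chartAt (Coord m) x).source := by rwa [φ.left_inv hx]
  rw [hψ.coordDualConn_eq hG hG' (hY.differentiableAt (by simp)) (hY'.differentiableAt (by simp))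
    (coordField_transition hφ hc X (φ.map_source hx) hz')
    ((eventually_mem_source (φ.map_source hx) (chartAt (Coord m) x).open_source hz').mono
      fun z hz => coordField_transition hφ hc Y hz.1 hz.2),
    fderiv_transition_eq hφ hc hx hxc, ContinuousLinearEquiv.coe_coe, transitionEquiv_chartDiff,
    transition_apply hx]
  rfl

theorem coordWeyl_transition {φ' : OpenPartialHomeomorph M (Coord m)}
    (hφ : φ ∈ IsManifold.maximalAtlas (𝓡 m) ∞ M) (hφ' : φ' ∈ IsManifold.maximalAtlas (𝓡 m) ∞ M)
    (hx : x ∈ φ.source) (hx' : x ∈ φ'.source)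
    (hs : x ∉ singularSet g) (u v w t : TangentSpace (𝓡 m) x) :
    coordWeyl (coordMetric g φ) (φ x) (chartDiff φ x u) (chartDiff φ x v) (chartDiff φ x w)
      (chartDiff φ x t) = coordWeyl (coordMetric g φ') (φ' x) (chartDiff φ' x u)
        (chartDiff φ' x v) (chartDiff φ' x w) (chartDiff φ' x t) := by
  have hψ := pullbackGerm_transition g hφ hφ' hx hx'
  have hG := localMetric_coordMetric g hφ (φ.map_source hx)
  have hG' := localMetric_coordMetric g hφ' (φ'.map_source hx')
  rw [← transition_apply (φ := φ) hx] at hG'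
  rw [hψ.coordWeyl_eq hG hG' (fderiv_transition_eq hφ hφ' hx hx')
    (fun h => hs ((mem_singularSet_iff hφ hx).2 h)), transitionEquiv_chartDiff,
    transitionEquiv_chartDiff, transitionEquiv_chartDiff, transitionEquiv_chartDiff,
    transition_apply hx]

theorem weylTensor_eq (hφ : φ ∈ IsManifold.maximalAtlas (𝓡 m) ∞ M) (hx : x ∈ φ.source)
    (hs : x ∉ singularSet g) (v : Fin 4 → TangentSpace (𝓡 m) x) :
    weylTensor g x v = coordWeyl (coordMetric g φ) (φ x) (chartDiff φ x (v 0))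
      (chartDiff φ x (v 1)) (chartDiff φ x (v 2)) (chartDiff φ x (v 3)) :=
  coordWeyl_transition (IsManifold.chart_mem_maximalAtlas x) hφ (mem_chart_source _ x) hx hs _ _ _ _

theorem transverseMetric_coordMetric (hg : IsTransverseTypeChanging g)
    (hφ : φ ∈ IsManifold.maximalAtlas (𝓡 m) ∞ M) (hx : x ∈ φ.source) (hs : x ∈ singularSet g) :
    TransverseMetric (coordMetric g φ) (φ x) :=
  ⟨localMetric_coordMetric g hφ (φ.map_source hx), hg φ hφ x hx hs⟩

theorem isClosed_singularSet : IsClosed (singularSet g) := by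
  rw [← isOpen_compl_iff, isOpen_iff_mem_nhds]
  intro x hx
  have hc := IsManifold.chart_mem_maximalAtlas (I := 𝓡 m) (n := ∞) x
  have hxc := mem_chart_source (Coord m) x
  have hG := localMetric_coordMetric g hc ((chartAt (Coord m) x).map_source hxc)
  have h1 : gramDet (coordMetric g (chartAt (Coord m) x)) (chartAt (Coord m) x x) ≠ 0 :=
    fun h => hx ((mem_singularSet_iff hc hxc).2 h)
  filter_upwards [(chartAt (Coord m) x).open_source.mem_nhds hxc,
    ((chartAt (Coord m) x).continuousAt hxc).eventually
      (hG.smooth_gramDet.continuousAt.eventually_ne h1)] with y hy h2 h3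
    using h2 ((mem_singularSet_iff hc hy).1 h3)

theorem IsRadicalField.radicalGerm (hR : IsRadicalField g R U) (hU : IsOpen U)
    (hφ : φ ∈ IsManifold.maximalAtlas (𝓡 m) ∞ M) (hx : x ∈ φ.source) (hxU : x ∈ U) :
    RadicalGerm (coordMetric g φ) (coordField φ R) (φ x) := by
  refine ⟨hR.1.smoothNear hU hφ hx hxU, ?_⟩
  filter_upwards [eventually_mem_source (φ.map_source hx) hU (by rwa [φ.left_inv hx])] with z hz h0
  have hs := (symm_mem_singularSet_iff (g := g) hφ hz.1).2 h0
  obtain ⟨h1, h2⟩ := hR.2 _ ⟨hs, hz.2⟩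
  have h3 := (mem_radical_iff hφ (φ.map_target hz.1) _).1 h1
  rw [φ.right_inv hz.1] at h3
  exact ⟨h3, fun h => h2 ((chartDiff_eq_zero_iff hφ (φ.map_target hz.1) _).1 h)⟩

/-- The bilinear identity `II^R = h g` along `Σ`, read in a chart. -/
theorem eventually_christoffelFirst_eq (hR : IsRadicalField g R U) (hU : IsOpen U)
    (hφ : φ ∈ IsManifold.maximalAtlas (𝓡 m) ∞ M) (hx : x ∈ φ.source) (hxU : x ∈ U) {h : M → ℝ}
    (hII : ∀ p ∈ singularSet g ∩ U, ∀ u ∈ tangentSigma g p, ∀ v ∈ tangentSigma g p,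
      secondForm g p (R p) u v = h p * g.form p u v) :
    ∀ᶠ y in 𝓝 (φ x), gramDet (coordMetric g φ) y = 0 → ∀ u v,
      fderiv ℝ (gramDet (coordMetric g φ)) y u = 0 →
      fderiv ℝ (gramDet (coordMetric g φ)) y v = 0 →
      christoffelFirst (coordMetric g φ) y u v (coordField φ R y) =
        h (φ.symm y) * coordMetric g φ y u v := by
  filter_upwards [eventually_mem_source (φ.map_source hx) hU (by rwa [φ.left_inv hx])]
    with z hz h0 u v hu hv
  have hs := (symm_mem_singularSet_iff (g := g) hφ hz.1).2 h0
  have hzs := φ.map_target hz.1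
  obtain ⟨u, rfl⟩ := chartDiff_surjective hφ hzs u
  obtain ⟨v, rfl⟩ := chartDiff_surjective hφ hzs v
  have hu' := mem_tangentSigma_iff hφ hzs hs u
  have hv' := mem_tangentSigma_iff hφ hzs hs v
  rw [φ.right_inv hz.1] at hu' hv'
  have h1 := hII _ ⟨hs, hz.2⟩ u (hu'.2 hu) v (hv'.2 hv)
  rw [secondForm_eq hφ hzs (hR.2 _ ⟨hs, hz.2⟩).1, ← coordMetric_chartDiff g hφ hzs,
    φ.right_inv hz.1] at h1
  exact h1

theorem flatGerm_of_secondForm_eq_zero (hR : IsRadicalField g R U) (hU : IsOpen U)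
    (hφ : φ ∈ IsManifold.maximalAtlas (𝓡 m) ∞ M) (hx : x ∈ φ.source) (hxU : x ∈ U)
    (hII : ∀ p ∈ singularSet g ∩ U, ∀ u ∈ tangentSigma g p, ∀ v ∈ tangentSigma g p,
      secondForm g p (R p) u v = 0) : FlatGerm (coordMetric g φ) (coordField φ R) (φ x) := by
  have := eventually_christoffelFirst_eq hR hU hφ hx hxU (h := fun _ => 0) (by simpa using hII)
  simpa [FlatGerm] using this

theorem IsTangentField.eventually (hX : IsTangentField g X U) (hU : IsOpen U)
    (hφ : φ ∈ IsManifold.maximalAtlas (𝓡 m) ∞ M) (hx : x ∈ φ.source) (hxU : x ∈ U) :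
    ∀ᶠ y in 𝓝 (φ x), gramDet (coordMetric g φ) y = 0 →
      fderiv ℝ (gramDet (coordMetric g φ)) y (coordField φ X y) = 0 := by
  filter_upwards [eventually_mem_source (φ.map_source hx) hU (by rwa [φ.left_inv hx])] with z hz h0
  have hs := (symm_mem_singularSet_iff (g := g) hφ hz.1).2 h0
  have h1 := (mem_tangentSigma_iff hφ (φ.map_target hz.1) hs _).1 (hX.2 _ ⟨hs, hz.2⟩)
  rwa [φ.right_inv hz.1] at h1

theorem conformalGerm_coordMetric {f : M → ℝ} (hf : ContMDiff (𝓡 m) 𝓘(ℝ, ℝ) ∞ f)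
    (hg : ∀ x, g'.form x = Real.exp (2 * f x) • g.form x)
    (hφ : φ ∈ IsManifold.maximalAtlas (𝓡 m) ∞ M) (hx : x ∈ φ.source) :
    ConformalGerm (coordMetric g φ) (coordMetric g' φ) (fun z => f (φ.symm z)) (φ x) := by
  refine ⟨smoothNear_comp_symm hφ (φ.map_source hx) isOpen_univ (mem_univ _) hf.contMDiffOn,
    .of_forall fun z => ?_⟩
  ext u v
  exact DFunLike.congr_fun (DFunLike.congr_fun (hg (φ.symm z)) _) _

end Transfer

/-! ### Extendibility of the Weyl tensor is a local property -/

section Extension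

variable {m : ℕ}

theorem isQuadrilinear_quad (Q : Quad m) : IsQuadrilinear fun u v w t => Q u v w t := by
  refine ⟨fun v w t => ⟨fun a b => ?_, fun c a => ?_⟩, fun u w t => ⟨fun a b => ?_, fun c a => ?_⟩,
    fun u v t => ⟨fun a b => ?_, fun c a => ?_⟩, fun u v w => ⟨fun a b => ?_, fun c a => ?_⟩⟩ <;>
  simp only [map_add, map_smul, add_apply, smul_apply]

theorem quadOfComponents_quad (Q : Quad m) : quadOfComponents
    (fun a b c d => Q (basisVec a) (basisVec b) (basisVec c) (basisVec d)) = Q := by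
  ext u v w t
  exact quadOfComponents_apply (isQuadrilinear_quad Q) u v w t

theorem SmoothNear.quadOfComponents {F : Coord m → Fin m → Fin m → Fin m → Fin m → ℝ} {p : Coord m}
    (hF : ∀ a b c d, SmoothNear (fun y => F y a b c d) p) :
    SmoothNear (fun y => quadOfComponents (F y)) p := by
  unfold RiemannLorentz.quadOfComponents
  exact SmoothNear.sum (s := Finset.univ) fun a _ => SmoothNear.sum (s := Finset.univ) fun b _ =>
    SmoothNear.sum (s := Finset.univ) fun c _ => SmoothNear.sum (s := Finset.univ) fun d _ =>
      (hF a b c d).smul (.const _)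

/-- The Weyl tensor, as a quadrilinear form, at a point where the metric is nondegenerate. -/
noncomputable def weylQuad (G : Coord m → Bilin m) (y : Coord m) : Quad m :=
  (gramDet G y)⁻¹ • curvQuad G y - kulkarniNomizuQuad
    (schoutenForm (ricciTrace ((gramDet G y)⁻¹ • curvQuad G y) (G y).inverse)
      (metricTrace (ricciTrace ((gramDet G y)⁻¹ • curvQuad G y) (G y).inverse) (G y).inverse)
      (G y)) (G y)

variable {G : Coord m → Bilin m} {p y : Coord m}

theorem LocalMetric.coordWeyl_eq_weylQuad (hG : LocalMetric G y) (h : gramDet G y ≠ 0)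
    (u v w t : Coord m) : coordWeyl G y u v w t = weylQuad G y u v w t := by
  rw [hG.coordWeyl_eq h (hG.coordCurv_eq h), weylQuad, sub_apply, sub_apply, sub_apply, sub_apply,
    kulkarniNomizuQuad_apply]

theorem LocalMetric.smooth_weylQuad (hG : LocalMetric G p) (h : gramDet G p ≠ 0) :
    SmoothNear (weylQuad G) p := by
  have hK := (hG.smooth_gramDet.inv h).smul hG.smooth_curvQuad
  have hJ := hG.smooth_inverse h
  exact hK.sub (SmoothNear.quadOfComponents fun a b c d =>
    SmoothNear.kulkarniNomizu ((hK.ricciTrace hJ).schoutenForm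
      ((hK.ricciTrace hJ).metricTrace hJ) hG.smooth) hG.smooth _ _ _ _)

theorem LocalMetric.weylExtendsNear (hG : LocalMetric G p) (h : gramDet G p ≠ 0) :
    WeylExtendsNear G p := by
  refine ⟨weylQuad G, hG.smooth_weylQuad h, ?_⟩
  filter_upwards [hG.eventually] with y h1 h2 u v w t using h1.coordWeyl_eq_weylQuad h2 u v w t

/-- A quadrilinear form as a multilinear map. -/
noncomputable def quadMultilinear (Q : Quad m) :
    MultilinearMap ℝ (fun _ : Fin 4 => Coord m) ℝ :=
  ∑ a, ∑ b, ∑ c, ∑ d, Q (basisVec a) (basisVec b) (basisVec c) (basisVec d) •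
    (MultilinearMap.mkPiAlgebra ℝ (Fin 4) ℝ).compLinearMap
      fun i => (EuclideanSpace.proj (![a, b, c, d] i) : Coord m →L[ℝ] ℝ).toLinearMap

theorem quadMultilinear_apply (Q : Quad m) (v : Fin 4 → Coord m) :
    quadMultilinear Q v = Q (v 0) (v 1) (v 2) (v 3) := by
  conv_rhs => rw [← quadOfComponents_quad Q]
  simp [quadMultilinear, quadOfComponents, Fin.prod_univ_four, mul_assoc]

variable {M : Type*} [TopologicalSpace M] [ChartedSpace (Coord m) M]
  [IsManifold (𝓡 m) ∞ M] {φ φ' : OpenPartialHomeomorph M (Coord m)} {g : SymTensorField m M}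
  {x : M}

/-- Local smooth extensions of the Weyl tensor in two charts agree. -/
theorem weylExtension_unique (hg : IsTransverseTypeChanging g)
    (hφ : φ ∈ IsManifold.maximalAtlas (𝓡 m) ∞ M) (hφ' : φ' ∈ IsManifold.maximalAtlas (𝓡 m) ∞ M)
    (hx : x ∈ φ.source) (hx' : x ∈ φ'.source) {T T' : Coord m → Quad m}
    (hT : SmoothNear T (φ x)) (hT' : SmoothNear T' (φ' x))
    (hTW : ∀ᶠ y in 𝓝 (φ x), gramDet (coordMetric g φ) y ≠ 0 →
      ∀ u v w t, coordWeyl (coordMetric g φ) y u v w t = T y u v w t)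
    (hTW' : ∀ᶠ y in 𝓝 (φ' x), gramDet (coordMetric g φ') y ≠ 0 →
      ∀ u v w t, coordWeyl (coordMetric g φ') y u v w t = T' y u v w t)
    (u v w t : TangentSpace (𝓡 m) x) :
    T (φ x) (chartDiff φ x u) (chartDiff φ x v) (chartDiff φ x w) (chartDiff φ x t) =
      T' (φ' x) (chartDiff φ' x u) (chartDiff φ' x v) (chartDiff φ' x w) (chartDiff φ' x t) := by
  by_cases hs : x ∈ singularSet g
  · have hψ := pullbackGerm_transition g hφ hφ' hx hx'
    have hz' : φ.symm (φ x) ∈ φ'.source := by rwa [φ.left_inv hx]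
    have hD := fderiv_transition_eq hφ hφ' hx hx'
    have hsm := hψ.smooth
    rw [← transition_apply (φ := φ) hx] at hT' hTW'
    have hd : ∀ a : Coord m, SmoothNear (fun z => fderiv ℝ (transition φ φ') z a) (φ x) :=
      fun a => hsm.fderiv_right.clm_apply (.const a)
    have key := eq_of_eventually_ne_zero (transverseMetric_coordMetric hg hφ hx hs).fderiv_ne
      (F := fun z => T z (chartDiff φ x u) (chartDiff φ x v) (chartDiff φ x w) (chartDiff φ x t))
      (F' := fun z => T' (transition φ φ' z)
        (fderiv ℝ (transition φ φ') z (chartDiff φ x u))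
        (fderiv ℝ (transition φ φ') z (chartDiff φ x v))
        (fderiv ℝ (transition φ φ') z (chartDiff φ x w))
        (fderiv ℝ (transition φ φ') z (chartDiff φ x t)))
      (hT.quad_apply (.const _) (.const _) (.const _) (.const _)).continuousAt
      ((hT'.comp hsm).quad_apply (hd _) (hd _) (hd _) (hd _)).continuousAt ?_
    · rw [key, hD]
      simp only [ContinuousLinearEquiv.coe_coe, transitionEquiv_chartDiff]
      rw [transition_apply hx]
    · filter_upwards [hTW, hsm.continuousAt.eventually hTW', hψ.eventually,
        eventually_mem_source (φ.map_source hx) φ'.open_source hz'] with z h1 h2 h3 hz h0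
      have hzs := φ.map_target hz.1
      have hDz := fderiv_transition_eq hφ hφ' hzs hz.2
      rw [φ.right_inv hz.1] at hDz
      have hG' := localMetric_coordMetric g hφ' (φ'.map_source hz.2)
      have h4 := h3.coordWeyl_eq (localMetric_coordMetric g hφ hz.1) hG' hDz h0
      have h5 : gramDet (coordMetric g φ') (transition φ φ' z) ≠ 0 := fun h =>
        h0 ((h3.gramDet_eq_zero_iff hDz).2 h)
      rw [← h1 h0, h4, h2 h5, hDz]
      rfl
  · rw [← hTW.self_of_nhds (fun h => hs ((mem_singularSet_iff hφ hx).2 h)),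
      ← hTW'.self_of_nhds (fun h => hs ((mem_singularSet_iff hφ' hx').2 h)),
      coordWeyl_transition hφ hφ' hx hx' hs]

/-- Local smooth extensions of the Weyl tensor glue. -/
theorem weylExtends_of_weylExtendsNear (hg : IsTransverseTypeChanging g)
    (h : ∀ φ ∈ IsManifold.maximalAtlas (𝓡 m) ∞ M, ∀ x ∈ φ.source,
      WeylExtendsNear (coordMetric g φ) (φ x)) : WeylExtends g := by
  have hc : ∀ x : M, chartAt (Coord m) x ∈ IsManifold.maximalAtlas (𝓡 m) ∞ M := fun x =>
    IsManifold.chart_mem_maximalAtlas x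
  choose T hT hTW using fun x : M => h _ (hc x) x (mem_chart_source _ x)
  refine ⟨fun x => (quadMultilinear (T x (chartAt (Coord m) x x))).compLinearMap
    fun _ => (chartDiff (chartAt (Coord m) x) x).toLinearMap, ?_, ?_⟩
  · intro φ hφ a z hz
    obtain ⟨T', hT', hTW'⟩ := h φ hφ (φ.symm z) (φ.map_target hz)
    rw [φ.right_inv hz] at hT' hTW'
    have h1 : SmoothNear (fun y => T' y (basisVec (a 0)) (basisVec (a 1)) (basisVec (a 2))
        (basisVec (a 3))) z := hT'.quad_apply (.const _) (.const _) (.const _) (.const _)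
    refine (h1.contDiffAt.congr_of_eventuallyEq ?_).contDiffWithinAt
    filter_upwards [hT'.eventually, eventually_eventually_nhds.2 hTW',
      φ.open_target.mem_nhds hz] with y h2 h3 hy
    have h4 := weylExtension_unique hg hφ (hc (φ.symm y)) (φ.map_target hy)
      (mem_chart_source _ _) (by rwa [φ.right_inv hy]) (hT (φ.symm y))
      (by rwa [φ.right_inv hy]) (hTW (φ.symm y)) (chartSymmDiff φ y (basisVec (a 0)))
      (chartSymmDiff φ y (basisVec (a 1))) (chartSymmDiff φ y (basisVec (a 2)))
      (chartSymmDiff φ y (basisVec (a 3)))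
    simp only [chartDiff_chartSymmDiff hφ hy] at h4
    rw [φ.right_inv hy] at h4
    rw [MultilinearMap.compLinearMap_apply, quadMultilinear_apply]
    exact h4.symm
  · intro x hx v
    rw [MultilinearMap.compLinearMap_apply, quadMultilinear_apply]
    exact ((hTW x).self_of_nhds
      (fun h => hx ((mem_singularSet_iff (hc x) (mem_chart_source _ x)).2 h)) _ _ _ _).symm

theorem WeylExtends.weylExtendsNear (h : WeylExtends g)
    (hφ : φ ∈ IsManifold.maximalAtlas (𝓡 m) ∞ M) (hx : x ∈ φ.source) :
    WeylExtendsNear (coordMetric g φ) (φ x) := by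
  obtain ⟨T, hT, hTW⟩ := h
  refine ⟨fun y => quadOfComponents fun a b c d =>
    T (φ.symm y) fun i => chartSymmDiff φ y (basisVec (![a, b, c, d] i)),
    SmoothNear.quadOfComponents fun a b c d => smoothNear_of_contDiffOn (hT φ hφ ![a, b, c, d])
      φ.open_target (φ.map_source hx), ?_⟩
  filter_upwards [φ.open_target.mem_nhds (φ.map_source hx)] with y hy h0 u v w t
  have hG := localMetric_coordMetric g hφ hy
  have hs : φ.symm y ∉ singularSet g := fun h => h0 ((symm_mem_singularSet_iff hφ hy).1 h)
  have h1 : ∀ a b c d : Fin m,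
      T (φ.symm y) (fun i => chartSymmDiff φ y (basisVec (![a, b, c, d] i))) =
        weylQuad (coordMetric g φ) y (basisVec a) (basisVec b) (basisVec c) (basisVec d) := by
    intro a b c d
    rw [hTW _ hs, weylTensor_eq hφ (φ.map_target hy) hs, φ.right_inv hy,
      ← hG.coordWeyl_eq_weylQuad h0]
    simp only [chartDiff_chartSymmDiff hφ hy]
    rfl
  simp only [h1]
  rw [quadOfComponents_quad, hG.coordWeyl_eq_weylQuad h0]

end Extension

/-! ### Conformal classes of tensor fields -/

section ConformalClass

variable {m : ℕ} {M : Type*} [TopologicalSpace M] [ChartedSpace (Coord m) M]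
  [IsManifold (𝓡 m) ∞ M] {φ : OpenPartialHomeomorph M (Coord m)} {g g' : SymTensorField m M}
  {x : M} {f : M → ℝ}

/-- The tensor field `e^{2f} g`. -/
noncomputable def conformalChange (g : SymTensorField m M) {f : M → ℝ}
    (hf : ContMDiff (𝓡 m) 𝓘(ℝ, ℝ) ∞ f) : SymTensorField m M where
  form x := Real.exp (2 * f x) • g.form x
  symm x u v := by
    have h : ∀ a b : TangentSpace (𝓡 m) x, (Real.exp (2 * f x) • g.form x) a b =
      Real.exp (2 * f x) * g.form x a b := fun a b => rfl
    rw [h, h, g.symm]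
  contMDiff := by
    refine ContMDiff.smul_section (s := g.form) ?_ g.contMDiff
    exact Real.contDiff_exp.contMDiff.comp (contMDiff_const.mul hf)

theorem conformalChange_mem (hf : ContMDiff (𝓡 m) 𝓘(ℝ, ℝ) ∞ f) :
    conformalChange g hf ∈ conformalClass g := ⟨f, hf, fun _ => rfl⟩

theorem mem_conformalClass_symm (h : g' ∈ conformalClass g) : g ∈ conformalClass g' := by
  obtain ⟨f, hf, h⟩ := h
  refine ⟨fun x => -f x, hf.neg, fun x => ?_⟩
  rw [h, smul_smul, ← Real.exp_add]
  simp

theorem mem_conformalClass_trans {g'' : SymTensorField m M} (h : g' ∈ conformalClass g)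
    (h' : g'' ∈ conformalClass g') : g'' ∈ conformalClass g := by
  obtain ⟨f, hf, h⟩ := h
  obtain ⟨f', hf', h'⟩ := h'
  refine ⟨fun x => f' x + f x, hf'.add hf, fun x => ?_⟩
  rw [h', h, smul_smul, ← Real.exp_add]
  ring_nf

theorem radical_eq_of_mem_conformalClass (h : g' ∈ conformalClass g) (x : M) :
    radical g' x = radical g x := by
  obtain ⟨f, hf, h⟩ := h
  have h1 : ∀ a b : TangentSpace (𝓡 m) x, g'.form x a b =
    Real.exp (2 * f x) * g.form x a b := fun a b => by rw [h]; rfl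
  ext ξ
  simp [radical, h1, (Real.exp_pos _).ne']

theorem singularSet_eq_of_mem_conformalClass (h : g' ∈ conformalClass g) :
    singularSet g' = singularSet g := by
  simp only [singularSet, radical_eq_of_mem_conformalClass h]

theorem tangentSigma_eq_of_mem_conformalClass (h : g' ∈ conformalClass g)
    (hs : x ∈ singularSet g) : tangentSigma g' x = tangentSigma g x := by
  obtain ⟨f, hf, h⟩ := h
  have hc := IsManifold.chart_mem_maximalAtlas (I := 𝓡 m) (n := ∞) x
  have hxc := mem_chart_source (Coord m) x
  ext v
  exact (conformalGerm_coordMetric hf h hc hxc).fderiv_gramDet_eq_zero_iff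
    (localMetric_coordMetric g hc ((chartAt (Coord m) x).map_source hxc))
    ((mem_singularSet_iff hc hxc).1 hs) _

theorem IsTransverseTypeChanging.of_mem_conformalClass (hg : IsTransverseTypeChanging g)
    (h : g' ∈ conformalClass g) : IsTransverseTypeChanging g' := by
  intro φ hφ x hx hs
  rw [singularSet_eq_of_mem_conformalClass h] at hs
  obtain ⟨f, hf, h⟩ := h
  exact ((conformalGerm_coordMetric hf h hφ hx).transverseMetric
    (transverseMetric_coordMetric hg hφ hx hs) ((mem_singularSet_iff hφ hx).1 hs)).fderiv_ne

theorem RadicalTransverse.of_mem_conformalClass (hg : RadicalTransverse g)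
    (h : g' ∈ conformalClass g) : RadicalTransverse g' := by
  intro x hs ξ hξ h0
  rw [singularSet_eq_of_mem_conformalClass h] at hs
  rw [radical_eq_of_mem_conformalClass h] at hξ
  rw [tangentSigma_eq_of_mem_conformalClass h hs]
  exact hg x hs ξ hξ h0

theorem IsRadicalField.of_mem_conformalClass {R : ∀ x : M, TangentSpace (𝓡 m) x} {U : Set M}
    (hR : IsRadicalField g R U) (h : g' ∈ conformalClass g) : IsRadicalField g' R U := by
  refine ⟨hR.1, fun x hx => ?_⟩
  rw [singularSet_eq_of_mem_conformalClass h] at hx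
  rw [radical_eq_of_mem_conformalClass h]
  exact hR.2 x hx

theorem WeylExtends.of_mem_conformalClass (hm : 4 ≤ m) (hg : IsTransverseTypeChanging g)
    (hW : WeylExtends g) (h : g' ∈ conformalClass g) : WeylExtends g' := by
  refine weylExtends_of_weylExtendsNear (hg.of_mem_conformalClass h) fun φ hφ x hx => ?_
  obtain ⟨f, hf, h⟩ := h
  exact (conformalGerm_coordMetric hf h hφ hx).weylExtendsNear hm
    (localMetric_coordMetric g hφ (φ.map_source hx)) (hW.weylExtendsNear hφ hx)

end ConformalClass

/-! ### Radical fields and tangent fields -/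

section Fields

variable {m : ℕ}

theorem TransverseMetric.exists_radicalGerm {G : Coord m → Bilin m} {p : Coord m}
    (hG : TransverseMetric G p) (hp : gramDet G p = 0) : ∃ R, RadicalGerm G R p := by
  obtain ⟨r, hr0, hr⟩ := gramDet_eq_zero_iff.1 hp
  obtain ⟨c, hc0, hc⟩ := hG.exists_adjMap_eq hr0 hr
  obtain ⟨α, -, hα⟩ := exists_dual_vector ℝ r (norm_ne_zero_iff.2 hr0)
  have hα0 : α r ≠ 0 := by rw [hα]; simpa using hr0
  have hs : SmoothNear (fun y => adjMap G y α) p := hG.smooth_adjMap.clm_apply (.const α)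
  refine ⟨fun y => adjMap G y α, hs, ?_⟩
  filter_upwards [hs.continuousAt.eventually_ne (y := 0) (by simp [hc, hc0, hα0, hr0])] with y h1 h2
  exact ⟨by rw [apply_adjMap, h2, zero_smul], h1⟩

theorem FlatGerm.of_radicalGerm {G : Coord m → Bilin m} {R R' : Coord m → Coord m} {p : Coord m}
    (hII : FlatGerm G R p) (hG : TransverseMetric G p) (hR : RadicalGerm G R p)
    (hR' : RadicalGerm G R' p) : FlatGerm G R' p := by
  filter_upwards [hII, hG.eventually, hR.radical, hR'.radical] with y h1 h2 h3 h4 hy u v hu hv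
  obtain ⟨a, ha⟩ := h2.exists_eq_smul (h3 hy).2 (h3 hy).1 (h4 hy).1
  rw [ha, map_smul, h1 hy u v hu hv, smul_zero]

variable {M : Type*} [TopologicalSpace M] [ChartedSpace (Coord m) M]
  [IsManifold (𝓡 m) ∞ M] {φ φ' : OpenPartialHomeomorph M (Coord m)} {g : SymTensorField m M}
  {x : M}

theorem RadicalTransverse.fderiv_ne (hT : RadicalTransverse g)
    (hφ : φ ∈ IsManifold.maximalAtlas (𝓡 m) ∞ M) (hx : x ∈ φ.source) (hs : x ∈ singularSet g)
    {r : Coord m} (hr : coordMetric g φ (φ x) r = 0) (hr0 : r ≠ 0) :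
    fderiv ℝ (gramDet (coordMetric g φ)) (φ x) r ≠ 0 := by
  obtain ⟨ξ, rfl⟩ := chartDiff_surjective hφ hx r
  intro h
  exact hT x hs ξ ((mem_radical_iff hφ hx ξ).2 hr) (fun h => hr0 (by rw [h, map_zero]))
    ((mem_tangentSigma_iff hφ hx hs ξ).2 h)

/-- The side of `Σ` to which a vector points does not depend on the chart. -/
theorem fderiv_gramDet_pos_iff (hφ : φ ∈ IsManifold.maximalAtlas (𝓡 m) ∞ M)
    (hφ' : φ' ∈ IsManifold.maximalAtlas (𝓡 m) ∞ M) (hx : x ∈ φ.source) (hx' : x ∈ φ'.source)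
    (hs : x ∈ singularSet g) (ξ : TangentSpace (𝓡 m) x) :
    0 < fderiv ℝ (gramDet (coordMetric g φ)) (φ x) (chartDiff φ x ξ) ↔
      0 < fderiv ℝ (gramDet (coordMetric g φ')) (φ' x) (chartDiff φ' x ξ) := by
  have hψ := pullbackGerm_transition g hφ hφ' hx hx'
  have hG' := localMetric_coordMetric g hφ' (φ'.map_source hx')
  have hs' := (mem_singularSet_iff hφ' hx').1 hs
  rw [← transition_apply (φ := φ) hx] at hG' hs'
  rw [hψ.fderiv_gramDet hG' hs', fderiv_transition_eq hφ hφ' hx hx',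
    ContinuousLinearEquiv.coe_coe, transitionEquiv_chartDiff, transition_apply hx]
  exact mul_pos_iff_of_pos_left (sq_pos_of_ne_zero (det_equiv_ne_zero _))

/-- If the radical is transverse, there is a global radical field: locally the radical is spanned by
a smooth field, and the sections pointing to the positive side of `Σ` form a convex set. -/
theorem RadicalTransverse.exists_isRadicalField [T2Space M] [SigmaCompactSpace M]
    (hg : IsTransverseTypeChanging g) (hT : RadicalTransverse g) :
    ∃ R : ∀ x : M, TangentSpace (𝓡 m) x, IsRadicalField g R univ := by
  have hc : ∀ x : M, chartAt (Coord m) x ∈ IsManifold.maximalAtlas (𝓡 m) ∞ M := fun x =>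
    IsManifold.chart_mem_maximalAtlas x
  let t : ∀ x : M, Set (TangentSpace (𝓡 m) x) := fun x => {ξ | x ∈ singularSet g →
    ξ ∈ radical g x ∧ 0 < fderiv ℝ (gramDet (coordMetric g (chartAt (Coord m) x)))
      (chartAt (Coord m) x x) (chartDiff (chartAt (Coord m) x) x ξ)}
  have ht : ∀ x, Convex ℝ (t x) := by
    intro x ξ hξ η hη a b ha hb hab hs
    obtain ⟨h1, h2⟩ := hξ hs
    obtain ⟨h3, h4⟩ := hη hs
    refine ⟨fun v => ?_, ?_⟩
    · have h5 : g.form x (a • ξ + b • η) v = a * g.form x ξ v + b * g.form x η v := by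
        rw [map_add, map_smul, map_smul]; rfl
      rw [h5, h1 v, h3 v]
      ring
    · simp only [map_add, map_smul, smul_eq_mul]
      rcases ha.eq_or_lt with rfl | ha
      · rw [zero_add] at hab
        subst hab
        simpa using h4
      · exact add_pos_of_pos_of_nonneg (mul_pos ha h2) (mul_nonneg hb h4.le)
  obtain ⟨R, hR⟩ := exists_contMDiffSection_forall_mem_convex_of_local (n := ⊤) (𝓡 m)
    (F_fiber := Coord m) (fun x : M => TangentSpace (𝓡 m) x) t ht fun x₀ => by
      set φ := chartAt (Coord m) x₀ with hφ
      have hx₀ : x₀ ∈ φ.source := mem_chart_source _ x₀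
      by_cases hs : x₀ ∈ singularSet g
      · have hG := transverseMetric_coordMetric hg (hc x₀) hx₀ hs
        have hp := (mem_singularSet_iff (hc x₀) hx₀).1 hs
        obtain ⟨V, hV⟩ := hG.exists_radicalGerm hp
        obtain ⟨h1, h2⟩ := hV.radical.self_of_nhds hp
        have h3 := hT.fderiv_ne (hc x₀) hx₀ hs h1 h2
        obtain ⟨a, ha⟩ : ∃ a : ℝ, 0 < a * fderiv ℝ (gramDet (coordMetric g φ)) (φ x₀) (V (φ x₀)) :=
          ⟨_, mul_self_pos.2 h3⟩
        have hd := (SmoothNear.const a).mul (hG.smooth_gramDet.fderiv_right.clm_apply hV.smooth)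
        have hVs := (SmoothNear.const a).smul hV.smooth
        have hev := (φ.continuousAt hx₀).eventually
          ((hVs.and hV.radical).and (hd.continuousAt.eventually (lt_mem_nhds ha)))
        refine ⟨_, (hev.and (φ.open_source.mem_nhds hx₀)), liftField φ fun y => a • V y,
          smoothFieldOn_liftField (hc x₀) (fun x hx => hx.2) fun x hx => hx.1.1.1,
          fun x hx hsx => ?_⟩
        obtain ⟨⟨⟨-, h4⟩, h5⟩, hx⟩ := hx
        have h6 := h4 ((mem_singularSet_iff (hc x₀) hx).1 hsx)
        constructor
        · rw [mem_radical_iff (hc x₀) hx, chartDiff_liftField (hc x₀) hx, map_smul, h6.1, smul_zero]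
        · rw [← fderiv_gramDet_pos_iff (hc x₀) (hc x) hx (mem_chart_source _ x) hsx,
            chartDiff_liftField (hc x₀) hx, map_smul]
          exact h5
      · refine ⟨(singularSet g)ᶜ, isClosed_singularSet.isOpen_compl.mem_nhds hs, fun _ => 0,
          ?_, fun y hy hsy => (hy hsy).elim⟩
        exact (contMDiff_zeroSection ℝ (TangentSpace (𝓡 m) : M → Type _)).contMDiffOn
  refine ⟨R, R.contMDiff.contMDiffOn, fun x hx => ?_⟩
  obtain ⟨h1, h2⟩ := hR x hx.1
  refine ⟨h1, fun h => ?_⟩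
  rw [h, map_zero, map_zero] at h2
  exact lt_irrefl _ h2

/-- A tangent vector of `Σ` extends to a local field tangent to `Σ`. -/
theorem exists_isTangentField (hg : IsTransverseTypeChanging g) (hT : RadicalTransverse g)
    (hs : x ∈ singularSet g) {u : TangentSpace (𝓡 m) x} (hu : u ∈ tangentSigma g x) :
    ∃ X : ∀ x : M, TangentSpace (𝓡 m) x, X x = u ∧
      ∃ V : Set M, IsOpen V ∧ x ∈ V ∧ IsTangentField g X V := by
  set φ := chartAt (Coord m) x with hφ
  have hc : φ ∈ IsManifold.maximalAtlas (𝓡 m) ∞ M := IsManifold.chart_mem_maximalAtlas x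
  have hx : x ∈ φ.source := mem_chart_source _ x
  have hG := transverseMetric_coordMetric hg hc hx hs
  have hp := (mem_singularSet_iff hc hx).1 hs
  obtain ⟨W, hW⟩ := hG.exists_radicalGerm hp
  obtain ⟨h1, h2⟩ := hW.radical.self_of_nhds hp
  have h3 := hT.fderiv_ne hc hx hs h1 h2
  have hδ := hG.smooth_gramDet.fderiv_right
  have hd := hδ.clm_apply hW.smooth
  set Z : Coord m → Coord m := fun y => chartDiff φ x u -
    ((fderiv ℝ (gramDet (coordMetric g φ)) y (chartDiff φ x u)) *
      (fderiv ℝ (gramDet (coordMetric g φ)) y (W y))⁻¹) • W y with hZ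
  have hZs : SmoothNear Z (φ x) := (SmoothNear.const _).sub
    (((hδ.clm_apply (.const _)).mul (hd.inv h3)).smul hW.smooth)
  have hev := (φ.continuousAt hx).eventually (hZs.and (hd.continuousAt.eventually_ne h3))
  obtain ⟨V, hV, hVo, hxV⟩ := mem_nhds_iff.1 (Filter.inter_mem hev (φ.open_source.mem_nhds hx))
  refine ⟨liftField φ Z, ?_, V, hVo, hxV,
    smoothFieldOn_liftField hc (fun y hy => (hV hy).2) fun y hy => (hV hy).1.1, fun y hy => ?_⟩
  · apply chartDiff_injective hc hx
    have h4 := (mem_tangentSigma_iff hc hx hs u).1 hu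
    rw [chartDiff_liftField hc hx, hZ]
    simp [h4]
  · obtain ⟨⟨-, h4⟩, h5⟩ := hV hy.2
    rw [mem_tangentSigma_iff hc h5 hy.1, chartDiff_liftField hc h5, hZ, map_sub, map_smul,
      smul_eq_mul]
    have h6 : fderiv ℝ (gramDet (coordMetric g φ)) (φ y) (W (φ y)) ≠ 0 := h4
    field_simp
    ring

/-- Smooth fields which agree off `Σ` agree. -/
theorem field_unique (hg : IsTransverseTypeChanging g) {A B : ∀ x : M, TangentSpace (𝓡 m) x}
    {W : Set M} (hW : IsOpen W) (hA : SmoothFieldOn A W) (hB : SmoothFieldOn B W)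
    (h : ∀ y ∈ W, y ∉ singularSet g → A y = B y) (hx : x ∈ W) : A x = B x := by
  by_cases hs : x ∈ singularSet g
  · have hc := IsManifold.chart_mem_maximalAtlas (I := 𝓡 m) (n := ∞) x
    have hxc := mem_chart_source (Coord m) x
    apply chartDiff_injective hc hxc
    have h1 := eq_of_eventually_ne_zero (transverseMetric_coordMetric hg hc hxc hs).fderiv_ne
      (hA.smoothNear hW hc hxc hx).continuousAt (hB.smoothNear hW hc hxc hx).continuousAt ?_
    · rw [coordField, coordField, (chartAt (Coord m) x).left_inv hxc] at h1
      exact h1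
    · filter_upwards [eventually_mem_source ((chartAt (Coord m) x).map_source hxc) hW
        (by rwa [(chartAt (Coord m) x).left_inv hxc])] with z hz h0
      rw [coordField, coordField,
        h _ hz.2 fun h => h0 ((symm_mem_singularSet_iff hc hz.1).1 h)]
  · exact h x hx hs

/-- Local smooth fields, uniquely determined off `Σ` by a pointwise condition, glue. -/
theorem exists_smoothFieldOn_of_local (hg : IsTransverseTypeChanging g)
    {P : ∀ x : M, TangentSpace (𝓡 m) x → Prop} {V : Set M}
    (huniq : ∀ x ∈ V, x ∉ singularSet g → ∀ ξ η, P x ξ → P x η → ξ = η)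
    (hloc : ∀ x ∈ V, ∃ A : ∀ x : M, TangentSpace (𝓡 m) x, ∃ W : Set M, IsOpen W ∧ x ∈ W ∧
      W ⊆ V ∧ SmoothFieldOn A W ∧ ∀ y ∈ W, y ∉ singularSet g → P y (A y)) :
    ∃ N : ∀ x : M, TangentSpace (𝓡 m) x, SmoothFieldOn N V ∧
      ∀ x ∈ V, x ∉ singularSet g → P x (N x) := by
  classical
  choose A W hW hxW hWV hA hP using hloc
  have key : ∀ x (hx : x ∈ V) y (hy : y ∈ V), y ∈ W x hx → A y hy y = A x hx y := by
    intro x hx y hy hyx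
    refine field_unique hg ((hW y hy).inter (hW x hx)) ((hA y hy).mono inter_subset_left)
      ((hA x hx).mono inter_subset_right) (fun z hz hs => ?_) ⟨hxW y hy, hyx⟩
    exact huniq z (hWV y hy hz.1) hs _ _ (hP y hy z hz.1 hs) (hP x hx z hz.2 hs)
  refine ⟨fun x => if hx : x ∈ V then A x hx x else 0, fun x hx => ?_, fun x hx hs => ?_⟩
  · refine ((ContMDiffOn.contMDiffAt (hA x hx)
      ((hW x hx).mem_nhds (hxW x hx))).congr_of_eventuallyEq ?_).contMDiffWithinAt
    filter_upwards [(hW x hx).mem_nhds (hxW x hx)] with y hy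
    rw [dif_pos (hWV x hx hy), key x hx y (hWV x hx hy) hy]
  · simp only [dif_pos hx]
    exact hP x hx x (hxW x hx) hs

end Fields

/-! ### From an extendible Weyl tensor to conformal flatness of second and third order -/

section Necessity

variable {m : ℕ} {M : Type*} [TopologicalSpace M] [ChartedSpace (Coord m) M]
  [IsManifold (𝓡 m) ∞ M] {φ : OpenPartialHomeomorph M (Coord m)} {g : SymTensorField m M}
  {x : M} {X Y N R : ∀ x : M, TangentSpace (𝓡 m) x} {U V : Set M}

theorem WeylExtends.radicalTransverse (hm : 4 ≤ m) (hg : IsTransverseTypeChanging g)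
    (hW : WeylExtends g) : RadicalTransverse g := by
  intro x hs ξ hξ hξ0 htan
  have hc := IsManifold.chart_mem_maximalAtlas (I := 𝓡 m) (n := ∞) x
  have hxc := mem_chart_source (Coord m) x
  have hG := transverseMetric_coordMetric hg hc hxc hs
  have hp := (mem_singularSet_iff hc hxc).1 hs
  obtain ⟨R, hR⟩ := hG.exists_radicalGerm hp
  obtain ⟨h1, h2⟩ := hR.radical.self_of_nhds hp
  obtain ⟨a, ha⟩ := hG.exists_eq_smul h2 h1 ((mem_radical_iff hc hxc ξ).1 hξ)
  have h3 := ((hW.weylExtendsNear hc hxc).secondForm_eq hm hG hp hR).1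
  rw [mem_tangentSigma_iff hc hxc hs, ha, map_smul, smul_eq_mul] at htan
  rcases mul_eq_zero.1 htan with h | h
  · rw [h, zero_smul] at ha
    exact hξ0 ((chartDiff_eq_zero_iff hc hxc ξ).1 ha)
  · exact h3 h

theorem WeylExtends.isConformallyIIFlat [T2Space M] [SigmaCompactSpace M] (hm : 4 ≤ m)
    (hg : IsTransverseTypeChanging g) (hW : WeylExtends g) : IsConformallyIIFlat g := by
  obtain ⟨R, hR⟩ := (hW.radicalTransverse hm hg).exists_isRadicalField hg
  let t : M → Set ℝ := fun x => {c | x ∈ singularSet g → ∀ u ∈ tangentSigma g x,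
    ∀ v ∈ tangentSigma g x, secondForm g x (R x) u v = c * g.form x u v}
  have ht : ∀ x, Convex ℝ (t x) := by
    intro x a ha b hb s s' _ _ hss hs u hu v hv
    have h1 := ha hs u hu v hv
    have h2 := hb hs u hu v hv
    simp only [smul_eq_mul]
    linear_combination s * h1 + s' * h2 - secondForm g x (R x) u v * hss
  obtain ⟨h, hh⟩ := exists_contMDiffMap_forall_mem_convex_of_local (n := ⊤) (𝓡 m) (t := t) ht
    fun x₀ => by
      by_cases hs : x₀ ∈ singularSet g
      · have hc := IsManifold.chart_mem_maximalAtlas (I := 𝓡 m) (n := ∞) x₀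
        have hxc := mem_chart_source (Coord m) x₀
        have hG := transverseMetric_coordMetric hg hc hxc hs
        have hp := (mem_singularSet_iff hc hxc).1 hs
        obtain ⟨-, h, hh, hhe⟩ := (hW.weylExtendsNear hc hxc).secondForm_eq hm hG hp
          (hR.radicalGerm isOpen_univ hc hxc (mem_univ _))
        refine ⟨_, (((chartAt (Coord m) x₀).continuousAt hxc).eventually (hh.and hhe)).and
          ((chartAt (Coord m) x₀).open_source.mem_nhds hxc),
          fun x => h (chartAt (Coord m) x₀ x),
          fun x hx => (contMDiffAt_comp_chart hc hx.2 hx.1.1).contMDiffWithinAt,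
          fun x hx hsx u hu v hv => ?_⟩
        obtain ⟨⟨-, h1⟩, hx⟩ := hx
        have h2 := h1 ((mem_singularSet_iff hc hx).1 hsx) _ _
          ((mem_tangentSigma_iff hc hx hsx u).1 hu) ((mem_tangentSigma_iff hc hx hsx v).1 hv)
        rw [coordField, (chartAt (Coord m) x₀).left_inv hx, coordMetric_chartDiff g hc hx] at h2
        rw [secondForm_eq hc hx (hR.2 x ⟨hsx, mem_univ _⟩).1]
        exact h2
      · exact ⟨(singularSet g)ᶜ, isClosed_singularSet.isOpen_compl.mem_nhds hs, fun _ => 0,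
          contMDiffOn_const, fun y hy hsy => (hy hsy).elim⟩
  exact ⟨R, hR, h, fun x _ => ⟨univ, isOpen_univ, mem_univ _, h, h.contMDiff.contMDiffOn,
    fun _ _ => rfl⟩, fun x hx => hh x hx⟩

theorem ExtendsNabla.eventually (hN : ExtendsNabla g X Y N V) (hV : IsOpen V)
    (hY : SmoothFieldOn Y V) (hφ : φ ∈ IsManifold.maximalAtlas (𝓡 m) ∞ M) (hx : x ∈ φ.source)
    (hxV : x ∈ V) : ∀ᶠ y in 𝓝 (φ x), gramDet (coordMetric g φ) y ≠ 0 →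
      coordMetric g φ y (coordField φ N y) =
        coordDualConn (coordMetric g φ) (coordField φ X) (coordField φ Y) y := by
  filter_upwards [eventually_mem_source (φ.map_source hx) hV (by rwa [φ.left_inv hx]),
    (hY.smoothNear hV hφ hx hxV)] with z hz hYz h0
  have hs : φ.symm z ∉ singularSet g := fun h => h0 ((symm_mem_singularSet_iff hφ hz.1).1 h)
  ext w
  obtain ⟨w, rfl⟩ := chartDiff_surjective hφ (φ.map_target hz.1) w
  have h1 := hN.2 _ hz.2 hs w
  rw [dualConn_eq hφ (φ.map_target hz.1) (by rwa [φ.right_inv hz.1]),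
    ← coordMetric_chartDiff g hφ (φ.map_target hz.1), φ.right_inv hz.1] at h1
  exact h1

/-- The Levi-Civita derivative of tangent fields of a `II`-flat metric extends across `Σ`. -/
theorem exists_extendsNabla (hg : IsTransverseTypeChanging g) (hV : IsOpen V)
    (hR : IsRadicalField g R V)
    (hII : ∀ p ∈ singularSet g ∩ V, ∀ u ∈ tangentSigma g p, ∀ v ∈ tangentSigma g p,
      secondForm g p (R p) u v = 0)
    (hX : IsTangentField g X V) (hY : IsTangentField g Y V) : ∃ N, ExtendsNabla g X Y N V := by
  refine exists_smoothFieldOn_of_local (V := V) hg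
    (P := fun x ξ => ∀ w, g.form x ξ w = dualConn g X Y x w) ?_ ?_
  · intro x _ hs ξ η hξ hη
    by_contra h
    refine hs ⟨ξ - η, fun w => ?_, sub_ne_zero.2 h⟩
    have h1 : g.form x (ξ - η) w = g.form x ξ w - g.form x η w := by rw [map_sub]; rfl
    rw [h1, hξ, hη, sub_self]
  · intro x hx
    set φ := chartAt (Coord m) x with hφ
    have hc : φ ∈ IsManifold.maximalAtlas (𝓡 m) ∞ M := IsManifold.chart_mem_maximalAtlas x
    have hxc : x ∈ φ.source := mem_chart_source _ x
    have hXs := hX.1.smoothNear hV hc hxc hx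
    have hYs := hY.1.smoothNear hV hc hxc hx
    obtain ⟨n, hn, hne⟩ : ∃ n, SmoothNear n (φ x) ∧ ∀ᶠ y in 𝓝 (φ x),
        gramDet (coordMetric g φ) y ≠ 0 → coordMetric g φ y (n y) =
          coordDualConn (coordMetric g φ) (coordField φ X) (coordField φ Y) y := by
      by_cases hs : x ∈ singularSet g
      · exact (flatGerm_of_secondForm_eq_zero hR hV hc hxc hx hII).exists_nabla
          (transverseMetric_coordMetric hg hc hxc hs) (hR.radicalGerm hV hc hxc hx) hXs hYs
          (hX.eventually hV hc hxc hx) (hY.eventually hV hc hxc hx)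
      · have hG := localMetric_coordMetric g hc (φ.map_source hxc)
        exact ⟨_, (hG.smooth_inverse fun h => hs ((mem_singularSet_iff hc hxc).2 h)).clm_apply
          (hG.smooth_coordDualConn hXs hYs), .of_forall fun y hy => inverse_apply hy _⟩
    have hev := (φ.continuousAt hxc).eventually ((hn.and hne).and hYs)
    obtain ⟨W, hW, hWo, hxW⟩ := mem_nhds_iff.1 (Filter.inter_mem hev
      (Filter.inter_mem (φ.open_source.mem_nhds hxc) (hV.mem_nhds hx)))
    refine ⟨liftField φ n, W, hWo, hxW, fun y hy => (hW hy).2.2,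
      smoothFieldOn_liftField hc (fun y hy => (hW hy).2.1) fun y hy => (hW hy).1.1.1,
      fun y hy hs w => ?_⟩
    obtain ⟨⟨⟨-, h1⟩, h2⟩, h3, -⟩ := hW hy
    rw [dualConn_eq hc h3 h2, ← coordMetric_chartDiff g hc h3, chartDiff_liftField hc h3,
      h1 fun h => hs ((mem_singularSet_iff hc h3).2 h)]

/-- In dimension at least two, `g_Σ` does not vanish when the radical is transverse. -/
theorem exists_form_ne_zero (hm : 2 ≤ m) (hg : IsTransverseTypeChanging g)
    (hT : RadicalTransverse g) (hs : x ∈ singularSet g) :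
    ∃ u ∈ tangentSigma g x, ∃ v ∈ tangentSigma g x, g.form x u v ≠ 0 := by
  have hc := IsManifold.chart_mem_maximalAtlas (I := 𝓡 m) (n := ∞) x
  have hxc := mem_chart_source (Coord m) x
  have hG := transverseMetric_coordMetric hg hc hxc hs
  obtain ⟨r, hr0, hr⟩ := gramDet_eq_zero_iff.1 ((mem_singularSet_iff hc hxc).1 hs)
  have hd := hT.fderiv_ne hc hxc hs hr hr0
  set G := coordMetric g (chartAt (Coord m) x)
  set p := chartAt (Coord m) x x
  obtain ⟨u, hu0, hu⟩ : ∃ u : Coord m, u ≠ 0 ∧ fderiv ℝ (gramDet G) p u = 0 := by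
    have h := (fderiv ℝ (gramDet G) p).toLinearMap.ker_ne_bot_of_finrank_lt (by
      rw [Module.finrank_self, finrank_euclideanSpace_fin]
      exact hm)
    obtain ⟨u, hu, hu0⟩ := Submodule.exists_mem_ne_zero_of_ne_bot h
    exact ⟨u, hu0, hu⟩
  by_contra! h
  have h1 : G p u = 0 := by
    ext w
    have hw : fderiv ℝ (gramDet G) p
        (w - (fderiv ℝ (gramDet G) p w * (fderiv ℝ (gramDet G) p r)⁻¹) • r) = 0 := by
      rw [map_sub, map_smul, smul_eq_mul]
      field_simp
      ring
    obtain ⟨u', rfl⟩ := chartDiff_surjective hc hxc u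
    obtain ⟨w', hw'⟩ := chartDiff_surjective hc hxc
      (w - (fderiv ℝ (gramDet G) p w * (fderiv ℝ (gramDet G) p r)⁻¹) • r)
    rw [← hw'] at hw
    have h2 := h u' ((mem_tangentSigma_iff hc hxc hs u').2 hu) w'
      ((mem_tangentSigma_iff hc hxc hs w').2 hw)
    rw [← coordMetric_chartDiff g hc hxc, hw', map_sub, map_smul, hG.symm_self _ r, hr] at h2
    simpa using h2
  obtain ⟨a, rfl⟩ := hG.exists_eq_smul hr0 hr h1
  rw [map_smul, smul_eq_mul] at hu
  rcases mul_eq_zero.1 hu with h | h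
  · exact hu0 (by rw [h, zero_smul])
  · exact hd h

theorem WeylExtends.isConformallyIIIFlatOn (hm : 4 ≤ m) (hg : IsTransverseTypeChanging g)
    (hW : WeylExtends g) (hU : IsOpen U) (hII : IsIIFlatOn g U) : IsConformallyIIIFlatOn g U := by
  refine ⟨hII, ?_⟩
  obtain ⟨R, hR, hII⟩ := hII
  have hT := hW.radicalTransverse hm hg
  let P : M → ℝ → Prop := fun x k => ∀ V : Set M, IsOpen V → V ⊆ U → x ∈ V →
    ∀ X Y N : ∀ x : M, TangentSpace (𝓡 m) x, IsTangentField g X V → IsTangentField g Y V →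
      ExtendsNabla g X Y N V → secondForm g x (R x) (N x) (R x) = k * g.form x (X x) (Y x)
  have hloc : ∀ x ∈ singularSet g ∩ U, ∃ V : Set M, IsOpen V ∧ x ∈ V ∧ V ⊆ U ∧ ∃ k : M → ℝ,
      ContMDiffOn (𝓡 m) 𝓘(ℝ, ℝ) ∞ k V ∧ ∀ y ∈ singularSet g ∩ V, P y (k y) := by
    rintro x ⟨hs, hxU⟩
    set φ := chartAt (Coord m) x with hφ
    have hc : φ ∈ IsManifold.maximalAtlas (𝓡 m) ∞ M := IsManifold.chart_mem_maximalAtlas x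
    have hxc : x ∈ φ.source := mem_chart_source _ x
    have hG := transverseMetric_coordMetric hg hc hxc hs
    have hp := (mem_singularSet_iff hc hxc).1 hs
    have hRg := hR.radicalGerm hU hc hxc hxU
    obtain ⟨hr, hr0⟩ := hRg.radical.self_of_nhds hp
    obtain ⟨κ, hκ⟩ := (flatGerm_of_secondForm_eq_zero hR hU hc hxc hxU hII).exists_curvExtension
      hG hRg (hT.fderiv_ne hc hxc hs hr hr0)
    obtain ⟨k, hk, hke⟩ := (hW.weylExtendsNear hc hxc).jacobi_eq hm hG hp hRg hκ
    have hev := (φ.continuousAt hxc).eventually ((hk.and hke).and hκ.eventually)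
    obtain ⟨W, hW, hWo, hxW⟩ := mem_nhds_iff.1 (Filter.inter_mem hev
      (Filter.inter_mem (φ.open_source.mem_nhds hxc) (hU.mem_nhds hxU)))
    refine ⟨W, hWo, hxW, fun y hy => (hW hy).2.2, fun y => k (φ y), fun y hy =>
      (contMDiffAt_comp_chart hc (hW hy).2.1 (hW hy).1.1.1).contMDiffWithinAt, ?_⟩
    rintro y ⟨hsy, hyW⟩ V hV hVU hyV X Y N hX hY hN
    obtain ⟨⟨⟨-, h1⟩, h2⟩, hy, hyU⟩ := hW hyW
    have hGy := transverseMetric_coordMetric hg hc hy hsy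
    have hpy := (mem_singularSet_iff hc hy).1 hsy
    have hRy := hR.radicalGerm hU hc hy hyU
    obtain ⟨hry, hry0⟩ := hRy.radical.self_of_nhds hpy
    have h3 := h2.thirdForm_eq hGy hpy hRy (hT.fderiv_ne hc hy hsy hry hry0)
      (flatGerm_of_secondForm_eq_zero hR hU hc hy hyU hII) (hX.1.smoothNear hV hc hy hyV)
      (hY.1.smoothNear hV hc hy hyV) (hN.1.smoothNear hV hc hy hyV)
      ((hX.eventually hV hc hy hyV).self_of_nhds hpy) (hY.eventually hV hc hy hyV)
      (hN.eventually hV hY.1 hc hy hyV)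
    rw [h1 hpy, coordField, coordField, coordField, coordField, φ.left_inv hy,
      coordMetric_chartDiff g hc hy, ← secondForm_eq hc hy (hR.2 y ⟨hsy, hyU⟩).1] at h3
    exact h3
  have huniq : ∀ x ∈ singularSet g ∩ U, ∀ k k', P x k → P x k' → k = k' := by
    rintro x ⟨hs, hxU⟩ k k' hk hk'
    obtain ⟨u, hu, v, hv, huv⟩ := exists_form_ne_zero (by omega) hg hT hs
    obtain ⟨X, rfl, V, hV, hxV, hX⟩ := exists_isTangentField hg hT hs hu
    obtain ⟨Y, rfl, V', hV', hxV', hY⟩ := exists_isTangentField hg hT hs hv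
    have hVo := (hV.inter hV').inter hU
    have hsub : V ∩ V' ∩ U ⊆ U := inter_subset_right
    have hX' : IsTangentField g X (V ∩ V' ∩ U) :=
      ⟨hX.1.mono fun y hy => hy.1.1, fun y hy => hX.2 y ⟨hy.1, hy.2.1.1⟩⟩
    have hY' : IsTangentField g Y (V ∩ V' ∩ U) :=
      ⟨hY.1.mono fun y hy => hy.1.2, fun y hy => hY.2 y ⟨hy.1, hy.2.1.2⟩⟩
    obtain ⟨N, hN⟩ := exists_extendsNabla hg hVo
      ⟨hR.1.mono hsub, fun y hy => hR.2 y ⟨hy.1, hsub hy.2⟩⟩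
      (fun y hy => hII y ⟨hy.1, hsub hy.2⟩) hX' hY'
    have h1 := hk _ hVo hsub ⟨⟨hxV, hxV'⟩, hxU⟩ X Y N hX' hY' hN
    rw [hk' _ hVo hsub ⟨⟨hxV, hxV'⟩, hxU⟩ X Y N hX' hY' hN] at h1
    exact (mul_right_cancel₀ huv h1).symm
  choose! V hV hxV hVU k hk hkP using hloc
  refine ⟨R, hR, fun x => k x x, fun x hx => ⟨V x, hV x hx, hxV x hx, k x, hk x hx,
    fun y hy => ?_⟩, fun W hW hWU X Y hX hY => ?_⟩
  · have hyU : y ∈ singularSet g ∩ U := ⟨hy.1, hVU x hx hy.2⟩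
    exact huniq y hyU _ _ (hkP x hx y hy) (hkP y hyU y ⟨hy.1, hxV y hyU⟩)
  · obtain ⟨N, hN⟩ := exists_extendsNabla hg hW
      ⟨hR.1.mono hWU, fun y hy => hR.2 y ⟨hy.1, hWU hy.2⟩⟩
      (fun y hy => hII y ⟨hy.1, hWU hy.2⟩) hX hY
    refine ⟨N, hN, fun x hx => ?_⟩
    have hxU : x ∈ singularSet g ∩ U := ⟨hx.1, hWU hx.2⟩
    exact hkP x hxU x ⟨hx.1, hxV x hxU⟩ W hW hWU hx.2 X Y N hX hY hN

end Necessity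

/-! ### From conformal flatness of second and third order to an extendible Weyl tensor -/

section Sufficiency

variable {m : ℕ} {M : Type*} [TopologicalSpace M] [ChartedSpace (Coord m) M]
  [IsManifold (𝓡 m) ∞ M] {φ : OpenPartialHomeomorph M (Coord m)} {g : SymTensorField m M}
  {x : M} {X Y N R : ∀ x : M, TangentSpace (𝓡 m) x} {U V : Set M}

/-- A smooth function on a neighbourhood of `x` agrees near `x` with a smooth function on `M`. -/
theorem exists_contMDiff_eventuallyEq [T2Space M] [SigmaCompactSpace M] {W : Set M}
    (hW : W ∈ 𝓝 x) {q : M → ℝ} (hq : ContMDiffOn (𝓡 m) 𝓘(ℝ, ℝ) ∞ q W) :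
    ∃ f : M → ℝ, ContMDiff (𝓡 m) 𝓘(ℝ, ℝ) ∞ f ∧ f =ᶠ[𝓝 x] q := by
  have : LocallyCompactSpace M := ChartedSpace.locallyCompactSpace (Coord m) M
  obtain ⟨K, hK, hKc, hKW⟩ := exists_mem_nhds_isClosed_subset (interior_mem_nhds.2 hW)
  let t : M → Set ℝ := fun y => {c | y ∈ K → c = q y}
  have ht : ∀ y, Convex ℝ (t y) := by
    intro y a ha b hb s s' _ _ hss hy
    rw [ha hy, hb hy, ← add_smul, hss, one_smul]
  obtain ⟨f, hf⟩ := exists_contMDiffMap_forall_mem_convex_of_local (n := ⊤) (𝓡 m) (t := t) ht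
    fun y => by
      by_cases hy : y ∈ K
      · exact ⟨interior W, isOpen_interior.mem_nhds (hKW hy), q, hq.mono interior_subset,
          fun z _ _ => rfl⟩
      · exact ⟨Kᶜ, hKc.isOpen_compl.mem_nhds hy, fun _ => 0, contMDiffOn_const,
          fun z hz hzK => (hz hzK).elim⟩
  exact ⟨f, f.contMDiff, Filter.mem_of_superset hK fun y hy => hf y hy⟩

/-- A conformally `II`-flat metric is locally conformal to a `II`-flat one: if `δ` is a local
equation of `Σ`, the factor `e^{2f}` with `f = δ h / dδ(R)` has `df(R) = h` along `Σ`, which cancels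
`II^R = h g`. -/
theorem IsConformallyIIFlat.exists_isIIFlatOn [T2Space M] [SigmaCompactSpace M]
    (hg : IsTransverseTypeChanging g) (hT : RadicalTransverse g) (hII : IsConformallyIIFlat g)
    (hs : x ∈ singularSet g) :
    ∃ g' ∈ conformalClass g, ∃ U : Set M, IsOpen U ∧ x ∈ U ∧ IsIIFlatOn g' U := by
  obtain ⟨R, hR, h, hh, hII⟩ := hII
  set φ := chartAt (Coord m) x with hφ
  have hc : φ ∈ IsManifold.maximalAtlas (𝓡 m) ∞ M := IsManifold.chart_mem_maximalAtlas x
  have hxc : x ∈ φ.source := mem_chart_source _ x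
  have hG := transverseMetric_coordMetric hg hc hxc hs
  have hp := (mem_singularSet_iff hc hxc).1 hs
  have hRg := hR.radicalGerm isOpen_univ hc hxc (mem_univ x)
  obtain ⟨hr, hr0⟩ := hRg.radical.self_of_nhds hp
  have hd := hG.smooth_gramDet.fderiv_right.clm_apply hRg.smooth
  have hd0 := hT.fderiv_ne hc hxc hs hr hr0
  obtain ⟨V, hV, hxV, η, hη, hηh⟩ := hh x ⟨hs, mem_univ x⟩
  have hηs := smoothNear_comp_symm hc (φ.map_source hxc) hV (by rwa [φ.left_inv hxc]) hη
  have hσ := hηs.mul (hd.inv hd0)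
  set σ : Coord m → ℝ := fun y => η (φ.symm y) *
    (fderiv ℝ (gramDet (coordMetric g φ)) y (coordField φ R y))⁻¹ with hσd
  have hq := hG.smooth_gramDet.mul hσ
  set q : Coord m → ℝ := fun y => gramDet (coordMetric g φ) y * σ y with hqd
  obtain ⟨f, hf, hfq⟩ := exists_contMDiff_eventuallyEq (x := x) (q := fun y => q (φ y))
    (Filter.inter_mem ((φ.continuousAt hxc).eventually hq) (φ.open_source.mem_nhds hxc))
    fun y hy => (contMDiffAt_comp_chart hc hy.2 hy.1).contMDiffWithinAt
  have hev := (φ.continuousAt hxc).eventually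
    (hσ.eventually.and (hd.continuousAt.eventually_ne hd0))
  obtain ⟨U, hU, hUo, hxU⟩ := mem_nhds_iff.1 (Filter.inter_mem (Filter.inter_mem hev
    (eventually_eventually_nhds.2 hfq))
    (Filter.inter_mem (φ.open_source.mem_nhds hxc) (hV.mem_nhds hxV)))
  have hmem := conformalChange_mem (g := g) hf
  refine ⟨conformalChange g hf, hmem, U, hUo, hxU, R, ?_, ?_⟩
  · have := hR.of_mem_conformalClass hmem
    exact ⟨this.1.mono (subset_univ _), fun y hy => this.2 y ⟨hy.1, mem_univ _⟩⟩
  · rintro y ⟨hsy, hyU⟩ u hu v hv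
    rw [singularSet_eq_of_mem_conformalClass hmem] at hsy
    rw [tangentSigma_eq_of_mem_conformalClass hmem hsy] at hu hv
    obtain ⟨⟨⟨hσy, hdy⟩, hfy⟩, hy, hyV⟩ := hU hyU
    have hRy := (hR.2 y ⟨hsy, mem_univ _⟩).1
    have hGy := localMetric_coordMetric g hc (φ.map_source hy)
    have hpy := (mem_singularSet_iff hc hy).1 hsy
    have hRd : coordField φ R (φ y) = chartDiff φ y (R y) := by rw [coordField, φ.left_inv hy]
    have h1 : (fun z => f (φ.symm z)) =ᶠ[𝓝 (φ y)] q := by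
      have h2 := φ.continuousAt_symm (φ.map_source hy)
      rw [ContinuousAt, φ.left_inv hy] at h2
      filter_upwards [h2.eventually hfy, φ.open_target.mem_nhds (φ.map_source hy)] with z hz hzt
      rw [hz, φ.right_inv hzt]
    have h2 : fderiv ℝ (fun z => f (φ.symm z)) (φ y) (chartDiff φ y (R y)) = h y := by
      have h3 : σ (φ y) * fderiv ℝ (gramDet (coordMetric g φ)) (φ y) (chartDiff φ y (R y)) =
          h y := by
        rw [← hηh y ⟨hsy, hyV⟩, hσd, ← hRd]
        have h4 : fderiv ℝ (gramDet (coordMetric g φ)) (φ y) (coordField φ R (φ y)) ≠ 0 := hdy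
        simp only [φ.left_inv hy]
        field_simp
      rw [h1.fderiv_eq, hqd, fderiv_fun_mul hGy.smooth_gramDet.differentiableAt
        hσy.differentiableAt, hpy, zero_smul, zero_add, smul_apply, smul_eq_mul, h3]
    have h3 := hII y hsy u hu v hv
    rw [secondForm_eq hc hy hRy, ← coordMetric_chartDiff g hc hy] at h3
    have hRy' := hRy
    rw [← radical_eq_of_mem_conformalClass hmem] at hRy'
    rw [secondForm_eq hc hy hRy', (conformalGerm_coordMetric hf (fun _ => rfl) hc
      hy).christoffelFirst_radical hGy ((mem_radical_iff hc hy _).1 hRy), h2, h3, sub_self,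
      mul_zero]

theorem IsConformallyIIIFlatOn.weylExtendsNear (hm : 4 ≤ m) (hg : IsTransverseTypeChanging g)
    (hT : RadicalTransverse g) (hU : IsOpen U) (h : IsConformallyIIIFlatOn g U)
    (hφ : φ ∈ IsManifold.maximalAtlas (𝓡 m) ∞ M) (hx : x ∈ φ.source) (hxU : x ∈ U)
    (hs : x ∈ singularSet g) : WeylExtendsNear (coordMetric g φ) (φ x) := by
  obtain ⟨⟨R₀, hR₀, hII⟩, R, hR, k, -, hIII⟩ := h
  have hflat : ∀ y ∈ singularSet g ∩ U, y ∈ φ.source →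
      FlatGerm (coordMetric g φ) (coordField φ R) (φ y) := fun y hy hyφ =>
    (flatGerm_of_secondForm_eq_zero hR₀ hU hφ hyφ hy.2 hII).of_radicalGerm
      (transverseMetric_coordMetric hg hφ hyφ hy.1) (hR₀.radicalGerm hU hφ hyφ hy.2)
      (hR.radicalGerm hU hφ hyφ hy.2)
  have hG := transverseMetric_coordMetric hg hφ hx hs
  have hp := (mem_singularSet_iff hφ hx).1 hs
  have hRg := hR.radicalGerm hU hφ hx hxU
  obtain ⟨hr, hr0⟩ := hRg.radical.self_of_nhds hp
  obtain ⟨κ, hκ⟩ := (hflat x ⟨hs, hxU⟩ hx).exists_curvExtension hG hRg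
    (hT.fderiv_ne hφ hx hs hr hr0)
  refine hκ.weylExtendsNear hm hG hp hRg ?_
  filter_upwards [eventually_mem_source (φ.map_source hx) hU (by rwa [φ.left_inv hx]),
    hκ.eventually] with z hz hκz h0
  obtain ⟨y, hy, rfl⟩ : ∃ y ∈ φ.source, φ y = z := ⟨φ.symm z, φ.map_target hz.1, φ.right_inv hz.1⟩
  have hyU : y ∈ U := by
    have := hz.2
    rwa [φ.left_inv hy] at this
  have hsy := (mem_singularSet_iff (g := g) hφ hy).2 h0
  have hGy := transverseMetric_coordMetric hg hφ hy hsy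
  have hRy := hR.radicalGerm hU hφ hy hyU
  obtain ⟨hry, hry0⟩ := hRy.radical.self_of_nhds h0
  have hd := hT.fderiv_ne hφ hy hsy hry hry0
  set G := coordMetric g φ
  set p := φ y
  set r := coordField φ R p with hrd
  have key : ∀ u v : Coord m, fderiv ℝ (gramDet G) p u = 0 → fderiv ℝ (gramDet G) p v = 0 →
      κ p r u r v = k y * G p u v := by
    intro u v hu hv
    obtain ⟨u, rfl⟩ := chartDiff_surjective hφ hy u
    obtain ⟨v, rfl⟩ := chartDiff_surjective hφ hy v
    obtain ⟨X, rfl, V, hV, hyV, hX⟩ := exists_isTangentField hg hT hsy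
      ((mem_tangentSigma_iff hφ hy hsy u).2 hu)
    obtain ⟨Y, rfl, V', hV', hyV', hY⟩ := exists_isTangentField hg hT hsy
      ((mem_tangentSigma_iff hφ hy hsy v).2 hv)
    have hVo := (hV.inter hV').inter hU
    have hyo : y ∈ V ∩ V' ∩ U := ⟨⟨hyV, hyV'⟩, hyU⟩
    have hX' : IsTangentField g X (V ∩ V' ∩ U) :=
      ⟨hX.1.mono fun y hy => hy.1.1, fun y hy => hX.2 y ⟨hy.1, hy.2.1.1⟩⟩
    have hY' : IsTangentField g Y (V ∩ V' ∩ U) :=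
      ⟨hY.1.mono fun y hy => hy.1.2, fun y hy => hY.2 y ⟨hy.1, hy.2.1.2⟩⟩
    obtain ⟨N, hN, hNe⟩ := hIII _ hVo inter_subset_right X Y hX' hY'
    have h1 := hNe y ⟨hsy, hyo⟩
    have h3 := hκz.thirdForm_eq hGy h0 hRy hd (hflat y ⟨hsy, hyU⟩ hy)
      (hX'.1.smoothNear hVo hφ hy hyo) (hY'.1.smoothNear hVo hφ hy hyo)
      (hN.1.smoothNear hVo hφ hy hyo) ((hX'.eventually hVo hφ hy hyo).self_of_nhds h0)
      (hY'.eventually hVo hφ hy hyo) (hN.eventually hVo hY'.1 hφ hy hyo)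
    rw [secondForm_eq hφ hy (hR.2 y ⟨hsy, hyU⟩).1, ← coordMetric_chartDiff g hφ hy] at h1
    have h4 : ∀ Z : ∀ x : M, TangentSpace (𝓡 m) x, coordField φ Z p = chartDiff φ y (Z y) :=
      fun Z => by rw [coordField, φ.left_inv hy]
    rw [← h4, ← h4, ← h4, ← h4] at h1
    rw [← h4, ← h4, ← h1, h3]
  refine ⟨k y, fun v t => ?_⟩
  have hsplit : ∀ w : Coord m, ∃ (a : ℝ) (w' : Coord m),
      fderiv ℝ (gramDet G) p w' = 0 ∧ w = w' + a • r := by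
    intro w
    refine ⟨fderiv ℝ (gramDet G) p w * (fderiv ℝ (gramDet G) p r)⁻¹,
      w - (fderiv ℝ (gramDet G) p w * (fderiv ℝ (gramDet G) p r)⁻¹) • r, ?_, by abel⟩
    rw [map_sub, map_smul, smul_eq_mul]
    field_simp
    ring
  obtain ⟨a, v, hv, rfl⟩ := hsplit v
  obtain ⟨b, t, ht, rfl⟩ := hsplit t
  have h1 : ∀ w t, κ p r r w t = 0 := hκz.self_left hGy r
  have h2 : ∀ v, κ p r v r r = 0 := fun v => hκz.self_right hGy r v r
  have h3 : ∀ w, G p w r = 0 := fun w => by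
    rw [hGy.symm_self, hry]
    rfl
  simp only [map_add, map_smul, add_apply, smul_apply, h1, h2, h3, hry, key v t hv ht, smul_zero,
    add_zero]

end Sufficiency

end RiemannLorentz

theorem theorem3p5 (m : ℕ) (hm : 4 ≤ m) (M : Type*) [TopologicalSpace M]
    [ChartedSpace (RiemannLorentz.Coord m) M] [IsManifold (𝓡 m) ∞ M] [T2Space M]
    [SecondCountableTopology M] [ConnectedSpace M]
    (𝒞 : Set (RiemannLorentz.SymTensorField m M))
    (h𝒞 : RiemannLorentz.IsTransverseRiemannLorentzConformal 𝒞)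
    (g : RiemannLorentz.SymTensorField m M) (hg : g ∈ 𝒞) :
    RiemannLorentz.WeylExtends g ↔
      RiemannLorentz.RadicalTransverse g ∧ RiemannLorentz.ConformallyIIIFlat 𝒞 := by
  open RiemannLorentz in
  obtain ⟨g₀, hg₀, rfl⟩ := h𝒞
  have : LocallyCompactSpace M := ChartedSpace.locallyCompactSpace (Coord m) M
  have hgt : IsTransverseTypeChanging g := hg₀.transverse.of_mem_conformalClass hg
  have hmem : ∀ g' ∈ conformalClass g₀, g' ∈ conformalClass g := fun g' hg' =>
    mem_conformalClass_trans (mem_conformalClass_symm hg) hg'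
  constructor
  · intro hW
    refine ⟨hW.radicalTransverse hm hgt, ⟨g, hg, hW.isConformallyIIFlat hm hgt⟩,
      fun g' hg' U hU hII => ?_⟩
    exact (hW.of_mem_conformalClass hm hgt (hmem g' hg')).isConformallyIIIFlatOn hm
      (hgt.of_mem_conformalClass (hmem g' hg')) hU hII
  · rintro ⟨hT, ⟨g₁, hg₁, hII⟩, hIII⟩
    have hg₁t := hgt.of_mem_conformalClass (hmem g₁ hg₁)
    have hT₁ := hT.of_mem_conformalClass (hmem g₁ hg₁)
    refine WeylExtends.of_mem_conformalClass hm hg₁t ?_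
      (mem_conformalClass_symm (hmem g₁ hg₁))
    refine weylExtends_of_weylExtendsNear hg₁t fun φ hφ x hx => ?_
    have hG := localMetric_coordMetric g₁ hφ (φ.map_source hx)
    by_cases hs : x ∈ singularSet g₁
    · obtain ⟨g₂, hg₂, U, hU, hxU, hII₂⟩ := hII.exists_isIIFlatOn hg₁t hT₁ hs
      have hW := (hIII g₂ (mem_conformalClass_trans hg₁ hg₂) U hU hII₂).weylExtendsNear hm
        (hg₁t.of_mem_conformalClass hg₂) (hT₁.of_mem_conformalClass hg₂) hU hφ hx hxU
        (by rwa [singularSet_eq_of_mem_conformalClass hg₂])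
      obtain ⟨f, hf, h⟩ := mem_conformalClass_symm hg₂
      exact (conformalGerm_coordMetric hf h hφ hx).weylExtendsNear hm
        (localMetric_coordMetric g₂ hφ (φ.map_source hx)) hW
    · exact hG.weylExtendsNear fun h => hs ((mem_singularSet_iff hφ hx).2 h)
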